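/- Let $U_1,\dots,U_n$ be independent and uniformly distributed on the unit sphere $\mathbb{S}^{d-1}\subset\mathbb{R}^d$, and for $p\in(0,1/2]$ let $\tau(p,d)$ be the number with $\mathbb{P}(\langle U,V\rangle\ge\tau(p,d))=p$, where $U,V$ are independent and uniform on $\mathbb{S}^{d-1}$. The random geometric graph $\mathcal{G}(n,p,d)$ is the graph $G$ on $\{1,\dots,n\}$ in which distinct vertices $i,j$ are adjacent if and only if $\langle U_i,U_j\rangle\ge\tau(p,d)$; write $G_{ij}\in\{0,1\}$ for the indicator of the edge $ij$. There exist absolute constants $C>0$ and $d_0\in\mathbb{N}$ such that for all integers $n$, $\ell$, $d$ with $3\le\ell\le n$ and $d\ge d_0$, all $p\in(0,1/2]$ with $d\ge(5\log(1/p))^4$, and every cycle $H$ of length $\ell$ in the complete graph on $\{1,\dots,n\}$, $$\frac{1}{C^{\ell}}\cdot\frac{p^{\ell}\,(\log(1/p))^{\ell/2}}{d^{\ell/2-1}}\;\le\;\mathbb{E}_{G\sim\mathcal{G}(n,p,d)}\Big[\prod_{ij\in E(H)}(G_{ij}-p)\Big]\;\le\;C^{\ell}\cdot\frac{p^{\ell}\,(\log(1/p))^{\ell/2}}{d^{\ell/2-1}}.$$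 -/

import Mathlib

open MeasureTheory

namespace SphereRGG

/-- The unit sphere of `ℝᵈ` with the Euclidean norm. -/
abbrev UnitSphere (d : ℕ) : Type :=
  Metric.sphere (0 : EuclideanSpace ℝ (Fin d)) 1

/-- The uniform distribution on the unit sphere of `ℝᵈ`: the surface measure, normalized to have
total mass one. -/
noncomputable def uniformSphere (d : ℕ) : Measure (UnitSphere d) :=
  ((volume : Measure (EuclideanSpace ℝ (Fin d))).toSphere Set.univ)⁻¹ •
    (volume : Measure (EuclideanSpace ℝ (Fin d))).toSphere

instance (d : ℕ) : IsFiniteMeasure (uniformSphere d) := by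
  constructor
  rw [uniformSphere, Measure.smul_apply, smul_eq_mul]
  exact lt_of_le_of_lt (ENNReal.inv_mul_le_one _) ENNReal.one_lt_top

instance (d : ℕ) [NeZero d] : IsProbabilityMeasure (uniformSphere d) := by
  constructor
  have h0 : (volume : Measure (EuclideanSpace ℝ (Fin d))).toSphere Set.univ ≠ 0 := by
    rw [Ne, Measure.measure_univ_eq_zero]
    exact Measure.toSphere_ne_zero _
  rw [uniformSphere, Measure.smul_apply, smul_eq_mul]
  exact ENNReal.inv_mul_cancel h0 (measure_ne_top _ _)

/-- `ℙ(⟨U, V⟩ ≥ t)` for independent uniform points `U, V` of the unit sphere of `ℝᵈ`. -/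
noncomputable def innerTail (d : ℕ) (t : ℝ) : ℝ :=
  ((uniformSphere d).prod (uniformSphere d)).real
    {x | t ≤ inner ℝ (x.1 : EuclideanSpace ℝ (Fin d)) (x.2 : EuclideanSpace ℝ (Fin d))}

/-- The connection threshold `τ(p, d)`, chosen so that `ℙ(⟨U, V⟩ ≥ τ(p, d)) = p`. For `d ≥ 2` and
`0 < p < 1` there is exactly one such number, because the law of `⟨U, V⟩` has no atoms and charges
every subinterval of `[-1, 1]`. -/
noncomputable def threshold (p : ℝ) (d : ℕ) : ℝ :=
  Classical.epsilon fun t : ℝ => innerTail d t = p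

theorem innerTail_threshold {p : ℝ} {d : ℕ} (h : ∃ t, innerTail d t = p) :
    innerTail d (threshold p d) = p :=
  Classical.epsilon_spec h

/-- The geometric graph of the latent vectors `x`: distinct vertices `i, j` are adjacent iff
`⟨x i, x j⟩ ≥ t`. -/
def geometricGraph {V : Type*} {d : ℕ} (t : ℝ) (x : V → UnitSphere d) : SimpleGraph V where
  Adj i j := i ≠ j ∧
    t ≤ inner ℝ (x i : EuclideanSpace ℝ (Fin d)) (x j : EuclideanSpace ℝ (Fin d))
  symm := ⟨fun i j h => ⟨h.1.symm, by rw [real_inner_comm]; exact h.2⟩⟩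
  loopless := ⟨fun _ h => h.1 rfl⟩

theorem measurable_geometricGraph {V : Type*} {d : ℕ} (t : ℝ) :
    Measurable (geometricGraph t : (V → UnitSphere d) → SimpleGraph V) := by
  rw [SimpleGraph.measurable_iff_adj]
  intro i j
  refine Measurable.and measurable_const (measurableSet_setOfPred.1 ?_)
  refine measurableSet_le measurable_const (Measurable.inner ?_ ?_)
  · exact measurable_subtype_coe.comp (measurable_pi_apply i)
  · exact measurable_subtype_coe.comp (measurable_pi_apply j)

/-- The random geometric graph `𝒢(n, p, d)`, as a law on graphs with vertex set `Fin n`: the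
geometric graph with threshold `τ(p, d)` of `n` independent uniform points of the unit sphere. -/
noncomputable def randomGeometricGraph (n : ℕ) (p : ℝ) (d : ℕ) : Measure (SimpleGraph (Fin n)) :=
  (Measure.pi fun _ : Fin n => uniformSphere d).map (geometricGraph (threshold p d))

instance (n : ℕ) (p : ℝ) (d : ℕ) [NeZero d] :
    IsProbabilityMeasure (randomGeometricGraph n p d) :=
  Measure.isProbabilityMeasure_map (measurable_geometricGraph _).aemeasurable

open Classical in
/-- The signed weight `∏_{ij ∈ E(H)} (G_{ij} - p)` of a subgraph `H` of the complete graph, where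
`G_{ij}` is the indicator that `ij` is an edge of `G`. -/
noncomputable def signedWeight {V : Type*} [Fintype V] (p : ℝ) (H G : SimpleGraph V) : ℝ :=
  ∏ e ∈ H.edgeFinset, ((if e ∈ G.edgeSet then (1 : ℝ) else 0) - p)

end SphereRGG

/-! Integrating out the latent vectors turns the expected signed weight of an ℓ-cycle into the trace
of T^ℓ, where T is the integral operator on the sphere with kernel 1{⟨x, y⟩ ≥ τ} - p
(`integral_signedWeight_cycle`). T is symmetric and commutes with rotations. It kills constants, and
by the degree-one Funk–Hecke formula it acts on the d-dimensional space of linear functions as one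
scalar λ. With g the kernel left after removing the linear part, tr T^ℓ = d λ^ℓ + tr g^ℓ
(`kpow_eq_add_deflate`). With L = log(1/p), it therefore suffices that d λ² is comparable to p² L
and that |tr g^ℓ| ≤ d λ^ℓ / 2.

Both facts are read off T². Its kernel at (x, y) is the measure of the intersection of two caps
minus p², a function of s = ⟨x, y⟩ only. Gaussian integration in the plane of x and y gives this
function as a one-dimensional integral with explicit derivative in s. The slope at s = 0 is
comparable to p² L, and the remainder R(s) of the linear approximation is O(p² L² s²) while L|s| is
small. The hypothesis d ≥ (5L)^4 allows the cut-off |s| ≤ d^(-1/4), beyond which s lies with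
negligible probability. Testing T² on linear functions gives d λ² = slope + d E[s R(s)], so the
first fact follows from moment bounds. Moreover g² is R projected off the affine functions, so its
squared Hilbert–Schmidt norm is at most E[R²] = O(p⁴ L⁴ / d²), far below d λ⁴, which is of order p⁴
L² / d.

For ℓ ≥ 4 the trace of g^ℓ is controlled by this norm together with the fact that nontrivial
eigenvalues of an invariant kernel have high multiplicity, hence are at most λ. No spectral theorem
is used: the multiplicity enters through a Bessel inequality for the rows of the kernel at the
coordinate axes (`rowGap_add_le`), and rows are compared through a point orthogonal to both
(`hsSq_le_rowGap`).

For ℓ = 3 Hilbert–Schmidt norms lose powers of p. Instead, since g² is orthogonal to affine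
functions, one factor g may be replaced by the indicator of a cap. The integral of |R| over the cap
gains a further factor p (`abs_kpow_deflate_two_le`). -/

namespace SphereRGG

/-! ### Composition of bounded kernels; integrals along paths and cycles. -/

section Kernel

variable {S : Type*} [MeasurableSpace S]

/-- A bounded jointly measurable kernel. -/
structure IsBddKernel (k : S → S → ℝ) : Prop where
  meas : Measurable (Function.uncurry k)
  bdd : ∃ C, ∀ x y, |k x y| ≤ C

/-- Composition of two kernels with respect to a measure. -/
noncomputable def kcomp (μ : Measure S) (k l : S → S → ℝ) (x y : S) : ℝ :=
  ∫ z, k x z * l z y ∂μ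

/-- `kpow μ k m` is the `(m + 1)`-fold composition of the kernel `k` with itself. -/
noncomputable def kpow (μ : Measure S) (k : S → S → ℝ) : ℕ → S → S → ℝ
  | 0 => k
  | m + 1 => kcomp μ k (kpow μ k m)

theorem integrable_of_bdd {T : Type*} [MeasurableSpace T] {ν : Measure T} [IsFiniteMeasure ν]
    {φ : T → ℝ} (hm : Measurable φ) {C : ℝ} (hC : ∀ x, |φ x| ≤ C) : Integrable φ ν :=
  Integrable.of_bound hm.aestronglyMeasurable C (Filter.Eventually.of_forall hC)

theorem IsBddKernel.nonneg_bound {k : S → S → ℝ} (hk : IsBddKernel k) :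
    ∃ C, 0 ≤ C ∧ ∀ x y, |k x y| ≤ C := by
  obtain ⟨C, hC⟩ := hk.bdd
  exact ⟨max C 0, le_max_right _ _, fun x y => (hC x y).trans (le_max_left _ _)⟩

theorem IsBddKernel.comp_measurable {k : S → S → ℝ} (hk : IsBddKernel k) {T : Type*}
    [MeasurableSpace T] {u v : T → S} (hu : Measurable u) (hv : Measurable v) :
    Measurable fun t => k (u t) (v t) :=
  hk.meas.comp (hu.prodMk hv)

theorem IsBddKernel.measurable_left {k : S → S → ℝ} (hk : IsBddKernel k) (x : S) :
    Measurable (k x) := hk.comp_measurable measurable_const measurable_id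

theorem IsBddKernel.measurable_right {k : S → S → ℝ} (hk : IsBddKernel k) (y : S) :
    Measurable (fun x => k x y) := hk.comp_measurable measurable_id measurable_const

theorem IsBddKernel.integrable {k : S → S → ℝ} (hk : IsBddKernel k) {μ : Measure S}
    [IsFiniteMeasure μ] (x : S) : Integrable (k x) μ := by
  obtain ⟨C, hC⟩ := hk.bdd
  exact integrable_of_bdd (hk.measurable_left x) (hC x)

theorem IsBddKernel.swap {k : S → S → ℝ} (hk : IsBddKernel k) :
    IsBddKernel fun x y => k y x := by
  obtain ⟨C, hC⟩ := hk.bdd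
  exact ⟨hk.comp_measurable measurable_snd measurable_fst, C, fun x y => hC y x⟩

theorem IsBddKernel.mul {k l : S → S → ℝ} (hk : IsBddKernel k) (hl : IsBddKernel l) :
    IsBddKernel fun x y => k x y * l x y := by
  obtain ⟨C, hC0, hC⟩ := hk.nonneg_bound
  obtain ⟨D, hD0, hD⟩ := hl.nonneg_bound
  refine ⟨hk.meas.mul hl.meas, C * D, fun x y => ?_⟩
  rw [abs_mul]
  exact mul_le_mul (hC x y) (hD x y) (abs_nonneg _) hC0

theorem IsBddKernel.sub {k l : S → S → ℝ} (hk : IsBddKernel k) (hl : IsBddKernel l) :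
    IsBddKernel fun x y => k x y - l x y := by
  obtain ⟨C, hC⟩ := hk.bdd
  obtain ⟨D, hD⟩ := hl.bdd
  exact ⟨hk.meas.sub hl.meas, C + D, fun x y =>
    (abs_sub _ _).trans (add_le_add (hC x y) (hD x y))⟩

theorem IsBddKernel.const_mul {k : S → S → ℝ} (hk : IsBddKernel k) (c : ℝ) :
    IsBddKernel fun x y => c * k x y := by
  obtain ⟨C, hC⟩ := hk.bdd
  refine ⟨hk.meas.const_mul c, |c| * C, fun x y => ?_⟩
  rw [abs_mul]
  exact mul_le_mul_of_nonneg_left (hC x y) (abs_nonneg _)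

variable {μ : Measure S} [IsProbabilityMeasure μ]

theorem abs_integral_le_of_bdd {T : Type*} [MeasurableSpace T] {ν : Measure T}
    [IsProbabilityMeasure ν] {φ : T → ℝ} {C : ℝ} (hC : ∀ x, |φ x| ≤ C) : |∫ x, φ x ∂ν| ≤ C := by
  have h := norm_integral_le_of_norm_le_const (μ := ν) (f := φ) (C := C)
    (Filter.Eventually.of_forall hC)
  simpa using h

theorem IsBddKernel.comp {k l : S → S → ℝ} (hk : IsBddKernel k) (hl : IsBddKernel l) :
    IsBddKernel (kcomp μ k l) := by
  obtain ⟨C, hC0, hC⟩ := hk.nonneg_bound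
  obtain ⟨D, hD0, hD⟩ := hl.nonneg_bound
  refine ⟨?_, C * D, fun x y => abs_integral_le_of_bdd fun z => ?_⟩
  · have h : Measurable (Function.uncurry fun (q : S × S) (z : S) => k q.1 z * l z q.2) :=
      (hk.comp_measurable (measurable_fst.comp measurable_fst) measurable_snd).mul
        (hl.comp_measurable measurable_snd (measurable_snd.comp measurable_fst))
    exact (h.stronglyMeasurable.integral_prod_right (ν := μ)).measurable
  · rw [abs_mul]
    exact mul_le_mul (hC x z) (hD z y) (abs_nonneg _) hC0

theorem IsBddKernel.pow {k : S → S → ℝ} (hk : IsBddKernel k) (m : ℕ) :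
    IsBddKernel (kpow μ k m) := by
  induction m with
  | zero => exact hk
  | succ m ih => exact hk.comp ih

theorem kcomp_integrable {k l : S → S → ℝ} (hk : IsBddKernel k) (hl : IsBddKernel l) (x y : S) :
    Integrable (fun z => k x z * l z y) μ := by
  obtain ⟨C, hC0, hC⟩ := hk.nonneg_bound
  obtain ⟨D, hD0, hD⟩ := hl.nonneg_bound
  refine integrable_of_bdd (C := C * D) ((hk.measurable_left x).mul (hl.measurable_right y))
    fun z => ?_
  rw [abs_mul]
  exact mul_le_mul (hC x z) (hD z y) (abs_nonneg _) hC0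

theorem kcomp_assoc {k l r : S → S → ℝ} (hk : IsBddKernel k) (hl : IsBddKernel l)
    (hr : IsBddKernel r) : kcomp μ (kcomp μ k l) r = kcomp μ k (kcomp μ l r) := by
  ext x y
  obtain ⟨C, hC0, hC⟩ := hk.nonneg_bound
  obtain ⟨D, hD0, hD⟩ := hl.nonneg_bound
  obtain ⟨E, hE0, hE⟩ := hr.nonneg_bound
  have hint : Integrable (Function.uncurry fun z w => k x w * l w z * r z y) (μ.prod μ) := by
    refine integrable_of_bdd (C := C * D * E) ?_ fun q => ?_
    · exact ((hk.comp_measurable measurable_const measurable_snd).mul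
        (hl.comp_measurable measurable_snd measurable_fst)).mul
        (hr.comp_measurable measurable_fst measurable_const)
    · simp only [Function.uncurry, abs_mul]
      gcongr
      exacts [hC _ _, hD _ _, hE _ _]
  calc kcomp μ (kcomp μ k l) r x y = ∫ z, ∫ w, k x w * l w z * r z y ∂μ ∂μ := by
        simp only [kcomp, integral_mul_const]
    _ = ∫ w, ∫ z, k x w * l w z * r z y ∂μ ∂μ := integral_integral_swap hint
    _ = kcomp μ k (kcomp μ l r) x y := by
        simp only [kcomp, mul_assoc, integral_const_mul]

theorem kcomp_kpow {k : S → S → ℝ} (hk : IsBddKernel k) (a b : ℕ) :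
    kcomp μ (kpow μ k a) (kpow μ k b) = kpow μ k (a + b + 1) := by
  induction a with
  | zero => simp [kpow]
  | succ a ih =>
    rw [kpow, kcomp_assoc hk (hk.pow a) (hk.pow b), ih, show a + 1 + b + 1 = a + b + 1 + 1 by ring]
    rfl

theorem kpow_symm {k : S → S → ℝ} (hk : IsBddKernel k) (hs : ∀ x y, k x y = k y x) (m : ℕ)
    (x y : S) : kpow μ k m x y = kpow μ k m y x := by
  induction m generalizing x y with
  | zero => exact hs x y
  | succ m ih =>
    -- `kpow` peels a factor off on the left; transposing needs the factor on the right.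
    have h : kpow μ k (m + 1) = kcomp μ (kpow μ k m) (kpow μ k 0) := by rw [kcomp_kpow hk]
    conv_rhs => rw [h]
    simp only [kpow, kcomp]
    refine integral_congr_ae (Filter.Eventually.of_forall fun z => ?_)
    simp only
    rw [hs x z, ih z y, mul_comm]

/-- Integral of a product of kernels along a path with `m + 2` vertices. -/
theorem integral_path {k : S → S → ℝ} (hk : IsBddKernel k) (m : ℕ) {h : S → S → ℝ}
    (hh : IsBddKernel h) :
    ∫ x : Fin (m + 2) → S, h (x 0) (x (Fin.last _)) *
        ∏ i : Fin (m + 1), k (x i.castSucc) (x i.succ) ∂(Measure.pi fun _ => μ) =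
      ∫ a, ∫ b, h a b * kpow μ k m a b ∂μ ∂μ := by
  obtain ⟨C, hC0, hC⟩ := hk.nonneg_bound
  -- Fubini in the first vertex. The weight h on the two endpoints is kept arbitrary so that the
  -- induction can absorb the first edge into it.
  have peel : ∀ (m : ℕ) {h : S → S → ℝ}, IsBddKernel h →
      ∫ x : Fin (m + 2) → S, h (x 0) (x (Fin.last _)) *
        ∏ i : Fin (m + 1), k (x i.castSucc) (x i.succ) ∂(Measure.pi fun _ => μ) =
      ∫ a, ∫ x : Fin (m + 1) → S, h a (x (Fin.last _)) * k a (x 0) *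
        ∏ i : Fin m, k (x i.castSucc) (x i.succ) ∂(Measure.pi fun _ => μ) ∂μ := by
    intro m h hh
    obtain ⟨D, hD0, hD⟩ := hh.nonneg_bound
    have mp := (measurePreserving_piFinSuccAbove (fun _ : Fin (m + 2) => μ) 0).symm
    have hi : Integrable (fun x : Fin (m + 2) → S => h (x 0) (x (Fin.last _)) *
        ∏ i : Fin (m + 1), k (x i.castSucc) (x i.succ)) (Measure.pi fun _ => μ) := by
      refine integrable_of_bdd (C := D * ∏ i : Fin (m + 1), C) ?_ fun x => ?_
      · refine (hh.comp_measurable (measurable_pi_apply _) (measurable_pi_apply _)).mul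
          (Finset.measurable_prod _ fun i _ =>
            hk.comp_measurable (measurable_pi_apply _) (measurable_pi_apply _))
      · rw [abs_mul, Finset.abs_prod]
        gcongr
        exacts [hD _ _, hC _ _]
    rw [← mp.integral_comp (MeasurableEquiv.measurableEmbedding _), integral_prod]
    · simp only [MeasurableEquiv.piFinSuccAbove_symm_apply, Fin.insertNthEquiv_zero,
        Fin.consEquiv_apply, Fin.prod_univ_succ, Fin.castSucc_zero, Fin.cons_zero, Fin.cons_succ,
        ← Fin.succ_last, ← Fin.succ_castSucc, mul_assoc]
    · exact mp.integrable_comp_of_integrable hi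
  induction m generalizing h with
  | zero =>
    rw [peel 0 hh]
    refine integral_congr_ae (Filter.Eventually.of_forall fun a => ?_)
    have mp := (measurePreserving_funUnique μ (Fin 1)).symm
    simp only [Finset.univ_eq_empty, Finset.prod_empty, mul_one]
    exact (mp.integral_comp (MeasurableEquiv.measurableEmbedding _)
      (fun x : Fin 1 → S => h a (x (Fin.last 0)) * k a (x 0))).symm
  | succ m ih =>
    rw [peel (m + 1) hh]
    refine integral_congr_ae (Filter.Eventually.of_forall fun a => ?_)
    obtain ⟨D, hD0, hD⟩ := hh.nonneg_bound
    -- With the first vertex a frozen, the edge from a to b joins the weight on the endpoints b, c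
    -- of the shorter path.
    have hl : IsBddKernel fun b c => h a c * k a b := by
      refine ⟨(hh.comp_measurable measurable_const measurable_snd).mul
        (hk.comp_measurable measurable_const measurable_fst), D * C, fun b c => ?_⟩
      rw [abs_mul]
      exact mul_le_mul (hD _ _) (hC _ _) (abs_nonneg _) hD0
    have := ih hl
    simp only at this ⊢
    rw [this]
    obtain ⟨P, hP0, hP⟩ := (hk.pow (μ := μ) m).nonneg_bound
    rw [integral_integral_swap]
    · refine integral_congr_ae (Filter.Eventually.of_forall fun c => ?_)
      simp only [kpow, kcomp, mul_assoc, integral_const_mul]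
    · exact integrable_of_bdd (hl.mul (hk.pow m)).meas (C := D * C * P) fun q => by
        simp only [Function.uncurry, abs_mul]
        gcongr
        exacts [hD _ _, hC _ _, hP _ _]

/-- Integral of a product of kernels along a cycle with `m + 2` vertices. -/
theorem integral_cycle {k : S → S → ℝ} (hk : IsBddKernel k) (m : ℕ) :
    ∫ x : Fin (m + 2) → S, ∏ i : Fin (m + 2), k (x i) (x (i + 1)) ∂(Measure.pi fun _ => μ) =
      ∫ a, kpow μ k (m + 1) a a ∂μ := by
  have h := integral_path (μ := μ) hk m (h := fun a b => k b a) hk.swap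
  have h2 : kpow μ k (m + 1) = kcomp μ (kpow μ k m) (kpow μ k 0) := by rw [kcomp_kpow hk]
  rw [h2]
  simp only [kcomp, kpow]
  simp_rw [mul_comm (kpow μ k m _ _)]
  rw [← h]
  refine integral_congr_ae (Filter.Eventually.of_forall fun x => ?_)
  simp only
  rw [Fin.prod_univ_castSucc, mul_comm]
  simp [Fin.coeSucc_eq_succ]

end Kernel

/-! ### Marginals of product measures and the edges of an embedded cycle. -/

/-- Restricting a product measure along an embedding of the index type. -/
theorem measurePreserving_pi_comp {S ι κ : Type*} [MeasurableSpace S] [Fintype ι] [Fintype κ]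
    (μ : Measure S) [IsProbabilityMeasure μ] (f : ι ↪ κ) :
    MeasurePreserving (fun (x : κ → S) i => x (f i)) (Measure.pi fun _ => μ)
      (Measure.pi fun _ => μ) := by
  classical
  have hm : Measurable fun (x : κ → S) i => x (f i) :=
    measurable_pi_lambda _ fun i => measurable_pi_apply _
  refine ⟨hm, (Measure.pi_eq fun s hs => ?_).symm⟩
  rw [Measure.map_apply hm (MeasurableSet.univ_pi hs)]
  have : (fun (x : κ → S) i => x (f i)) ⁻¹' Set.univ.pi s =
      Set.univ.pi (Function.extend f s fun _ => Set.univ) := by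
    ext x
    simp only [Set.mem_preimage, Set.mem_univ_pi]
    constructor
    · intro h j
      by_cases hj : ∃ i, f i = j
      · obtain ⟨i, rfl⟩ := hj
        rw [f.injective.extend_apply]
        exact h i
      · rw [Function.extend_apply' _ _ _ hj]
        trivial
    · intro h i
      have := h (f i)
      rwa [f.injective.extend_apply] at this
  rw [this, Measure.pi_pi]
  rw [← Finset.prod_subset (Finset.subset_univ (Finset.univ.map f)), Finset.prod_map]
  · simp [f.injective.extend_apply]
  · intro j _ hj
    rw [Function.extend_apply' _ _ _ (by simpa using hj)]
    simp

theorem prod_edgeFinset_cycleGraph_map {V : Type*} [Fintype V] [DecidableEq V] {ℓ : ℕ}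
    (f : Fin (ℓ + 3) ↪ V) (w : Sym2 V → ℝ)
    [Fintype ((SimpleGraph.cycleGraph (ℓ + 3)).map f).edgeSet] :
    ∏ e ∈ ((SimpleGraph.cycleGraph (ℓ + 3)).map f).edgeFinset, w e =
      ∏ i, w s(f i, f (i + 1)) := by
  -- Length at least 3 makes the edges s(f i, f (i + 1)) pairwise distinct: an edge met in both
  -- directions would force i = i + 1 + 1.
  have hne : ∀ i : Fin (ℓ + 3), i ≠ i + 1 + 1 := by
    intro i h
    have h2 : (1 + 1 : Fin (ℓ + 3)) = 0 := by simpa [add_assoc] using h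
    have := congrArg Fin.val h2
    rw [Fin.val_add] at this
    simp only [Fin.val_one, Fin.val_zero] at this
    rw [Nat.mod_eq_of_lt (by omega)] at this
    omega
  rw [← Finset.prod_image (f := w) (g := fun i => s(f i, f (i + 1)))]
  · refine Finset.prod_congr ?_ fun _ _ => rfl
    ext e
    induction e with | _ a b
    simp only [SimpleGraph.mem_edgeFinset, SimpleGraph.mem_edgeSet, SimpleGraph.map_adj,
      SimpleGraph.cycleGraph_adj, Finset.mem_image, Finset.mem_univ, true_and, Sym2.eq_iff]
    constructor
    · rintro ⟨u, v, h, rfl, rfl⟩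
      rcases h with h | h
      · exact ⟨v, Or.inr ⟨rfl, by rw [← h]; congr 1; abel⟩⟩
      · exact ⟨u, Or.inl ⟨rfl, by rw [← h]; congr 1; abel⟩⟩
    · rintro ⟨i, ⟨rfl, rfl⟩ | ⟨rfl, rfl⟩⟩
      · exact ⟨i, i + 1, Or.inr (by abel), rfl, rfl⟩
      · exact ⟨i + 1, i, Or.inl (by abel), rfl, rfl⟩
  · intro i _ j _ h
    simp only [Sym2.eq_iff, f.injective.eq_iff] at h
    rcases h with h | ⟨h1, h2⟩
    · exact h.1
    · exact absurd (by rw [h2, h1] : i = i + 1 + 1) (fun h => hne i h) 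

/-! ### Rotation invariance on the sphere. -/

section Rotation

open scoped Pointwise

variable {d : ℕ}

/-- The Euclidean inner product of two points of the sphere. -/
noncomputable def sinner (x y : UnitSphere d) : ℝ :=
  inner ℝ (x : EuclideanSpace ℝ (Fin d)) (y : EuclideanSpace ℝ (Fin d))

theorem sinner_comm (x y : UnitSphere d) : sinner x y = sinner y x := real_inner_comm _ _

theorem sphere_norm (x : UnitSphere d) : ‖(x : EuclideanSpace ℝ (Fin d))‖ = 1 := by
  simp

theorem sinner_self (x : UnitSphere d) : sinner x x = 1 := by
  rw [sinner, real_inner_self_eq_norm_sq, sphere_norm, one_pow]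

theorem abs_sinner_le (x y : UnitSphere d) : |sinner x y| ≤ 1 := by
  have := abs_real_inner_le_norm (x : EuclideanSpace ℝ (Fin d)) y
  rwa [sphere_norm, sphere_norm, one_mul] at this

theorem sinner_sq_le (x y : UnitSphere d) : sinner x y ^ 2 ≤ 1 := by
  have := abs_sinner_le x y
  rw [← sq_abs]
  exact pow_le_one₀ (abs_nonneg _) this

theorem measurable_sinner :
    Measurable (Function.uncurry (sinner : UnitSphere d → UnitSphere d → ℝ)) :=
  (measurable_subtype_coe.comp measurable_fst).inner (measurable_subtype_coe.comp measurable_snd)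

theorem isBddKernel_sinner : IsBddKernel (sinner : UnitSphere d → UnitSphere d → ℝ) :=
  ⟨measurable_sinner, 1, abs_sinner_le⟩

theorem IsBddKernel.of_sinner {φ : ℝ → ℝ} (hφ : Measurable φ) {C : ℝ}
    (hC : ∀ t, |t| ≤ 1 → |φ t| ≤ C) :
    IsBddKernel fun x y : UnitSphere d => φ (sinner x y) :=
  ⟨hφ.comp measurable_sinner, C, fun x y => hC _ (abs_sinner_le x y)⟩

/-- A linear isometry acting on the sphere. -/
noncomputable def rot (R : EuclideanSpace ℝ (Fin d) ≃ₗᵢ[ℝ] EuclideanSpace ℝ (Fin d)) (x : UnitSphere d) :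
    UnitSphere d :=
  ⟨R x, by rw [mem_sphere_zero_iff_norm, R.norm_map, sphere_norm]⟩

variable (R : EuclideanSpace ℝ (Fin d) ≃ₗᵢ[ℝ] EuclideanSpace ℝ (Fin d))

theorem sinner_rot (x y : UnitSphere d) : sinner (rot R x) (rot R y) = sinner x y :=
  R.inner_map_map _ _

theorem measurable_rot : Measurable (rot R) :=
  (R.continuous.measurable.comp measurable_subtype_coe).subtype_mk

/-- `toSphere` measures a set through the volume of the cone over it inside the unit ball, and a
linear isometry carries such cones to cones of equal volume. -/
theorem measurePreserving_rot : MeasurePreserving (rot R) (uniformSphere d) (uniformSphere d) := by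
  refine ⟨measurable_rot R, Measure.ext fun s hs => ?_⟩
  rw [Measure.map_apply (measurable_rot R) hs, uniformSphere, Measure.smul_apply,
    Measure.smul_apply, Measure.toSphere_apply' _ hs,
    Measure.toSphere_apply' _ (measurable_rot R hs)]
  congr 2
  rw [← R.measurePreserving.measure_preimage_equiv (f := R.toMeasurableEquiv)
    (Set.Ioo (0 : ℝ) 1 • (Subtype.val '' s))]
  congr 1
  ext v
  simp only [Set.mem_preimage, LinearIsometryEquiv.coe_toMeasurableEquiv, Set.mem_smul,
    Set.mem_image]
  constructor
  · rintro ⟨r, hr, _, ⟨x, hx, rfl⟩, rfl⟩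
    exact ⟨r, hr, _, ⟨rot R x, hx, rfl⟩, by simp [rot]⟩
  · rintro ⟨r, hr, _, ⟨x, hx, rfl⟩, h⟩
    refine ⟨r, hr, _, ⟨rot R.symm x, ?_, rfl⟩, ?_⟩
    · have : rot R (rot R.symm x) = x := Subtype.ext (by simp [rot])
      rwa [this]
    · apply R.injective
      rw [← h]
      simp [rot]

theorem measurableEmbedding_rot : MeasurableEmbedding (rot R) := by
  refine MeasurableEmbedding.of_measurable_inverse (measurable_rot R) ?_ (measurable_rot R.symm)
    fun x => Subtype.ext (by simp [rot])
  have : Function.Surjective (rot R) := fun x => ⟨rot R.symm x, Subtype.ext (by simp [rot])⟩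
  rw [this.range_eq]
  exact MeasurableSet.univ

theorem integral_rot (φ : UnitSphere d → ℝ) :
    ∫ x, φ (rot R x) ∂uniformSphere d = ∫ x, φ x ∂uniformSphere d :=
  (measurePreserving_rot R).integral_comp (measurableEmbedding_rot R) φ

/-- Two reflections suffice: the first sends x to x', and the second sends the image of y to y'. The
second fixes x' because x' has the same inner product with both. Hence an invariant kernel is a
function of the inner product. -/
theorem exists_rot_eq_pair {x y x' y' : UnitSphere d} (h : sinner x y = sinner x' y') :
    ∃ R, rot R x = x' ∧ rot R y = y' := by
  let E := EuclideanSpace ℝ (Fin d)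
  let R₁ : E ≃ₗᵢ[ℝ] E := (ℝ ∙ ((x : E) - x'))ᗮ.reflection
  have h1 : rot R₁ x = x' :=
    Subtype.ext (Submodule.reflection_sub (by rw [sphere_norm, sphere_norm]))
  let R₂ : E ≃ₗᵢ[ℝ] E := (ℝ ∙ ((rot R₁ y : E) - y'))ᗮ.reflection
  have h2 : rot R₂ (rot R₁ y) = y' :=
    Subtype.ext (Submodule.reflection_sub (by rw [sphere_norm, sphere_norm]))
  have h3 : rot R₂ x' = x' := by
    refine Subtype.ext (Submodule.reflection_mem_subspace_eq_self ?_)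
    rw [Submodule.mem_orthogonal_singleton_iff_inner_right, inner_sub_left, sub_eq_zero]
    have : sinner (rot R₁ x) (rot R₁ y) = sinner x' y' := by rw [sinner_rot, h]
    rw [h1] at this
    rw [real_inner_comm, real_inner_comm (x' : E)]
    exact this
  refine ⟨R₁.trans R₂, ?_, ?_⟩
  · rw [← h3, ← h1]; rfl
  · rw [← h2]; rfl

/-- A kernel invariant under linear isometries. -/
def IsInvKernel (k : UnitSphere d → UnitSphere d → ℝ) : Prop :=
  ∀ R x y, k (rot R x) (rot R y) = k x y

theorem IsInvKernel.eq_of_sinner_eq {k : UnitSphere d → UnitSphere d → ℝ} (hk : IsInvKernel k)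
    {x y x' y' : UnitSphere d} (h : sinner x y = sinner x' y') : k x y = k x' y' := by
  obtain ⟨R, rfl, rfl⟩ := exists_rot_eq_pair h
  exact (hk R x y).symm

theorem IsInvKernel.diag {k : UnitSphere d → UnitSphere d → ℝ} (hk : IsInvKernel k)
    (x y : UnitSphere d) : k x x = k y y :=
  hk.eq_of_sinner_eq (by rw [sinner_self, sinner_self])

theorem isInvKernel_of_sinner (φ : ℝ → ℝ) :
    IsInvKernel fun x y : UnitSphere d => φ (sinner x y) := fun R x y => by
  simp only [sinner_rot]

theorem IsInvKernel.comp {k l : UnitSphere d → UnitSphere d → ℝ} (hk : IsInvKernel k)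
    (hl : IsInvKernel l) : IsInvKernel (kcomp (uniformSphere d) k l) := fun R x y => by
  rw [kcomp, ← integral_rot R, kcomp]
  simp only [hk R, hl R]

theorem IsInvKernel.pow {k : UnitSphere d → UnitSphere d → ℝ} (hk : IsInvKernel k) (m : ℕ) :
    IsInvKernel (kpow (uniformSphere d) k m) := by
  induction m with
  | zero => exact hk
  | succ m ih => exact hk.comp ih

theorem IsInvKernel.integral_const {k : UnitSphere d → UnitSphere d → ℝ} (hk : IsInvKernel k)
    (x x' : UnitSphere d) :
    ∫ y, k x y ∂uniformSphere d = ∫ y, k x' y ∂uniformSphere d := by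
  obtain ⟨R, rfl, -⟩ := exists_rot_eq_pair (x := x) (y := x) (x' := x') (y' := x')
    (by rw [sinner_self, sinner_self])
  rw [← integral_rot R (k (rot R x))]
  simp only [hk R]

/-- Funk–Hecke formula in degree one. -/
theorem integral_mul_sinner {k : UnitSphere d → UnitSphere d → ℝ}
    (hb : IsBddKernel k) (hk : IsInvKernel k) (x z : UnitSphere d) :
    ∫ y, k x y * sinner y z ∂uniformSphere d =
      (∫ y, k x y * sinner x y ∂uniformSphere d) * sinner x z := by
  let E := EuclideanSpace ℝ (Fin d)
  -- w is the component of z orthogonal to x. The reflection negating w fixes x, so the part of the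
  -- integral along w is its own negative.
  let w : E := (z : E) - sinner x z • (x : E)
  let R : E ≃ₗᵢ[ℝ] E := (ℝ ∙ w)ᗮ.reflection
  have hwx : inner ℝ w (x : E) = 0 := by
    simp only [w, inner_sub_left, inner_smul_left, real_inner_self_eq_norm_sq]
    rw [real_inner_comm]
    simp [sinner]
  have hRx : rot R x = x := Subtype.ext (Submodule.reflection_mem_subspace_eq_self
    ((Submodule.mem_orthogonal_singleton_iff_inner_right).2 hwx))
  have hRw : R w = -w := Submodule.reflection_orthogonalComplement_singleton_eq_neg w
  have hflip : ∀ y, inner ℝ ((rot R y : UnitSphere d) : E) w = - inner ℝ (y : E) w := by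
    intro y
    have : inner ℝ (R y) (R w) = inner ℝ (y : E) w := R.inner_map_map _ _
    rw [hRw, inner_neg_right] at this
    change inner ℝ (R y) w = _
    linarith
  have hsplit : ∀ y : UnitSphere d,
      k x y * sinner y z = k x y * inner ℝ (y : E) w + k x y * sinner x y * sinner x z := by
    intro y
    have : inner ℝ (y : E) w = sinner y z - sinner x z * sinner x y := by
      simp only [w, inner_sub_right, inner_smul_right]
      rw [real_inner_comm (x : E) y]
      rfl
    rw [this]; ring
  have hzero : ∫ y, k x y * inner ℝ (y : E) w ∂uniformSphere d = 0 := by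
    have h1 := integral_rot R fun y => k x y * inner ℝ (y : E) w
    have h2 : ∀ y, k x (rot R y) * inner ℝ ((rot R y : UnitSphere d) : E) w =
        -(k x y * inner ℝ (y : E) w) := by
      intro y
      have := hk R x y
      rw [hRx] at this
      rw [this, hflip]; ring
    simp only [h2, integral_neg] at h1
    linarith
  obtain ⟨C, hC0, hC⟩ := hb.nonneg_bound
  have hi1 : Integrable (fun y : UnitSphere d => k x y * inner ℝ (y : E) w) (uniformSphere d) := by
    refine integrable_of_bdd (C := C * ‖w‖) ?_ fun y => ?_
    · exact (hb.measurable_left x).mul (measurable_subtype_coe.inner measurable_const)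
    · rw [abs_mul]
      refine mul_le_mul (hC _ _) ?_ (abs_nonneg _) hC0
      simpa [sphere_norm] using abs_real_inner_le_norm (y : E) w
  have hi2 : Integrable (fun y : UnitSphere d => k x y * sinner x y * sinner x z)
      (uniformSphere d) :=
    ((hb.mul isBddKernel_sinner).integrable x).mul_const _
  simp only [hsplit]
  rw [integral_add hi1 hi2, hzero, zero_add, integral_mul_const]

theorem integral_sinner (x : UnitSphere d) : ∫ y, sinner x y ∂uniformSphere d = 0 := by
  have h := integral_rot (LinearIsometryEquiv.neg ℝ) fun y => sinner x y
  have h2 : ∀ y : UnitSphere d, sinner x (rot (LinearIsometryEquiv.neg ℝ) y) = - sinner x y := by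
    intro y
    simp [sinner, rot]
  simp only [h2, integral_neg] at h
  linarith

/-- The points of the sphere on the coordinate axes. -/
noncomputable def axis (i : Fin d) : UnitSphere d :=
  ⟨EuclideanSpace.single i 1, by simp⟩

theorem sinner_axis (i : Fin d) (x : UnitSphere d) : sinner (axis i) x = x.1 i := by
  simp [sinner, axis, EuclideanSpace.inner_single_left]

theorem sinner_axis_axis {i j : Fin d} (h : i ≠ j) : sinner (axis i) (axis j) = 0 := by
  rw [sinner_axis]
  simp [axis, h]

/-- The d coordinate directions contribute equally, and the squared coordinates of a unit vector sum
to 1. -/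
theorem integral_sinner_sq [NeZero d] (x : UnitSphere d) :
    ∫ y, sinner x y ^ 2 ∂uniformSphere d = 1 / d := by
  have h1 : ∀ i : Fin d, ∫ y, sinner (axis i) y ^ 2 ∂uniformSphere d =
      ∫ y, sinner x y ^ 2 ∂uniformSphere d := fun i =>
    (isInvKernel_of_sinner (d := d) fun t => t ^ 2).integral_const (axis i) x
  have h2 : ∑ i : Fin d, ∫ y, sinner (axis i) y ^ 2 ∂uniformSphere d = 1 := by
    rw [← integral_finsetSum]
    · have : ∀ y : UnitSphere d, ∑ i, sinner (axis i) y ^ 2 = 1 := by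
        intro y
        simp only [sinner_axis]
        have := EuclideanSpace.real_norm_sq_eq (y : EuclideanSpace ℝ (Fin d))
        rw [← this, sphere_norm, one_pow]
      simp [this]
    · intro i _
      simpa [pow_two] using (isBddKernel_sinner.mul isBddKernel_sinner).integrable (axis i)
  simp only [h1, Finset.sum_const, Finset.card_univ, Fintype.card_fin, nsmul_eq_mul] at h2
  have : (d : ℝ) ≠ 0 := Nat.cast_ne_zero.2 (NeZero.ne d)
  field_simp
  linarith

/-- Three dimensions leave room for a vector orthogonal to any two; it serves as an intermediary
when comparing rows of a kernel. -/
theorem exists_sinner_eq_zero (hd : 3 ≤ d) (x y : UnitSphere d) :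
    ∃ z : UnitSphere d, sinner x z = 0 ∧ sinner y z = 0 := by
  let E := EuclideanSpace ℝ (Fin d)
  let U : Submodule ℝ E := Submodule.span ℝ {(x : E), (y : E)}
  have hU : Module.finrank ℝ U ≤ 2 := by
    have := finrank_span_finset_le_card (R := ℝ) ({(x : E), (y : E)} : Finset E)
    simp only [Finset.coe_insert, Finset.coe_singleton] at this
    exact this.trans Finset.card_le_two
  have hne : Uᗮ ≠ ⊥ := by
    intro h
    have h2 := U.finrank_add_finrank_orthogonal
    rw [h, finrank_bot, finrank_euclideanSpace_fin] at h2
    omega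
  obtain ⟨v, hv, hv0⟩ := Submodule.exists_mem_ne_zero_of_ne_bot hne
  have hvn : ‖v‖ ≠ 0 := norm_ne_zero_iff.2 hv0
  refine ⟨⟨(‖v‖)⁻¹ • v, by
    rw [mem_sphere_zero_iff_norm, norm_smul, norm_inv, norm_norm, inv_mul_cancel₀ hvn]⟩, ?_, ?_⟩
  all_goals
    rw [sinner, inner_smul_right, (Submodule.mem_orthogonal _ _).1 hv _
      (Submodule.subset_span (by simp)), mul_zero]

end Rotation

theorem sq_integral_mul_le {T : Type*} [MeasurableSpace T] {ν : Measure T} {u v : T → ℝ}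
    (huu : Integrable (fun x => u x ^ 2) ν) (hvv : Integrable (fun x => v x ^ 2) ν)
    (huv : Integrable (fun x => u x * v x) ν) :
    (∫ x, u x * v x ∂ν) ^ 2 ≤ (∫ x, u x ^ 2 ∂ν) * ∫ x, v x ^ 2 ∂ν := by
  have key : ∀ t : ℝ, 0 ≤ (∫ x, v x ^ 2 ∂ν) * (t * t) + (-2 * ∫ x, u x * v x ∂ν) * t +
      ∫ x, u x ^ 2 ∂ν := by
    intro t
    have h0 : 0 ≤ ∫ x, (u x - t * v x) ^ 2 ∂ν := integral_nonneg fun x => sq_nonneg _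
    have h1 : ∀ x, (u x - t * v x) ^ 2 =
        t * t * v x ^ 2 + -2 * t * (u x * v x) + u x ^ 2 := fun x => by ring
    simp only [h1] at h0
    rw [integral_add ((hvv.const_mul _).fun_add (huv.const_mul _)) huu,
      integral_add (hvv.const_mul _) (huv.const_mul _), integral_const_mul,
      integral_const_mul] at h0
    linarith
  have := discrim_le_zero key
  rw [discrim] at this
  nlinarith

/-! ### Trace bounds for invariant kernels from multiplicity, without spectral theory. -/

section Trace

variable {n : ℕ} {g : UnitSphere (n + 2) → UnitSphere (n + 2) → ℝ}

local notation "σₙ" => uniformSphere (n + 2)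
local notation "𝒦" => kpow (uniformSphere (n + 2)) g

/-- Squared Hilbert–Schmidt norm of the `(m + 1)`-fold composition of a symmetric invariant
kernel. -/
noncomputable def hsSq (g : UnitSphere (n + 2) → UnitSphere (n + 2) → ℝ) (m : ℕ) : ℝ :=
  kpow (uniformSphere (n + 2)) g (2 * m + 1) (axis 0) (axis 0)

/-- Half the squared distance of the rows of the `(m + 1)`-fold composition of a symmetric
invariant kernel at two orthogonal points. -/
noncomputable def rowGap (g : UnitSphere (n + 2) → UnitSphere (n + 2) → ℝ) (m : ℕ) : ℝ :=
  hsSq g m - kpow (uniformSphere (n + 2)) g (2 * m + 1) (axis 0) (axis 1)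

variable (hb : IsBddKernel g) (hs : ∀ x y, g x y = g y x) (hi : IsInvKernel g)

include hb hs in
theorem integral_row_mul_row (m k : ℕ) (x y : UnitSphere (n + 2)) :
    ∫ z, 𝒦 m x z * 𝒦 k y z ∂σₙ = 𝒦 (m + k + 1) x y := by
  rw [← kcomp_kpow hb, kcomp]
  simp only [kpow_symm hb hs k y]

include hi in
theorem kpow_diag (m : ℕ) (x : UnitSphere (n + 2)) : 𝒦 (2 * m + 1) x x = hsSq g m :=
  (hi.pow _).diag _ _

include hi in
theorem kpow_orthogonal (m : ℕ) {x y : UnitSphere (n + 2)} (h : sinner x y = 0) :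
    𝒦 (2 * m + 1) x y = hsSq g m - rowGap g m := by
  rw [rowGap, sub_sub_cancel]
  refine (hi.pow _).eq_of_sinner_eq ?_
  rw [h, sinner_axis_axis]
  simp

include hb hs hi in
theorem integral_row_sq (m : ℕ) (x : UnitSphere (n + 2)) : ∫ z, 𝒦 m x z ^ 2 ∂σₙ = hsSq g m := by
  simp only [pow_two]
  rw [integral_row_mul_row hb hs, ← kpow_diag hi m x]
  congr 2
  ring

theorem row_sq_integrable (hb : IsBddKernel g) (m : ℕ) (x : UnitSphere (n + 2)) :
    Integrable (fun z => 𝒦 m x z ^ 2) σₙ := by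
  simpa [pow_two] using ((hb.pow m).mul (hb.pow m)).integrable x

theorem row_mul_integrable (hb : IsBddKernel g) (m k : ℕ) (x y : UnitSphere (n + 2)) :
    Integrable (fun z => 𝒦 m x z * 𝒦 k y z) σₙ := by
  exact kcomp_integrable (hb.pow m) (hb.pow k).swap x y

include hb hs hi in
theorem hsSq_nonneg (m : ℕ) : 0 ≤ hsSq g m := by
  rw [← integral_row_sq hb hs hi m (axis 0)]
  exact integral_nonneg fun _ => sq_nonneg _

include hb hs hi in
theorem integral_row_sub_sq (m : ℕ) (x y : UnitSphere (n + 2)) :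
    ∫ z, (𝒦 m x z - 𝒦 m y z) ^ 2 ∂σₙ = 2 * hsSq g m - 2 * 𝒦 (2 * m + 1) x y := by
  have h : ∀ z, (𝒦 m x z - 𝒦 m y z) ^ 2 = 𝒦 m x z ^ 2 + 𝒦 m y z ^ 2 - 2 * (𝒦 m x z * 𝒦 m y z) :=
    fun z => by ring
  simp only [h]
  rw [integral_sub ((row_sq_integrable hb m x).fun_add (row_sq_integrable hb m y))
    ((row_mul_integrable hb m m x y).const_mul _),
    integral_add (row_sq_integrable hb m x) (row_sq_integrable hb m y), integral_const_mul,
    integral_row_mul_row hb hs, integral_row_sq hb hs hi, integral_row_sq hb hs hi,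
    show m + m + 1 = 2 * m + 1 by ring]
  ring

include hb hs hi in
theorem rowGap_nonneg (m : ℕ) : 0 ≤ rowGap g m := by
  have h := integral_row_sub_sq hb hs hi m (axis 0) (axis 1)
  rw [kpow_orthogonal hi m (sinner_axis_axis (by simp))] at h
  have : 0 ≤ ∫ z, (𝒦 m (axis 0) z - 𝒦 m (axis 1) z) ^ 2 ∂σₙ := integral_nonneg fun _ => sq_nonneg _
  linarith

include hb hs hi in
theorem rowGap_le (m : ℕ) : rowGap g m ≤ 2 * hsSq g m := by
  have h : ∫ z, (𝒦 m (axis 0) z - 𝒦 m (axis 1) z) ^ 2 ∂σₙ ≤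
      ∫ z, (2 * 𝒦 m (axis 0) z ^ 2 + 2 * 𝒦 m (axis 1) z ^ 2) ∂σₙ := by
    refine integral_mono ?_ (((row_sq_integrable hb m _).const_mul 2).add
      ((row_sq_integrable hb m _).const_mul 2)) fun z => ?_
    · have := ((row_sq_integrable hb m (axis 0)).add (row_sq_integrable hb m (axis 1))).sub
        ((row_mul_integrable hb m m (axis 0) (axis 1)).const_mul 2)
      refine this.congr (Filter.Eventually.of_forall fun z => ?_)
      simp only [Pi.add_apply, Pi.sub_apply]
      ring
    · nlinarith [sq_nonneg (𝒦 m (axis 0) z + 𝒦 m (axis 1) z)]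
  rw [integral_row_sub_sq hb hs hi, kpow_orthogonal hi m (sinner_axis_axis (by simp)),
    integral_add ((row_sq_integrable hb m _).const_mul 2) ((row_sq_integrable hb m _).const_mul 2),
    integral_const_mul, integral_const_mul, integral_row_sq hb hs hi,
    integral_row_sq hb hs hi] at h
  linarith

include hb in
theorem integral_kpow_eq_zero (h0 : ∀ x, ∫ y, g x y ∂σₙ = 0) (m : ℕ) (x : UnitSphere (n + 2)) :
    ∫ y, 𝒦 m x y ∂σₙ = 0 := by
  cases m with
  | zero => exact h0 x
  | succ m =>
    have h : ∀ y, 𝒦 (m + 1) x y = ∫ z, 𝒦 m x z * g z y ∂σₙ := fun y => by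
      rw [show m + 1 = m + 0 + 1 by ring, ← kcomp_kpow (μ := σₙ) hb m 0]; rfl
    simp only [h]
    obtain ⟨C, hC0, hC⟩ := hb.nonneg_bound
    obtain ⟨D, hD0, hD⟩ := (hb.pow (μ := σₙ) m).nonneg_bound
    rw [integral_integral_swap]
    · simp only [integral_const_mul, h0, mul_zero, integral_zero]
    · refine integrable_of_bdd (C := D * C) ?_ fun q => ?_
      · exact ((hb.pow m).comp_measurable measurable_const measurable_snd).mul
          (hb.comp_measurable measurable_snd measurable_fst)
      · simp only [Function.uncurry, abs_mul]
        exact mul_le_mul (hD _ _) (hC _ _) (abs_nonneg _) hD0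

-- Each of two rows is at squared distance 2 `rowGap` from the row at a common orthogonal point, so
-- any two rows are at squared distance at most 8 `rowGap`. Averaging over the second point removes
-- the cross term, since the rows have mean zero.
include hb hs hi in
theorem hsSq_le_rowGap (hn : 1 ≤ n) (h0 : ∀ x, ∫ y, g x y ∂σₙ = 0) (m : ℕ) :
    hsSq g m ≤ 4 * rowGap g m := by
  have key : ∀ y, 2 * hsSq g m - 2 * 𝒦 (2 * m + 1) (axis 0) y ≤ 8 * rowGap g m := by
    intro y
    obtain ⟨z, hz0, hzy⟩ := exists_sinner_eq_zero (by omega) (axis 0) y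
    have h1 := integral_row_sub_sq hb hs hi m (axis 0) z
    have h2 := integral_row_sub_sq hb hs hi m y z
    rw [kpow_orthogonal hi m hz0] at h1
    rw [kpow_orthogonal hi m hzy] at h2
    have hint : ∀ x y, Integrable (fun z => (𝒦 m x z - 𝒦 m y z) ^ 2) σₙ := by
      intro x y
      have := ((row_sq_integrable hb m x).add (row_sq_integrable hb m y)).sub
        ((row_mul_integrable hb m m x y).const_mul 2)
      refine this.congr (Filter.Eventually.of_forall fun z => ?_)
      simp only [Pi.add_apply, Pi.sub_apply]
      ring
    rw [← integral_row_sub_sq hb hs hi]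
    calc ∫ w, (𝒦 m (axis 0) w - 𝒦 m y w) ^ 2 ∂σₙ
        ≤ ∫ w, (2 * (𝒦 m (axis 0) w - 𝒦 m z w) ^ 2 + 2 * (𝒦 m y w - 𝒦 m z w) ^ 2) ∂σₙ := by
          refine integral_mono (hint _ _) (((hint _ _).const_mul 2).add ((hint _ _).const_mul 2))
            fun w => ?_
          simp only
          nlinarith [sq_nonneg (𝒦 m (axis 0) w - 𝒦 m z w + (𝒦 m y w - 𝒦 m z w))]
      _ = 8 * rowGap g m := by
          rw [integral_add ((hint _ _).const_mul 2) ((hint _ _).const_mul 2),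
            integral_const_mul, integral_const_mul, h1, h2]
          ring
  have h3 : ∫ y, (2 * hsSq g m - 2 * 𝒦 (2 * m + 1) (axis 0) y) ∂σₙ ≤ ∫ _, 8 * rowGap g m ∂σₙ :=
    integral_mono ((integrable_const _).sub (((hb.pow _).integrable _).const_mul _))
      (integrable_const _) key
  rw [integral_sub (integrable_const _) (((hb.pow _).integrable _).const_mul _),
    integral_const_mul 2 (fun y => 𝒦 (2 * m + 1) (axis 0) y),
    integral_kpow_eq_zero hb h0] at h3
  simp at h3
  linarith

-- The Gram matrix of the rows at the n + 2 axis points is a multiple of the all-ones matrix plus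
-- `rowGap` times the identity. On coefficient vectors of sum zero the rows therefore behave like an
-- orthogonal family of squared norm `rowGap`, and Bessel's inequality applies to the centred
-- coefficients.
include hb hs hi in
theorem rowGap_bessel (m : ℕ) {h : UnitSphere (n + 2) → ℝ} (hm : Measurable h)
    (hC : ∃ C, ∀ x, |h x| ≤ C) :
    ∑ i, (∫ z, h z * 𝒦 m (axis i) z ∂σₙ) ^ 2 -
        (∑ i, ∫ z, h z * 𝒦 m (axis i) z ∂σₙ) ^ 2 / (n + 2 : ℝ) ≤
      rowGap g m * ∫ z, h z ^ 2 ∂σₙ := by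
  obtain ⟨C, hC⟩ := hC
  have hC0 : 0 ≤ C := (abs_nonneg _).trans (hC (axis 0))
  obtain ⟨D, hD0, hD⟩ := (hb.pow (μ := σₙ) m).nonneg_bound
  set c : Fin (n + 2) → ℝ := fun i => ∫ z, h z * 𝒦 m (axis i) z ∂σₙ with hc
  -- Centring the coefficients removes the all-ones part of the Gram matrix.
  set b : Fin (n + 2) → ℝ := fun i => c i - (∑ j, c j) / (n + 2 : ℝ) with hbdef
  have hn : (n + 2 : ℝ) ≠ 0 := by positivity
  have hb0 : ∑ i, b i = 0 := by
    simp only [hbdef, Finset.sum_sub_distrib, Finset.sum_const, Finset.card_univ,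
      Fintype.card_fin, nsmul_eq_mul]
    push_cast
    field_simp
    ring
  have hbc : ∑ i, b i * c i = ∑ i, b i ^ 2 := by
    have : ∀ i, b i ^ 2 = b i * c i - b i * ((∑ j, c j) / (n + 2 : ℝ)) := fun i => by
      simp only [hbdef]; ring
    simp only [this, Finset.sum_sub_distrib, ← Finset.sum_mul, hb0]
    ring
  have hbb : ∑ i, b i ^ 2 = ∑ i, c i ^ 2 - (∑ i, c i) ^ 2 / (n + 2 : ℝ) := by
    rw [← hbc]
    simp only [hbdef, sub_mul, Finset.sum_sub_distrib, ← Finset.mul_sum]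
    congr 1
    · exact Finset.sum_congr rfl fun i _ => by ring
    · ring
  rw [← hbb]
  have hint : ∀ i, Integrable (fun z => h z * 𝒦 m (axis i) z) σₙ := fun i => by
    refine integrable_of_bdd (C := C * D) (hm.mul ((hb.pow m).measurable_left _)) fun z => ?_
    rw [abs_mul]
    exact mul_le_mul (hC _) (hD _ _) (abs_nonneg _) hC0
  have hsum : ∫ z, h z * ∑ i, b i * 𝒦 m (axis i) z ∂σₙ = ∑ i, b i ^ 2 := by
    rw [← hbc]
    simp only [Finset.mul_sum, hc]
    rw [integral_finsetSum]
    · refine Finset.sum_congr rfl fun i _ => ?_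
      rw [← integral_const_mul]
      exact integral_congr_ae (Filter.Eventually.of_forall fun z => by simp only; ring)
    · intro i _
      refine ((hint i).const_mul (b i)).congr (Filter.Eventually.of_forall fun z => ?_)
      simp only; ring
  have hexp : ∀ z, (∑ i, b i * 𝒦 m (axis i) z) ^ 2 =
      ∑ i, ∑ j, b i * b j * (𝒦 m (axis i) z * 𝒦 m (axis j) z) := fun z => by
    rw [pow_two, Finset.sum_mul_sum]
    exact Finset.sum_congr rfl fun i _ => Finset.sum_congr rfl fun j _ => by ring
  have hintv : Integrable (fun z => (∑ i, b i * 𝒦 m (axis i) z) ^ 2) σₙ := by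
    simp only [hexp]
    exact integrable_finsetSum _ fun i _ => integrable_finsetSum _ fun j _ =>
      (row_mul_integrable hb m m _ _).const_mul _
  have hgram : ∀ i j, ∫ z, 𝒦 m (axis i) z * 𝒦 m (axis j) z ∂σₙ =
      (hsSq g m - rowGap g m) + if i = j then rowGap g m else 0 := by
    intro i j
    rw [integral_row_mul_row hb hs, show m + m + 1 = 2 * m + 1 by ring]
    split_ifs with hij
    · rw [hij, kpow_diag hi]; ring
    · rw [kpow_orthogonal hi m (sinner_axis_axis hij)]; ring
  have hv : ∫ z, (∑ i, b i * 𝒦 m (axis i) z) ^ 2 ∂σₙ = rowGap g m * ∑ i, b i ^ 2 := by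
    simp only [hexp]
    rw [integral_finsetSum _ fun i _ => integrable_finsetSum _ fun j _ =>
      (row_mul_integrable hb m m _ _).const_mul _]
    have : ∀ i, ∫ z, ∑ j, b i * b j * (𝒦 m (axis i) z * 𝒦 m (axis j) z) ∂σₙ =
        b i * (hsSq g m - rowGap g m) * ∑ j, b j + rowGap g m * b i ^ 2 := by
      intro i
      rw [integral_finsetSum _ fun j _ => (row_mul_integrable hb m m _ _).const_mul _]
      simp only [integral_const_mul, hgram, mul_add, Finset.sum_add_distrib, mul_ite, mul_zero,
        Finset.sum_ite_eq, Finset.mem_univ, if_true, Finset.mul_sum]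
      congr 1
      · exact Finset.sum_congr rfl fun _ _ => by ring
      · ring
    simp only [this, hb0, mul_zero, zero_add, Finset.mul_sum]
  have hmv : Measurable fun z => ∑ i, b i * 𝒦 m (axis i) z :=
    Finset.measurable_sum _ fun i _ => ((hb.pow m).measurable_left _).const_mul _
  have cs := sq_integral_mul_le (ν := σₙ) (u := h) (v := fun z => ∑ i, b i * 𝒦 m (axis i) z)
    (integrable_of_bdd (C := C ^ 2) (hm.pow_const 2) fun z => by
      rw [abs_pow]; exact pow_le_pow_left₀ (abs_nonneg _) (hC z) 2) hintv (by
      simp only [Finset.mul_sum]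
      refine integrable_finsetSum _ fun i _ =>
        ((hint i).const_mul (b i)).congr (Filter.Eventually.of_forall fun z => ?_)
      simp only; ring)
  rw [hsum, hv] at cs
  have hB : 0 ≤ ∑ i, b i ^ 2 := Finset.sum_nonneg fun _ _ => sq_nonneg _
  have hH : 0 ≤ ∫ z, h z ^ 2 ∂σₙ := integral_nonneg fun _ => sq_nonneg _
  rcases hB.eq_or_lt with h' | h'
  · rw [← h']
    exact mul_nonneg (rowGap_nonneg hb hs hi m) hH
  · refine le_of_mul_le_mul_left ?_ h'
    nlinarith

include hb hs hi in
/-- Every nontrivial eigenvalue of an invariant kernel has multiplicity at least `n + 1`. -/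
theorem rowGap_add_le (m k : ℕ) :
    (n + 1 : ℝ) * rowGap g (m + k + 1) ≤ hsSq g k * rowGap g m := by
  have hrow : ∀ x i, ∫ z, 𝒦 k x z * 𝒦 m (axis i) z ∂σₙ = 𝒦 (m + k + 1) (axis i) x := by
    intro x i
    rw [integral_row_mul_row hb hs, kpow_symm hb hs, show k + m + 1 = m + k + 1 by ring]
  -- Bessel's inequality for the row of the (k + 1)-fold composition at x; its coefficients are
  -- entries of the longer composition.
  have key : ∀ x, ∑ i, 𝒦 (m + k + 1) (axis i) x ^ 2 -
      (∑ i, 𝒦 (m + k + 1) (axis i) x) ^ 2 / (n + 2 : ℝ) ≤ rowGap g m * hsSq g k := by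
    intro x
    have := rowGap_bessel hb hs hi m ((hb.pow (μ := σₙ) k).measurable_left x)
      (by obtain ⟨C, hC⟩ := (hb.pow (μ := σₙ) k).bdd; exact ⟨C, hC x⟩)
    simpa only [hrow, integral_row_sq hb hs hi] using this
  set M := m + k + 1
  have hgram : ∀ i j, ∫ z, 𝒦 M (axis i) z * 𝒦 M (axis j) z ∂σₙ =
      (hsSq g M - rowGap g M) + if i = j then rowGap g M else 0 := by
    intro i j
    rw [integral_row_mul_row hb hs, show M + M + 1 = 2 * M + 1 by ring]
    split_ifs with hij
    · rw [hij, kpow_diag hi]; ring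
    · rw [kpow_orthogonal hi M (sinner_axis_axis hij)]; ring
  have hexp : ∀ z, (∑ i, 𝒦 M (axis i) z) ^ 2 =
      ∑ i, ∑ j, 𝒦 M (axis i) z * 𝒦 M (axis j) z := fun z => by
    rw [pow_two, Finset.sum_mul_sum]
  have i1 : Integrable (fun x => ∑ i, 𝒦 M (axis i) x ^ 2) σₙ :=
    integrable_finsetSum _ fun i _ => row_sq_integrable hb M _
  have i2 : Integrable (fun x => (∑ i, 𝒦 M (axis i) x) ^ 2) σₙ := by
    simp only [hexp]
    exact integrable_finsetSum _ fun i _ => integrable_finsetSum _ fun j _ =>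
      row_mul_integrable hb M M _ _
  have e1 : ∫ x, ∑ i, 𝒦 M (axis i) x ^ 2 ∂σₙ = (n + 2 : ℝ) * hsSq g M := by
    rw [integral_finsetSum _ fun i _ => row_sq_integrable hb M _]
    simp [integral_row_sq hb hs hi]
  have e2 : ∫ x, (∑ i, 𝒦 M (axis i) x) ^ 2 ∂σₙ =
      (n + 2 : ℝ) ^ 2 * (hsSq g M - rowGap g M) + (n + 2 : ℝ) * rowGap g M := by
    simp only [hexp]
    rw [integral_finsetSum _ fun i _ => integrable_finsetSum _ fun j _ =>
      row_mul_integrable hb M M _ _]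
    have : ∀ i, ∫ z, ∑ j, 𝒦 M (axis i) z * 𝒦 M (axis j) z ∂σₙ =
        (n + 2 : ℝ) * (hsSq g M - rowGap g M) + rowGap g M := by
      intro i
      rw [integral_finsetSum _ fun j _ => row_mul_integrable hb M M _ _]
      simp only [hgram, Finset.sum_add_distrib, Finset.sum_const, Finset.card_univ,
        Fintype.card_fin, nsmul_eq_mul, Finset.sum_ite_eq, Finset.mem_univ, if_true]
      push_cast
      ring
    simp only [this, Finset.sum_const, Finset.card_univ, Fintype.card_fin, nsmul_eq_mul]
    push_cast
    ring
  -- Averaging over x, the left side becomes (n + 2) `hsSq` - (n + 2)(`hsSq` - `rowGap`) - `rowGap`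
  -- = (n + 1) `rowGap`, all at level M.
  have h := integral_mono (μ := σₙ) (i1.sub (i2.div_const _)) (integrable_const _) key
  simp only [Pi.sub_apply] at h
  rw [integral_sub i1 (i2.div_const _), integral_div, e1, e2] at h
  simp only [integral_const, probReal_univ, smul_eq_mul, one_mul] at h
  have hn : (n + 2 : ℝ) ≠ 0 := by positivity
  have e3 : ((n + 2 : ℝ) ^ 2 * (hsSq g M - rowGap g M) + (n + 2 : ℝ) * rowGap g M) / (n + 2 : ℝ) =
      (n + 2 : ℝ) * (hsSq g M - rowGap g M) + rowGap g M := by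
    field_simp
  rw [e3] at h
  linarith

include hb hs hi in
theorem sq_kpow_diag_le (m k : ℕ) (x : UnitSphere (n + 2)) :
    𝒦 (m + k + 1) x x ^ 2 ≤ hsSq g m * hsSq g k := by
  rw [← integral_row_mul_row hb hs, ← integral_row_sq hb hs hi m x, ← integral_row_sq hb hs hi k x]
  exact sq_integral_mul_le (row_sq_integrable hb m x) (row_sq_integrable hb k x)
    (row_mul_integrable hb m k x x)

-- The hypothesis plays the role of bounding every nontrivial eigenvalue by `lam`: by multiplicity,
-- each two further levels shrink `rowGap` by `lam ^ 4`. Comparing `rowGap` with `hsSq` at both ends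
-- costs the factor 8 = 4 · 2.
include hb hs hi in
theorem hsSq_le_pow (hn : 1 ≤ n) (h0 : ∀ x, ∫ y, g x y ∂σₙ = 0) {lam : ℝ} (hl : 0 ≤ lam)
    (h1 : hsSq g 1 ≤ (n + 1 : ℝ) * lam ^ 4) (m : ℕ) :
    hsSq g (m + 1) ≤ 8 * lam ^ (2 * m) * hsSq g 1 := by
  have hgap : ∀ i, rowGap g (2 * i + 1) ≤ lam ^ (4 * i) * rowGap g 1 := by
    intro i
    induction i with
    | zero => simp
    | succ i ih =>
      have h2 := rowGap_add_le hb hs hi (2 * i + 1) 1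
      have h3 : hsSq g 1 * rowGap g (2 * i + 1) ≤ (n + 1 : ℝ) * lam ^ 4 * rowGap g (2 * i + 1) :=
        mul_le_mul_of_nonneg_right h1 (rowGap_nonneg hb hs hi _)
      have h4 : rowGap g (2 * i + 1 + 1 + 1) ≤ lam ^ 4 * rowGap g (2 * i + 1) := by
        refine le_of_mul_le_mul_left ?_ (by positivity : (0 : ℝ) < n + 1)
        linarith
      calc rowGap g (2 * (i + 1) + 1) ≤ lam ^ 4 * rowGap g (2 * i + 1) := h4
        _ ≤ lam ^ 4 * (lam ^ (4 * i) * rowGap g 1) := by gcongr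
        _ = lam ^ (4 * (i + 1)) * rowGap g 1 := by ring
  have heven : ∀ i, hsSq g (2 * i + 1) ≤ 8 * lam ^ (4 * i) * hsSq g 1 := by
    intro i
    have h2 : lam ^ (4 * i) * rowGap g 1 ≤ lam ^ (4 * i) * (2 * hsSq g 1) := by
      gcongr
      exact rowGap_le hb hs hi 1
    linarith [hsSq_le_rowGap hb hs hi hn h0 (2 * i + 1), hgap i]
  rcases Nat.even_or_odd' m with ⟨i, rfl | rfl⟩
  · exact (heven i).trans_eq (by ring)
  -- The other parity follows from its two neighbours by Cauchy–Schwarz (log-convexity of `hsSq`).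
  · have h2 := sq_kpow_diag_le hb hs hi (2 * i + 1) (2 * (i + 1) + 1) (axis 0)
    rw [show 2 * i + 1 + (2 * (i + 1) + 1) + 1 = 2 * (2 * i + 1 + 1) + 1 by ring,
      kpow_diag hi] at h2
    have hN := hsSq_nonneg hb hs hi
    refine le_of_sq_le_sq ?_ (by have := hN 1; positivity)
    calc hsSq g (2 * i + 1 + 1) ^ 2 ≤ hsSq g (2 * i + 1) * hsSq g (2 * (i + 1) + 1) := h2
      _ ≤ 8 * lam ^ (4 * i) * hsSq g 1 * (8 * lam ^ (4 * (i + 1)) * hsSq g 1) :=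
          mul_le_mul (heven i) (heven (i + 1)) (hN _) (by have := hN 1; positivity)
      _ = _ := by ring

include hb hs hi in
/-- Bound for the trace of the `(m + 4)`-fold composition. -/
theorem abs_kpow_diag_le (hn : 1 ≤ n) (h0 : ∀ x, ∫ y, g x y ∂σₙ = 0) {lam : ℝ} (hl : 0 ≤ lam)
    (h1 : hsSq g 1 ≤ (n + 1 : ℝ) * lam ^ 4) (m : ℕ) (x : UnitSphere (n + 2)) :
    |𝒦 (m + 3) x x| ≤ 8 * lam ^ m * hsSq g 1 := by
  have hN := hsSq_nonneg hb hs hi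
  -- Cauchy–Schwarz splits the m + 4 factors as 2 + (m + 2).
  have h2 := sq_kpow_diag_le hb hs hi 1 (m + 1) x
  rw [show 1 + (m + 1) + 1 = m + 3 by ring] at h2
  refine abs_le_of_sq_le_sq ?_ (by have := hN 1; positivity)
  have h3 := mul_le_mul_of_nonneg_left (hsSq_le_pow hb hs hi hn h0 hl h1 m) (hN 1)
  have h4 : 0 ≤ 56 * (lam ^ (2 * m) * hsSq g 1 ^ 2) := by positivity
  calc _ ≤ _ := h2
    _ ≤ _ := h3
    _ ≤ (8 * lam ^ m * hsSq g 1) ^ 2 := by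
      have : (8 * lam ^ m * hsSq g 1) ^ 2 = hsSq g 1 * (8 * lam ^ (2 * m) * hsSq g 1) +
          56 * (lam ^ (2 * m) * hsSq g 1 ^ 2) := by ring
      linarith

end Trace

/-! ### Gaussian integrals in polar coordinates. -/

section Gaussian

theorem lintegral_Ioi_mul_exp_neg_sq {a : ℝ} (ha : 0 ≤ a) :
    ∫⁻ r in Set.Ioi a, ENNReal.ofReal (r * Real.exp (-r ^ 2 / 2)) =
      ENNReal.ofReal (Real.exp (-a ^ 2 / 2)) := by
  have hd : ∀ x ∈ Set.Ici a, HasDerivAt (fun r : ℝ => -Real.exp (-r ^ 2 / 2))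
      (x * Real.exp (-x ^ 2 / 2)) x := by
    intro x _
    have h1 : HasDerivAt (fun r : ℝ => -r ^ 2 / 2) (-x) x := by
      have := ((hasDerivAt_pow 2 x).neg).div_const 2
      convert! this using 1
      push_cast
      ring
    convert! h1.exp.neg using 1
    ring
  have hpos : ∀ x ∈ Set.Ioi a, 0 ≤ x * Real.exp (-x ^ 2 / 2) := fun x hx =>
    mul_nonneg (ha.trans hx.out.le) (Real.exp_pos _).le
  have hlim : Filter.Tendsto (fun r : ℝ => -Real.exp (-r ^ 2 / 2)) Filter.atTop (nhds 0) := by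
    rw [← neg_zero]
    refine (Real.tendsto_exp_atBot.comp ?_).neg
    have : Filter.Tendsto (fun r : ℝ => r ^ 2 / 2) Filter.atTop Filter.atTop :=
      (Filter.tendsto_pow_atTop two_ne_zero).atTop_div_const two_pos
    exact (Filter.tendsto_neg_atTop_atBot.comp this).congr fun r => by simp [neg_div]
  have h1 := integrableOn_Ioi_deriv_of_nonneg' hd hpos hlim
  have h2 := integral_Ioi_of_hasDerivAt_of_nonneg' hd hpos hlim
  rw [← ofReal_integral_eq_lintegral_ofReal h1 ((ae_restrict_iff' measurableSet_Ioi).2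
    (Filter.Eventually.of_forall hpos)), h2]
  simp

theorem lintegral_exp_neg_mul_norm_sq {V : Type*} [NormedAddCommGroup V] [InnerProductSpace ℝ V]
    [FiniteDimensional ℝ V] [MeasurableSpace V] [BorelSpace V] {b : ℝ} (hb : 0 < b) :
    ∫⁻ v : V, ENNReal.ofReal (Real.exp (-b * ‖v‖ ^ 2)) =
      ENNReal.ofReal ((Real.pi / b) ^ ((Module.finrank ℝ V : ℝ) / 2)) := by
  have h := GaussianFourier.integral_rexp_neg_mul_sq_norm (V := V) hb
  rw [← h, ofReal_integral_eq_lintegral_ofReal _ (Filter.Eventually.of_forall fun v =>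
    (Real.exp_pos _).le)]
  by_contra hn
  rw [integral_undef hn] at h
  have : 0 < (Real.pi / b) ^ ((Module.finrank ℝ V : ℝ) / 2) := by
    have := Real.pi_pos
    positivity
  linarith

/-- The conditional probability that a uniform point of the sphere of `ℝⁿ⁺²`, whose projection to
a fixed plane has polar angle `β`, has first coordinate at least `t`. -/
noncomputable def capAngle (n : ℕ) (t β : ℝ) : ℝ :=
  if t ≤ Real.cos β then (1 - t ^ 2 / Real.cos β ^ 2) ^ ((n : ℝ) / 2) else 0

/-- For t < cos β the condition says r ≥ κ‖y‖. The radial integral then yields exp(-κ²‖y‖²/2), and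
the remaining Gaussian in y contributes (1 + κ²)^(-n/2) with 1/(1 + κ²) = 1 - t²/cos² β. -/
theorem lintegral_radial {n : ℕ} (hn : 1 ≤ n) {t : ℝ} (ht : 0 ≤ t) (β : ℝ) :
    ∫⁻ y : EuclideanSpace ℝ (Fin n), ∫⁻ r in Set.Ioi (0 : ℝ),
      (if t * √(r ^ 2 + ‖y‖ ^ 2) ≤ r * Real.cos β then
        ENNReal.ofReal (r * Real.exp (-r ^ 2 / 2)) * ENNReal.ofReal (Real.exp (-‖y‖ ^ 2 / 2))
        else 0) =
      ENNReal.ofReal ((2 * Real.pi) ^ ((n : ℝ) / 2) * capAngle n t β) := by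
  have hpi := Real.pi_pos
  set c := Real.cos β with hc
  have hn0 : (0 : ℝ) < n / 2 := by
    have : (1 : ℝ) ≤ n := by exact_mod_cast hn
    linarith
  have hN : Nontrivial (EuclideanSpace ℝ (Fin n)) := by
    have : NeZero n := ⟨by omega⟩
    infer_instance
  have hrt : ∀ (y : EuclideanSpace ℝ (Fin n)) (r : ℝ), 0 < r → r ≤ √(r ^ 2 + ‖y‖ ^ 2) :=
    fun y r hr => Real.le_sqrt_of_sq_le (by nlinarith [sq_nonneg ‖y‖])
  rcases lt_trichotomy c t with hct | hct | hct
  · rw [capAngle, if_neg (not_le.2 hct), mul_zero, ENNReal.ofReal_zero]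
    refine (lintegral_congr fun y => ?_).trans lintegral_zero
    refine (setLIntegral_congr_fun measurableSet_Ioi fun r hr => ?_).trans lintegral_zero
    rw [if_neg]
    push Not
    have hr : 0 < r := hr
    nlinarith [hrt y r hr]
  -- Boundary case cos β = t. For t = 0 the condition always holds, and the convention 0 / 0 = 0
  -- gives `capAngle` the right value 1. For t > 0 it forces y = 0, a null set because n ≥ 1.
  · rcases ht.eq_or_lt with ht0 | ht0
    · have : ∀ y : EuclideanSpace ℝ (Fin n), ∫⁻ r in Set.Ioi (0 : ℝ),
          (if t * √(r ^ 2 + ‖y‖ ^ 2) ≤ r * c then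
          ENNReal.ofReal (r * Real.exp (-r ^ 2 / 2)) * ENNReal.ofReal (Real.exp (-‖y‖ ^ 2 / 2))
          else 0) = ENNReal.ofReal (Real.exp (-(1 / 2) * ‖y‖ ^ 2)) := by
        intro y
        have h1 : ∀ r : ℝ, t * √(r ^ 2 + ‖y‖ ^ 2) ≤ r * c := by simp [hct, ← ht0]
        simp only [h1, if_true]
        rw [lintegral_mul_const' _ _ ENNReal.ofReal_ne_top, lintegral_Ioi_mul_exp_neg_sq le_rfl]
        simp only [ne_eq, OfNat.ofNat_ne_zero, not_false_eq_true, zero_pow, neg_zero, zero_div,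
          Real.exp_zero, ENNReal.ofReal_one, one_mul]
        congr 2
        ring
      simp only [this]
      rw [lintegral_exp_neg_mul_norm_sq (by norm_num), finrank_euclideanSpace_fin, capAngle,
        if_pos hct.ge, ← ht0]
      simp [mul_comm]
    · have h0 : capAngle n t β = 0 := by
        rw [capAngle, if_pos hct.ge, ← hc, hct, div_self (by positivity), sub_self,
          Real.zero_rpow hn0.ne']
      rw [h0, mul_zero, ENNReal.ofReal_zero]
      have hae : ∀ᵐ y : EuclideanSpace ℝ (Fin n), y ≠ 0 := by
        rw [ae_iff]; simp
      rw [lintegral_eq_zero_of_ae_eq_zero]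
      filter_upwards [hae] with y hy
      refine (setLIntegral_congr_fun measurableSet_Ioi fun r hr => ?_).trans lintegral_zero
      rw [if_neg]
      push Not
      rw [hct, mul_comm r]
      refine mul_lt_mul_of_pos_left ?_ ht0
      refine Real.lt_sqrt_of_sq_lt ?_
      have := norm_pos_iff.2 hy
      nlinarith
  · have hc0 : 0 < c := ht.trans_lt hct
    have hd : 0 < c ^ 2 - t ^ 2 := by nlinarith
    set κ := t / √(c ^ 2 - t ^ 2) with hκ
    have hκ0 : 0 ≤ κ := by positivity
    have hκ2 : κ ^ 2 * (c ^ 2 - t ^ 2) = t ^ 2 := by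
      rw [hκ, div_pow, Real.sq_sqrt hd.le]
      field_simp
    have hiff : ∀ (y : EuclideanSpace ℝ (Fin n)) (r : ℝ), 0 < r →
        (t * √(r ^ 2 + ‖y‖ ^ 2) ≤ r * c ↔ κ * ‖y‖ ≤ r) := by
      intro y r hr
      rw [← Real.sqrt_sq ht, ← Real.sqrt_mul (sq_nonneg t),
        Real.sqrt_le_left (by positivity)]
      have h1 : κ * ‖y‖ ≤ r ↔ (κ * ‖y‖) ^ 2 ≤ r ^ 2 :=
        (sq_le_sq₀ (by positivity) hr.le).symm
      rw [h1, ← mul_le_mul_iff_left₀ (b := (κ * ‖y‖) ^ 2) hd, mul_pow κ, mul_right_comm, hκ2]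
      constructor <;> intro h <;> nlinarith
    have hin : ∀ y : EuclideanSpace ℝ (Fin n), ∫⁻ r in Set.Ioi (0 : ℝ),
        (if t * √(r ^ 2 + ‖y‖ ^ 2) ≤ r * c then
        ENNReal.ofReal (r * Real.exp (-r ^ 2 / 2)) * ENNReal.ofReal (Real.exp (-‖y‖ ^ 2 / 2))
        else 0) = ENNReal.ofReal (Real.exp (-((1 + κ ^ 2) / 2) * ‖y‖ ^ 2)) := by
      intro y
      have h1 : ∫⁻ r in Set.Ioi (0 : ℝ), (if t * √(r ^ 2 + ‖y‖ ^ 2) ≤ r * c then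
          ENNReal.ofReal (r * Real.exp (-r ^ 2 / 2)) * ENNReal.ofReal (Real.exp (-‖y‖ ^ 2 / 2))
          else 0) = ∫⁻ r in Set.Ioi (0 : ℝ), (Set.Ici (κ * ‖y‖)).indicator (fun r =>
          ENNReal.ofReal (r * Real.exp (-r ^ 2 / 2)) *
            ENNReal.ofReal (Real.exp (-‖y‖ ^ 2 / 2))) r := by
        refine setLIntegral_congr_fun measurableSet_Ioi fun r hr => ?_
        simp only [Set.indicator, Set.mem_Ici, hiff y r hr]
      rw [h1, setLIntegral_indicator measurableSet_Ici]
      have h2 : (Set.Ici (κ * ‖y‖) ∩ Set.Ioi (0 : ℝ) : Set ℝ) =ᵐ[volume] Set.Ioi (κ * ‖y‖) := by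
        have ha : (Set.Ici (κ * ‖y‖) ∩ Set.Ioi (0 : ℝ) : Set ℝ) =ᵐ[volume]
            (Set.Ioi (κ * ‖y‖) ∩ Set.Ioi (0 : ℝ) : Set ℝ) :=
          (Ioi_ae_eq_Ici (a := κ * ‖y‖)).symm.inter (Filter.EventuallyEq.refl _ _)
        rwa [Set.inter_eq_left.2 (Set.Ioi_subset_Ioi
          (by positivity : (0 : ℝ) ≤ κ * ‖y‖))] at ha
      rw [setLIntegral_congr h2, lintegral_mul_const' _ _ ENNReal.ofReal_ne_top,
        lintegral_Ioi_mul_exp_neg_sq (by positivity), ← ENNReal.ofReal_mul (Real.exp_pos _).le,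
        ← Real.exp_add]
      congr 2
      ring
    simp only [hin]
    rw [lintegral_exp_neg_mul_norm_sq (by positivity), finrank_euclideanSpace_fin, capAngle,
      if_pos hct.le, ← hc, ← Real.mul_rpow (by positivity)]
    · congr 2
      field_simp
      nlinarith
    · rw [sub_nonneg, div_le_one (by positivity)]
      nlinarith

end Gaussian

/-! ### Two caps as a Gaussian cone. -/

section Cone

/-- The Gaussian measure of a cone is proportional to the measure of its trace on the sphere. -/
theorem uniformSphere_mul_gaussian {d : ℕ} [NeZero d] {A : Set (UnitSphere d)}
    (hA : MeasurableSet A) {B : Set (EuclideanSpace ℝ (Fin d))} (hB : MeasurableSet B)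
    (hAB : ∀ (θ : UnitSphere d) (r : ℝ), 0 < r →
      (r • (θ : EuclideanSpace ℝ (Fin d)) ∈ B ↔ θ ∈ A)) :
    uniformSphere d A * ∫⁻ v : EuclideanSpace ℝ (Fin d), ENNReal.ofReal (Real.exp (-‖v‖ ^ 2 / 2)) =
      ∫⁻ v in B, ENNReal.ofReal (Real.exp (-‖v‖ ^ 2 / 2)) := by
  -- The radial factor J is common to every cone and is absorbed in the total Gaussian mass.
  set J : ENNReal := ∫⁻ r, ENNReal.ofReal (Real.exp (-(r : ℝ) ^ 2 / 2))
    ∂(Measure.volumeIoiPow (Module.finrank ℝ (EuclideanSpace ℝ (Fin d)) - 1)) with hJ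
  have key : ∀ (A : Set (UnitSphere d)) (B : Set (EuclideanSpace ℝ (Fin d))), MeasurableSet A → MeasurableSet B →
      (∀ (θ : UnitSphere d) (r : ℝ), 0 < r → (r • (θ : (EuclideanSpace ℝ (Fin d))) ∈ B ↔ θ ∈ A)) →
      ∫⁻ v in B, ENNReal.ofReal (Real.exp (-‖v‖ ^ 2 / 2)) =
        (volume : Measure (EuclideanSpace ℝ (Fin d))).toSphere A * J := by
    intro A B hA hB hAB
    have mp := (volume : Measure (EuclideanSpace ℝ (Fin d))).measurePreserving_homeomorphUnitSphereProd
    have hm : Measurable fun r : Set.Ioi (0 : ℝ) => ENNReal.ofReal (Real.exp (-(r : ℝ) ^ 2 / 2)) := by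
      fun_prop
    have h1 := mp.lintegral_comp_emb (homeomorphUnitSphereProd (EuclideanSpace ℝ (Fin d))).measurableEmbedding
      (fun q => A.indicator 1 q.1 * ENNReal.ofReal (Real.exp (-(q.2 : ℝ) ^ 2 / 2)))
    rw [lintegral_prod_mul ((measurable_one.indicator hA).aemeasurable) hm.aemeasurable,
      lintegral_indicator_one hA] at h1
    rw [← h1, ← lintegral_indicator hB]
    have h2 := lintegral_subtype_comap (μ := (volume : Measure (EuclideanSpace ℝ (Fin d))))
      (measurableSet_singleton (0 : (EuclideanSpace ℝ (Fin d)))).compl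
      (B.indicator fun v => ENNReal.ofReal (Real.exp (-‖v‖ ^ 2 / 2)))
    have h3 : (volume : Measure (EuclideanSpace ℝ (Fin d))).restrict {0}ᶜ = volume := by
      rw [Measure.restrict_eq_self_of_ae_mem]
      rw [ae_iff]
      simp
    rw [h3] at h2
    rw [← h2]
    refine lintegral_congr fun v => ?_
    have hv : 0 < ‖(v : (EuclideanSpace ℝ (Fin d)))‖ := norm_pos_iff.2 v.2
    have hmem : (v : (EuclideanSpace ℝ (Fin d))) ∈ B ↔ (homeomorphUnitSphereProd (EuclideanSpace ℝ (Fin d)) v).1 ∈ A := by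
      rw [← hAB _ _ hv]
      congr! 1
      simp [smul_smul, hv.ne']
    by_cases hvB : (v : (EuclideanSpace ℝ (Fin d))) ∈ B
    · rw [Set.indicator_of_mem hvB, Set.indicator_of_mem (hmem.1 hvB)]
      simp
    · rw [Set.indicator_of_notMem hvB, Set.indicator_of_notMem (fun h => hvB (hmem.2 h)), zero_mul]
  have hu := key Set.univ Set.univ MeasurableSet.univ MeasurableSet.univ (by simp)
  rw [Measure.restrict_univ] at hu
  have h0 : (volume : Measure (EuclideanSpace ℝ (Fin d))).toSphere Set.univ ≠ 0 := by
    rw [Ne, Measure.measure_univ_eq_zero]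
    exact Measure.toSphere_ne_zero _
  rw [key A B hA hB hAB, hu, uniformSphere, Measure.smul_apply, smul_eq_mul, ← mul_assoc]
  congr 1
  rw [mul_right_comm, ENNReal.inv_mul_cancel h0 (measure_ne_top _ _), one_mul]

/-- The set of points of the sphere in two caps. -/
def twoCaps {d : ℕ} (t : ℝ) (x z : UnitSphere d) : Set (UnitSphere d) :=
  {y | t ≤ sinner x y ∧ t ≤ sinner z y}

theorem measurableSet_twoCaps {d : ℕ} (t : ℝ) (x z : UnitSphere d) :
    MeasurableSet (twoCaps t x z) :=
  (measurableSet_le measurable_const (isBddKernel_sinner.measurable_left x)).inter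
    (measurableSet_le measurable_const (isBddKernel_sinner.measurable_left z))

theorem measurable_capAngle (n : ℕ) (t : ℝ) : Measurable (capAngle n t) := by
  unfold capAngle
  refine Measurable.ite (measurableSet_le measurable_const Real.measurable_cos) ?_ measurable_const
  fun_prop

theorem capAngle_nonneg (n : ℕ) {t : ℝ} (ht : 0 ≤ t) (β : ℝ) : 0 ≤ capAngle n t β := by
  unfold capAngle
  split_ifs with h
  · refine Real.rpow_nonneg (sub_nonneg.2 (div_le_one_of_le₀ ?_ (sq_nonneg _))) _
    exact pow_le_pow_left₀ ht h 2
  · exact le_rfl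

theorem capAngle_le_one (n : ℕ) {t : ℝ} (ht : 0 ≤ t) (β : ℝ) : capAngle n t β ≤ 1 := by
  unfold capAngle
  split_ifs with h
  · refine Real.rpow_le_one (sub_nonneg.2 (div_le_one_of_le₀ ?_ (sq_nonneg _))) ?_ (by positivity)
    · exact pow_le_pow_left₀ ht h 2
    · rw [sub_le_self_iff]; positivity
  · exact zero_le_one

/-- The centres sit at angles ±h in their plane; only the constraint from the farther one, at angle
|α| + h, is binding. -/
theorem le_cos_abs_add_iff {a r t α h : ℝ} (hr : 0 < r) (hα : α ∈ Set.Ioo (-Real.pi) Real.pi)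
    (hh : h ∈ Set.Icc 0 (Real.pi / 2)) :
    (t * a ≤ r * Real.cos (α - h) ∧ t * a ≤ r * Real.cos (α + h)) ↔
      t * a ≤ r * Real.cos (|α| + h) := by
  have hs : 0 ≤ Real.sin h := Real.sin_nonneg_of_nonneg_of_le_pi hh.1 (by linarith [hh.2, Real.pi_pos])
  rw [Real.cos_sub, Real.cos_add, Real.cos_add, Real.cos_abs]
  rcases le_total 0 α with h0 | h0
  · rw [abs_of_nonneg h0]
    have : 0 ≤ Real.sin α := Real.sin_nonneg_of_nonneg_of_le_pi h0 hα.2.le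
    have h2 : 0 ≤ r * (Real.sin α * Real.sin h) := by positivity
    constructor
    · exact fun h => h.2
    · exact fun h => ⟨by linarith, h⟩
  · rw [abs_of_nonpos h0, Real.sin_neg]
    have : 0 ≤ Real.sin (-α) := Real.sin_nonneg_of_nonneg_of_le_pi (by linarith) (by linarith [hα.1])
    rw [Real.sin_neg] at this
    have h2 : 0 ≤ r * (-Real.sin α * Real.sin h) := by positivity
    constructor
    · exact fun h => by linarith [h.1]
    · exact fun h => ⟨by linarith, by linarith⟩

/-- Rotate the centres to exp(±ih) in the first factor of ℂ × ℝⁿ, pass to the Gaussian measure of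
the cone over the two caps, and use polar coordinates in ℂ. For fixed angle α the rest is
`lintegral_radial`. -/
theorem uniformSphere_twoCaps_lintegral {n : ℕ} (hn : 1 ≤ n) {t h : ℝ} (ht : 0 ≤ t)
    (hh : h ∈ Set.Icc 0 (Real.pi / 2)) {x z : UnitSphere (n + 2)}
    (hxz : sinner x z = Real.cos (2 * h)) :
    uniformSphere (n + 2) (twoCaps t x z) * ENNReal.ofReal (2 * Real.pi) =
      ∫⁻ α in Set.Ioo (-Real.pi) Real.pi, ENNReal.ofReal (capAngle n t (|α| + h)) := by
  have hpi := Real.pi_pos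
  have hfr : Module.finrank ℝ (WithLp 2 (ℂ × (EuclideanSpace ℝ (Fin n)))) = n + 2 := by
    rw [(WithLp.linearEquiv 2 ℝ (ℂ × (EuclideanSpace ℝ (Fin n)))).finrank_eq, Module.finrank_prod, Complex.finrank_real_complex,
      finrank_euclideanSpace_fin, add_comm]
  let e : WithLp 2 (ℂ × (EuclideanSpace ℝ (Fin n))) ≃ₗᵢ[ℝ] (EuclideanSpace ℝ (Fin (n + 2))) := ((stdOrthonormalBasis ℝ (WithLp 2 (ℂ × (EuclideanSpace ℝ (Fin n))))).reindex (finCongr hfr)).repr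
  let a : WithLp 2 (ℂ × (EuclideanSpace ℝ (Fin n))) := WithLp.toLp 2 (Complex.exp (h * Complex.I), 0)
  let b : WithLp 2 (ℂ × (EuclideanSpace ℝ (Fin n))) := WithLp.toLp 2 (Complex.exp (((-h : ℝ) : ℂ) * Complex.I), 0)
  have hnorm : ∀ c : ℂ, ‖(WithLp.toLp 2 (c, (0 : (EuclideanSpace ℝ (Fin n)))) : WithLp 2 (ℂ × (EuclideanSpace ℝ (Fin n))))‖ = ‖c‖ := by
    intro c
    rw [WithLp.prod_norm_eq_of_L2]
    simp
  have hinn : ∀ (s : ℝ) (r α : ℝ) (y : (EuclideanSpace ℝ (Fin n))),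
      inner ℝ (WithLp.toLp 2 (Complex.exp (s * Complex.I), (0 : (EuclideanSpace ℝ (Fin n)))) : WithLp 2 (ℂ × (EuclideanSpace ℝ (Fin n))))
        (WithLp.toLp 2 (Complex.polarCoord.symm (r, α), y)) = r * Real.cos (α - s) := by
    intro s r α y
    rw [WithLp.prod_inner_apply]
    simp only [inner_zero_left, add_zero, Complex.inner, Complex.polarCoord_symm_apply,
      Complex.exp_mul_I, map_add, map_mul, Complex.conj_I, ← Complex.ofReal_cos,
      ← Complex.ofReal_sin, Complex.conj_ofReal, Real.cos_sub]
    simp only [Complex.mul_re, Complex.add_re, Complex.ofReal_re, Complex.ofReal_im,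
      Complex.I_re, Complex.I_im, Complex.add_im, Complex.mul_im, Complex.neg_re, Complex.neg_im]
    ring
  have hab : inner ℝ a b = Real.cos (2 * h) := by
    have h1 := hinn h 1 (-h) 0
    rw [one_mul, show -h - h = -(2 * h) by ring, Real.cos_neg] at h1
    rw [← h1]
    have : Complex.polarCoord.symm (1, -h) = Complex.exp (((-h : ℝ) : ℂ) * Complex.I) := by
      rw [Complex.polarCoord_symm_apply, Complex.exp_mul_I]
      simp
    rw [this]
  let xa : UnitSphere (n + 2) := ⟨e a, by
    rw [mem_sphere_zero_iff_norm, e.norm_map, hnorm, Complex.norm_exp_ofReal_mul_I]⟩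
  let xb : UnitSphere (n + 2) := ⟨e b, by
    rw [mem_sphere_zero_iff_norm, e.norm_map, hnorm, Complex.norm_exp_ofReal_mul_I]⟩
  have hx : sinner x z = sinner xa xb := by
    rw [hxz, ← hab]
    exact (e.inner_map_map a b).symm
  obtain ⟨R, hR1, hR2⟩ := exists_rot_eq_pair hx
  have hcap : uniformSphere (n + 2) (twoCaps t x z) = uniformSphere (n + 2) (twoCaps t xa xb) := by
    rw [← (measurePreserving_rot R).measure_preimage
      (measurableSet_twoCaps t xa xb).nullMeasurableSet]
    congr 1
    ext y
    simp only [twoCaps, Set.mem_preimage, Set.mem_ofPred_eq, ← hR1, ← hR2, sinner_rot]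
  let B : Set (EuclideanSpace ℝ (Fin (n + 2))) := {v | t * ‖v‖ ≤ inner ℝ (e a) v ∧ t * ‖v‖ ≤ inner ℝ (e b) v}
  have hB : MeasurableSet B := by
    refine (measurableSet_le (f := fun v => t * ‖v‖) (g := fun v => inner ℝ (e a) v) ?_ ?_).inter
      (measurableSet_le (f := fun v => t * ‖v‖) (g := fun v => inner ℝ (e b) v) ?_ ?_) <;> fun_prop
  have hAB : ∀ (θ : UnitSphere (n + 2)) (r : ℝ), 0 < r →
      (r • (θ : (EuclideanSpace ℝ (Fin (n + 2)))) ∈ B ↔ θ ∈ twoCaps t xa xb) := by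
    intro θ r hr
    simp only [B, twoCaps, Set.mem_ofPred_eq, norm_smul, sphere_norm, mul_one, inner_smul_right,
      Real.norm_eq_abs, abs_of_pos hr, mul_comm t r, mul_le_mul_iff_right₀ hr]
    rfl
  have h1 := uniformSphere_mul_gaussian (measurableSet_twoCaps t xa xb) hB hAB
  have hZ : ∫⁻ v : (EuclideanSpace ℝ (Fin (n + 2))), ENNReal.ofReal (Real.exp (-‖v‖ ^ 2 / 2)) =
      ENNReal.ofReal (2 * Real.pi) * ENNReal.ofReal ((2 * Real.pi) ^ ((n : ℝ) / 2)) := by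
    have h2 := lintegral_exp_neg_mul_norm_sq (V := (EuclideanSpace ℝ (Fin (n + 2)))) (b := 1 / 2) (by norm_num)
    rw [finrank_euclideanSpace_fin] at h2
    rw [← ENNReal.ofReal_mul (by positivity)]
    convert! h2 using 2
    · ext v; congr 2; ring
    · push_cast
      rw [show ((n : ℝ) + 2) / 2 = 1 + n / 2 by ring, Real.rpow_add (by positivity), Real.rpow_one]
      congr 1
      · ring
      · congr 1; ring
  rw [hZ, ← mul_assoc, ← hcap] at h1
  have hK : ENNReal.ofReal ((2 * Real.pi) ^ ((n : ℝ) / 2)) ≠ 0 := by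
    rw [Ne, ENNReal.ofReal_eq_zero, not_le]; positivity
  refine (ENNReal.mul_left_inj hK ENNReal.ofReal_ne_top).1 (h1.trans ?_)
  let Q : ℂ × (EuclideanSpace ℝ (Fin n)) → ENNReal := fun q => B.indicator
    (fun v => ENNReal.ofReal (Real.exp (-‖v‖ ^ 2 / 2))) (e (WithLp.toLp 2 q))
  have hmQ : Measurable Q := by
    refine Measurable.comp (g := B.indicator fun v => ENNReal.ofReal (Real.exp (-‖v‖ ^ 2 / 2)))
      (Measurable.indicator (by fun_prop) hB) ?_
    exact e.continuous.measurable.comp (WithLp.volume_preserving_toLp ℂ (EuclideanSpace ℝ (Fin n))).measurable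
  have step1 : ∫⁻ v in B, ENNReal.ofReal (Real.exp (-‖v‖ ^ 2 / 2)) = ∫⁻ q : ℂ × (EuclideanSpace ℝ (Fin n)), Q q := by
    have mp := e.measurePreserving.comp (WithLp.volume_preserving_toLp ℂ (EuclideanSpace ℝ (Fin n)))
    rw [← lintegral_indicator hB, ← mp.lintegral_comp (Measurable.indicator (by fun_prop) hB)]
    rfl
  have step2 : ∀ y : (EuclideanSpace ℝ (Fin n)), ∫⁻ c : ℂ, Q (c, y) = ∫⁻ α in Set.Ioo (-Real.pi) Real.pi,
      ∫⁻ r in Set.Ioi (0 : ℝ), ENNReal.ofReal r * Q (Complex.polarCoord.symm (r, α), y) := by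
    intro y
    rw [← Complex.lintegral_comp_polarCoord_symm, polarCoord_target, Measure.volume_eq_prod,
      ← Measure.prod_restrict, lintegral_prod_symm]
    · rfl
    · refine Measurable.aemeasurable ?_
      refine (ENNReal.measurable_ofReal.comp measurable_fst).mul (hmQ.comp ?_)
      refine Measurable.prodMk ?_ measurable_const
      rw [funext Complex.polarCoord_symm_apply]
      fun_prop
  have step3 : ∀ y : (EuclideanSpace ℝ (Fin n)), ∀ α ∈ Set.Ioo (-Real.pi) Real.pi, ∀ r ∈ Set.Ioi (0 : ℝ),
      ENNReal.ofReal r * Q (Complex.polarCoord.symm (r, α), y) =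
      (if t * √(r ^ 2 + ‖y‖ ^ 2) ≤ r * Real.cos (|α| + h) then
        ENNReal.ofReal (r * Real.exp (-r ^ 2 / 2)) * ENNReal.ofReal (Real.exp (-‖y‖ ^ 2 / 2))
        else 0) := by
    intro y α hα r hr
    have hr : 0 < r := hr
    have hnq : ‖e (WithLp.toLp 2 (Complex.polarCoord.symm (r, α), y))‖ =
        √(r ^ 2 + ‖y‖ ^ 2) := by
      rw [e.norm_map, WithLp.prod_norm_eq_of_L2]
      simp [Complex.norm_polarCoord_symm, -Complex.polarCoord_symm_apply]
    have hmem : e (WithLp.toLp 2 (Complex.polarCoord.symm (r, α), y)) ∈ B ↔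
        t * √(r ^ 2 + ‖y‖ ^ 2) ≤ r * Real.cos (|α| + h) := by
      rw [← le_cos_abs_add_iff hr hα hh]
      simp only [B, Set.mem_ofPred_eq, hnq, e.inner_map_map, a, b, hinn, sub_neg_eq_add]
    simp only [Q, Set.indicator, hmem]
    split_ifs
    · rw [hnq, Real.sq_sqrt (by positivity), ← ENNReal.ofReal_mul hr.le,
        ← ENNReal.ofReal_mul (by positivity), mul_assoc, ← Real.exp_add]
      congr 3
      ring
    · rw [mul_zero]
  rw [step1, Measure.volume_eq_prod, lintegral_prod_symm _ hmQ.aemeasurable]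
  have step4 : ∀ y : (EuclideanSpace ℝ (Fin n)), ∫⁻ c : ℂ, Q (c, y) = ∫⁻ α in Set.Ioo (-Real.pi) Real.pi,
      ∫⁻ r in Set.Ioi (0 : ℝ),
      (if t * √(r ^ 2 + ‖y‖ ^ 2) ≤ r * Real.cos (|α| + h) then
        ENNReal.ofReal (r * Real.exp (-r ^ 2 / 2)) * ENNReal.ofReal (Real.exp (-‖y‖ ^ 2 / 2))
        else 0) := by
    intro y
    rw [step2]
    exact setLIntegral_congr_fun measurableSet_Ioo fun α hα =>
      setLIntegral_congr_fun measurableSet_Ioi fun r hr => step3 y α hα r hr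
  simp only [step4]
  rw [lintegral_lintegral_swap]
  · simp only [lintegral_radial hn ht]
    rw [← lintegral_mul_const' _ _ ENNReal.ofReal_ne_top]
    refine lintegral_congr fun α => ?_
    rw [mul_comm, ENNReal.ofReal_mul (capAngle_nonneg n ht _)]
  · refine Measurable.aemeasurable ?_
    have hm : Measurable fun q : ((EuclideanSpace ℝ (Fin n)) × ℝ) × ℝ =>
        (if t * √(q.2 ^ 2 + ‖q.1.1‖ ^ 2) ≤ q.2 * Real.cos (|q.1.2| + h) then
        ENNReal.ofReal (q.2 * Real.exp (-q.2 ^ 2 / 2)) *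
          ENNReal.ofReal (Real.exp (-‖q.1.1‖ ^ 2 / 2)) else 0) := by
      refine Measurable.ite (measurableSet_le (by fun_prop) ?_) (by fun_prop) measurable_const
      exact measurable_snd.mul (Real.measurable_cos.comp
        ((measurable_snd.comp measurable_fst).abs.add_const h))
    exact hm.lintegral_prod_right'

end Cone

/-! ### The measure of caps and of their intersections as a one-dimensional integral. -/

section CapArea

/-- The value of `capAngle` at angles in `[0, π / 2)`, in closed form. -/
noncomputable def capProfile (n : ℕ) (t β : ℝ) : ℝ :=
  max 0 (1 - t ^ 2 / Real.cos β ^ 2) ^ ((n : ℝ) / 2)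

/-- The measure of the intersection of two caps of height `t` whose centres are at angle `2 * h`,
as a function of `h`. -/
noncomputable def capArea (n : ℕ) (t h : ℝ) : ℝ :=
  (1 / Real.pi) * ∫ β in h..(Real.pi / 2), capProfile n t β

variable {n : ℕ}

theorem capProfile_nonneg (n : ℕ) (t β : ℝ) : 0 ≤ capProfile n t β :=
  Real.rpow_nonneg (le_max_left _ _) _

theorem capProfile_le_one (n : ℕ) (t β : ℝ) : capProfile n t β ≤ 1 := by
  refine Real.rpow_le_one (le_max_left _ _) (max_le zero_le_one ?_) (by positivity)
  rw [sub_le_self_iff]; positivity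

theorem measurable_capProfile (n : ℕ) (t : ℝ) : Measurable (capProfile n t) := by
  unfold capProfile
  fun_prop

theorem intervalIntegrable_capProfile (n : ℕ) (t a b : ℝ) :
    IntervalIntegrable (capProfile n t) volume a b := by
  refine (intervalIntegrable_const (c := (1 : ℝ))).mono_fun
    (measurable_capProfile n t).aestronglyMeasurable (Filter.Eventually.of_forall fun β => ?_)
  simp only [Real.norm_of_nonneg (capProfile_nonneg n t β), norm_one]
  exact capProfile_le_one n t β

theorem capAngle_eq_capProfile (hn : 1 ≤ n) {t β : ℝ} (ht : 0 ≤ t) (hβ : 0 < Real.cos β) :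
    capAngle n t β = capProfile n t β := by
  unfold capAngle capProfile
  have hn0 : ((n : ℝ) / 2) ≠ 0 := by
    have : (1 : ℝ) ≤ n := by exact_mod_cast hn
    positivity
  split_ifs with h
  · rw [max_eq_right]
    rw [sub_nonneg, div_le_one (by positivity)]
    exact pow_le_pow_left₀ ht h 2
  · rw [max_eq_left, Real.zero_rpow hn0]
    rw [sub_nonpos, one_le_div (by positivity)]
    exact pow_le_pow_left₀ hβ.le (not_le.1 h).le 2

theorem intervalIntegrable_capAngle (n : ℕ) {t : ℝ} (ht : 0 ≤ t) (a b : ℝ) :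
    IntervalIntegrable (capAngle n t) volume a b := by
  refine (intervalIntegrable_const (c := (1 : ℝ))).mono_fun
    (measurable_capAngle n t).aestronglyMeasurable (Filter.Eventually.of_forall fun β => ?_)
  simp only [Real.norm_of_nonneg (capAngle_nonneg n ht β), norm_one]
  exact capAngle_le_one n ht β

/-- Evenness in α folds the integral onto [0, π]; after the shift by h, angles beyond π/2 contribute
nothing because the cosine is negative there. -/
theorem integral_capAngle (hn : 1 ≤ n) {t h : ℝ} (ht : 0 ≤ t)
    (hh : h ∈ Set.Icc 0 (Real.pi / 2)) :
    ∫ α in Set.Ioo (-Real.pi) Real.pi, capAngle n t (|α| + h) =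
      2 * ∫ β in h..(Real.pi / 2), capProfile n t β := by
  have hpi := Real.pi_pos
  have hm : Measurable fun α => capAngle n t (|α| + h) :=
    (measurable_capAngle n t).comp (measurable_id.abs.add_const h)
  have hI : ∀ a b, IntervalIntegrable (fun α => capAngle n t (|α| + h)) volume a b := by
    intro a b
    refine (intervalIntegrable_const (c := (1 : ℝ))).mono_fun hm.aestronglyMeasurable
      (Filter.Eventually.of_forall fun β => ?_)
    simp only [Real.norm_of_nonneg (capAngle_nonneg n ht _), norm_one]
    exact capAngle_le_one n ht _
  rw [← integral_Ioc_eq_integral_Ioo, ← intervalIntegral.integral_of_le (by linarith),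
    ← intervalIntegral.integral_add_adjacent_intervals (hI (-Real.pi) 0) (hI 0 Real.pi)]
  have h1 : ∫ α in (-Real.pi)..0, capAngle n t (|α| + h) =
      ∫ α in (0 : ℝ)..Real.pi, capAngle n t (|α| + h) := by
    have := intervalIntegral.integral_comp_neg (a := 0) (b := Real.pi)
      fun α => capAngle n t (|α| + h)
    simp only [abs_neg, neg_zero] at this
    exact this.symm
  have h2 : ∫ α in (0 : ℝ)..Real.pi, capAngle n t (|α| + h) =
      ∫ α in (0 : ℝ)..Real.pi, capAngle n t (α + h) := by
    refine intervalIntegral.integral_congr fun α hα => ?_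
    rw [Set.uIcc_of_le hpi.le] at hα
    simp only [abs_of_nonneg hα.1]
  have h3 : ∫ β in (Real.pi / 2)..(Real.pi + h), capAngle n t β = 0 := by
    refine intervalIntegral.integral_zero_ae ?_
    -- For h = π/2 the range reaches 3π/2, where the cosine vanishes and `capAngle` is nonzero if t
    -- = 0.
    have : ∀ᵐ β : ℝ, β ≠ 3 * Real.pi / 2 := by simp [ae_iff]
    filter_upwards [this] with β hβ0 hβ
    rw [Set.uIoc_of_le (by linarith [hh.1])] at hβ
    have hβ1 : β < Real.pi + Real.pi / 2 :=
      lt_of_le_of_ne (by linarith [hβ.2, hh.2]) fun h => hβ0 (by rw [h]; ring)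
    have := Real.cos_neg_of_pi_div_two_lt_of_lt hβ.1 hβ1
    rw [capAngle, if_neg (by linarith)]
  rw [h1, h2, intervalIntegral.integral_comp_add_right (fun β => capAngle n t β), zero_add,
    ← intervalIntegral.integral_add_adjacent_intervals
      (intervalIntegrable_capAngle n ht h (Real.pi / 2))
      (intervalIntegrable_capAngle n ht (Real.pi / 2) (Real.pi + h)), h3, add_zero, ← two_mul]
  congr 1
  refine intervalIntegral.integral_congr_ae ?_
  have : ∀ᵐ β : ℝ, β ≠ Real.pi / 2 := by simp [ae_iff]
  filter_upwards [this] with β hβ0 hβ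
  rw [Set.uIoc_of_le hh.2] at hβ
  exact capAngle_eq_capProfile hn ht (Real.cos_pos_of_mem_Ioo
    ⟨by linarith [hβ.1, hh.1], lt_of_le_of_ne hβ.2 hβ0⟩)

theorem uniformSphere_twoCaps (hn : 1 ≤ n) {t h : ℝ} (ht : 0 ≤ t)
    (hh : h ∈ Set.Icc 0 (Real.pi / 2)) {x z : UnitSphere (n + 2)}
    (hxz : sinner x z = Real.cos (2 * h)) :
    (uniformSphere (n + 2)).real (twoCaps t x z) = capArea n t h := by
  have hpi := Real.pi_pos
  have h1 := uniformSphere_twoCaps_lintegral hn ht hh hxz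
  have hm : Measurable fun α => capAngle n t (|α| + h) :=
    (measurable_capAngle n t).comp (measurable_id.abs.add_const h)
  have hi : Integrable (fun α => capAngle n t (|α| + h))
      (volume.restrict (Set.Ioo (-Real.pi) Real.pi)) :=
    integrable_of_bdd hm (C := 1) fun α => by
      rw [abs_of_nonneg (capAngle_nonneg n ht _)]
      exact capAngle_le_one n ht _
  rw [← ofReal_integral_eq_lintegral_ofReal hi
    (Filter.Eventually.of_forall fun _ => capAngle_nonneg n ht _), integral_capAngle hn ht hh] at h1
  have h2 := congrArg ENNReal.toReal h1
  have h3 : 0 ≤ ∫ β in h..(Real.pi / 2), capProfile n t β :=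
    intervalIntegral.integral_nonneg hh.2 fun _ _ => capProfile_nonneg _ _ _
  rw [ENNReal.toReal_mul, ENNReal.toReal_ofReal (by positivity),
    ENNReal.toReal_ofReal (by positivity)] at h2
  rw [measureReal_def, capArea]
  field_simp
  linarith

/-- The set of points of the sphere whose inner product with `x` is at least `t`. -/
def cap {d : ℕ} (t : ℝ) (x : UnitSphere d) : Set (UnitSphere d) := {y | t ≤ sinner x y}

theorem measurableSet_cap {d : ℕ} (t : ℝ) (x : UnitSphere d) : MeasurableSet (cap t x) :=
  measurableSet_le measurable_const (isBddKernel_sinner.measurable_left x)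

theorem uniformSphere_cap (hn : 1 ≤ n) {t : ℝ} (ht : 0 ≤ t) (x : UnitSphere (n + 2)) :
    (uniformSphere (n + 2)).real (cap t x) = capArea n t 0 := by
  rw [← uniformSphere_twoCaps hn ht ⟨le_rfl, by positivity⟩ (x := x) (z := x)
    (by rw [sinner_self, mul_zero, Real.cos_zero])]
  congr 1
  ext y
  simp [cap, twoCaps]

theorem uniformSphere_cap_const {d : ℕ} (t : ℝ) (x x' : UnitSphere d) :
    uniformSphere d (cap t x) = uniformSphere d (cap t x') := by
  obtain ⟨R, hR, -⟩ := exists_rot_eq_pair (x := x) (y := x) (x' := x') (y' := x')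
    (by rw [sinner_self, sinner_self])
  rw [← (measurePreserving_rot R).measure_preimage (measurableSet_cap t x').nullMeasurableSet]
  congr 1
  ext y
  simp only [cap, Set.mem_preimage, Set.mem_ofPred_eq, ← hR, sinner_rot]

theorem innerTail_eq_cap {d : ℕ} [NeZero d] (t : ℝ) (x : UnitSphere d) :
    innerTail d t = (uniformSphere d).real (cap t x) := by
  have hms : MeasurableSet {q : UnitSphere d × UnitSphere d | t ≤ Function.uncurry sinner q} :=
    measurableSet_le measurable_const measurable_sinner
  change ((uniformSphere d).prod (uniformSphere d)).real
    {q : UnitSphere d × UnitSphere d | t ≤ Function.uncurry sinner q} = _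
  rw [measureReal_def, measureReal_def, Measure.prod_apply hms]
  congr 1
  have : ∀ y : UnitSphere d, uniformSphere d (Prod.mk y ⁻¹' {q : UnitSphere d × UnitSphere d |
      t ≤ Function.uncurry sinner q}) = uniformSphere d (cap t x) := fun y =>
    uniformSphere_cap_const t y x
  calc _ = ∫⁻ _, uniformSphere d (cap t x) ∂uniformSphere d := lintegral_congr this
    _ = _ := by simp

/-- The integrand is largest at β = 0, and the interval has length π/2. -/
theorem capArea_zero_le (hn : 1 ≤ n) (t : ℝ) :
    capArea n t 0 ≤ 1 / 2 * max 0 (1 - t ^ 2) ^ ((n : ℝ) / 2) := by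
  have hpi := Real.pi_pos
  have h : ∫ β in (0 : ℝ)..(Real.pi / 2), capProfile n t β ≤
      ∫ _ in (0 : ℝ)..(Real.pi / 2), max 0 (1 - t ^ 2) ^ ((n : ℝ) / 2) := by
    refine intervalIntegral.integral_mono_on_of_le_Ioo (by positivity)
      (intervalIntegrable_capProfile _ _ _ _) intervalIntegrable_const fun β hβ => ?_
    refine Real.rpow_le_rpow (le_max_left _ _) (max_le_max le_rfl ?_) (by positivity)
    have hc : 0 < Real.cos β := Real.cos_pos_of_mem_Ioo ⟨by linarith [hβ.1], hβ.2⟩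
    have : t ^ 2 ≤ t ^ 2 / Real.cos β ^ 2 := by
      rw [le_div_iff₀ (by positivity)]
      exact mul_le_of_le_one_right (sq_nonneg t) (pow_le_one₀ hc.le (Real.cos_le_one β))
    linarith
  rw [intervalIntegral.integral_const, smul_eq_mul, sub_zero] at h
  rw [capArea]
  calc _ ≤ 1 / Real.pi * (Real.pi / 2 * max 0 (1 - t ^ 2) ^ ((n : ℝ) / 2)) := by gcongr
    _ = _ := by field_simp

theorem capArea_zero_nonneg (n : ℕ) (t : ℝ) : 0 ≤ capArea n t 0 :=
  mul_nonneg (by have := Real.pi_pos; positivity)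
    (intervalIntegral.integral_nonneg (by positivity) fun _ _ => capProfile_nonneg _ _ _)

theorem continuous_capArea_zero (n : ℕ) : Continuous fun t => capArea n t 0 := by
  refine continuous_const.mul (intervalIntegral.continuous_of_dominated_interval
    (bound := fun _ => 1) (fun t => (measurable_capProfile n t).aestronglyMeasurable)
    (fun t => Filter.Eventually.of_forall fun β _ => ?_) intervalIntegrable_const
    (Filter.Eventually.of_forall fun β _ => ?_))
  · rw [Real.norm_of_nonneg (capProfile_nonneg n t β)]
    exact capProfile_le_one n t β
  · unfold capProfile
    refine Continuous.rpow_const (by fun_prop) fun t => Or.inr (by positivity)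

theorem capArea_zero_zero (n : ℕ) : capArea n 0 0 = 1 / 2 := by
  have hpi := Real.pi_pos
  simp [capArea, capProfile]
  field_simp

/-- Intermediate value theorem: the cap measure is continuous in t, equal to 1/2 at t = 0 and to 0
at t = 1. This makes `threshold` meaningful. -/
theorem exists_innerTail_eq (hn : 1 ≤ n) {p : ℝ} (hp0 : 0 ≤ p) (hp : p ≤ 1 / 2) :
    ∃ t, innerTail (n + 2) t = p := by
  have hn0 : ((n : ℝ) / 2) ≠ 0 := by
    have : (1 : ℝ) ≤ n := by exact_mod_cast hn
    positivity
  have h1 : capArea n 1 0 = 0 := by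
    refine le_antisymm ((capArea_zero_le hn 1).trans_eq ?_) (capArea_zero_nonneg n 1)
    simp [Real.zero_rpow hn0]
  obtain ⟨t, ht, h⟩ := intermediate_value_Icc' (zero_le_one' ℝ)
    (continuous_capArea_zero n).continuousOn (show p ∈ Set.Icc (capArea n 1 0) (capArea n 0 0) by
      rw [h1, capArea_zero_zero]; exact ⟨hp0, hp⟩)
  exact ⟨t, by rw [innerTail_eq_cap t (axis 0), uniformSphere_cap hn ht.1]; exact h⟩

/-- If t were negative, the antipodal map would carry the complement of the cap, of measure 1 - p ≥
1/2, into the cap at height -t, whose measure is below 1/2. -/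
theorem threshold_nonneg (hn : 1 ≤ n) {p : ℝ} (hp0 : 0 ≤ p) (hp : p ≤ 1 / 2) :
    0 ≤ threshold p (n + 2) := by
  by_contra! hneg
  set t := threshold p (n + 2)
  have hn0 : 0 < ((n : ℝ) / 2) := by
    have : (1 : ℝ) ≤ n := by exact_mod_cast hn
    positivity
  have h1 : innerTail (n + 2) t = p := innerTail_threshold (exists_innerTail_eq hn hp0 hp)
  let x : UnitSphere (n + 2) := axis 0
  rw [innerTail_eq_cap t x] at h1
  have h2 : (uniformSphere (n + 2)).real (cap t x)ᶜ ≤ (uniformSphere (n + 2)).real (cap (-t) x) := by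
    rw [measureReal_def, measureReal_def,
      ← (measurePreserving_rot (LinearIsometryEquiv.neg ℝ)).measure_preimage
        (measurableSet_cap (-t) x).nullMeasurableSet]
    refine ENNReal.toReal_mono (measure_ne_top _ _) (measure_mono fun y hy => ?_)
    have hy : ¬ t ≤ sinner x y := hy
    have h3 : sinner x (rot (LinearIsometryEquiv.neg ℝ) y) = - sinner x y := by simp [sinner, rot]
    change -t ≤ sinner x (rot (LinearIsometryEquiv.neg ℝ) y)
    rw [h3]
    linarith
  rw [probReal_compl_eq_one_sub (measurableSet_cap t x),
    uniformSphere_cap hn (t := -t) (by linarith), h1] at h2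
  have h3 := capArea_zero_le hn (-t)
  have h4 : max 0 (1 - (-t) ^ 2) ^ ((n : ℝ) / 2) < 1 := by
    refine Real.rpow_lt_one (le_max_left _ _) (max_lt one_pos ?_) hn0
    nlinarith
  linarith

theorem capArea_threshold (hn : 1 ≤ n) {p : ℝ} (hp0 : 0 ≤ p) (hp : p ≤ 1 / 2) :
    capArea n (threshold p (n + 2)) 0 = p := by
  rw [← uniformSphere_cap hn (threshold_nonneg hn hp0 hp) (axis 0), ← innerTail_eq_cap]
  exact innerTail_threshold (exists_innerTail_eq hn hp0 hp)

end CapArea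

/-! ### Comparison of the cap measure p, L = log(1/p), the height t and the slope. -/

section TailEstimates

variable {n : ℕ} {t : ℝ}

theorem one_sub_sq_rpow_le_exp (n : ℕ) (ht : t ^ 2 ≤ 1) :
    (1 - t ^ 2) ^ ((n : ℝ) / 2) ≤ Real.exp (-(n * t ^ 2) / 2) := by
  have h : 1 - t ^ 2 ≤ Real.exp (-t ^ 2) := by linarith [Real.add_one_le_exp (-t ^ 2)]
  calc (1 - t ^ 2) ^ ((n : ℝ) / 2) ≤ Real.exp (-t ^ 2) ^ ((n : ℝ) / 2) :=
        Real.rpow_le_rpow (by linarith) h (by positivity)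
    _ = _ := by
        rw [← Real.exp_mul]
        congr 1
        ring

theorem sq_lt_one_of_capArea_pos (hn : 1 ≤ n) (h : 0 < capArea n t 0) : t ^ 2 < 1 := by
  by_contra! h1
  have hn0 : ((n : ℝ) / 2) ≠ 0 := by
    have : (1 : ℝ) ≤ n := by exact_mod_cast hn
    positivity
  have := capArea_zero_le hn t
  rw [max_eq_left (by linarith), Real.zero_rpow hn0] at this
  linarith

theorem capArea_zero_le_rpow (hn : 1 ≤ n) (ht : t ^ 2 ≤ 1) :
    capArea n t 0 ≤ 1 / 2 * (1 - t ^ 2) ^ ((n : ℝ) / 2) := by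
  have := capArea_zero_le hn t
  rwa [max_eq_right (by linarith)] at this

theorem mul_sq_le_two_mul_log (hn : 1 ≤ n) (h : 0 < capArea n t 0) :
    n * t ^ 2 ≤ 2 * Real.log (1 / capArea n t 0) := by
  have h1 := sq_lt_one_of_capArea_pos hn h
  have h2 : capArea n t 0 ≤ Real.exp (-(n * t ^ 2) / 2) := by
    have := capArea_zero_le_rpow hn h1.le
    have := one_sub_sq_rpow_le_exp n h1.le
    have := Real.rpow_nonneg (by linarith : 0 ≤ 1 - t ^ 2) ((n : ℝ) / 2)
    linarith
  have h3 := Real.log_le_log h h2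
  rw [Real.log_exp] at h3
  rw [one_div, Real.log_inv]
  linarith

/-- On angles β ≤ 1/(4√L) the integrand keeps at least 3/4 of its value at 0, since the loss in the
exponent is of order n t² β² ≤ 2 L β². The length of this interval accounts for √L. -/
theorem one_sub_sq_rpow_le_capArea (hn : 2 ≤ n) (ht : t ^ 2 ≤ 1 / 2) {L : ℝ} (hL : 1 / 2 ≤ L)
    (hnt : n * t ^ 2 ≤ 2 * L) :
    (1 - t ^ 2) ^ ((n : ℝ) / 2) ≤ 17 * √L * capArea n t 0 := by
  have hpi := Real.pi_pos
  have hpi3 := Real.pi_gt_three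
  have hpi4 := Real.pi_lt_four
  set Q := (1 - t ^ 2) ^ ((n : ℝ) / 2) with hQ
  have hn2 : (1 : ℝ) ≤ n / 2 := by
    have : (2 : ℝ) ≤ n := by exact_mod_cast hn
    linarith
  have hQ0 : 0 ≤ Q := Real.rpow_nonneg (by linarith) _
  have hsL : 0 < √L := Real.sqrt_pos.2 (by linarith)
  have hsL2 : √L ^ 2 = L := Real.sq_sqrt (by linarith)
  have hsL1 : 1 / 2 ≤ √L := Real.le_sqrt_of_sq_le (by linarith)
  set a := 1 / (4 * √L) with ha
  have ha0 : 0 < a := by positivity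
  have ha2 : a ^ 2 * L = 1 / 16 := by
    have hL0 : L ≠ 0 := by linarith
    rw [ha, div_pow, mul_pow, hsL2]; field_simp; norm_num
  have ha1 : a ≤ 1 / 2 := by
    rw [ha, div_le_div_iff₀ (by positivity) two_pos]
    linarith
  have hlow : ∀ β ∈ Set.Icc 0 a, 3 / 4 * Q ≤ capProfile n t β := by
    intro β hβ
    have hb2 : β ^ 2 ≤ a ^ 2 := pow_le_pow_left₀ hβ.1 hβ.2 2
    have hb4 : β ^ 2 ≤ 1 / 4 := hb2.trans ((pow_le_pow_left₀ ha0.le ha1 2).trans (by norm_num))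
    have hsin : Real.sin β ^ 2 ≤ β ^ 2 := Real.sin_sq_le_sq
    have hcos : 1 - β ^ 2 ≤ Real.cos β ^ 2 := by linarith [Real.sin_sq_add_cos_sq β]
    have hcos0 : 0 < Real.cos β ^ 2 := by linarith
    have hinv : 1 / Real.cos β ^ 2 ≤ 1 + 2 * β ^ 2 := by
      rw [div_le_iff₀ hcos0]
      nlinarith [sq_nonneg β]
    have hdiv : t ^ 2 / Real.cos β ^ 2 ≤ t ^ 2 * (1 + 2 * β ^ 2) := by
      rw [div_eq_mul_one_div]
      exact mul_le_mul_of_nonneg_left hinv (sq_nonneg t)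
    have h0 : 0 ≤ 1 - 4 * (t ^ 2 * β ^ 2) := by nlinarith [sq_nonneg t, sq_nonneg β]
    have h1 : (1 - t ^ 2) * (1 - 4 * (t ^ 2 * β ^ 2)) ≤ 1 - t ^ 2 / Real.cos β ^ 2 := by
      have : 0 ≤ t ^ 2 * β ^ 2 := by positivity
      nlinarith
    have h2 : 3 / 4 ≤ (1 - 4 * (t ^ 2 * β ^ 2)) ^ ((n : ℝ) / 2) := by
      have h3 := one_add_mul_self_le_rpow_one_add (s := -(4 * (t ^ 2 * β ^ 2))) (by linarith) hn2
      rw [← sub_eq_add_neg] at h3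
      have h4 : n * t ^ 2 * β ^ 2 ≤ 2 * L * a ^ 2 := by
        have : (0 : ℝ) ≤ n * t ^ 2 := by positivity
        exact mul_le_mul hnt hb2 (sq_nonneg _) (by linarith)
      have h5 : 2 * L * a ^ 2 = 1 / 8 := by linarith
      linarith
    calc 3 / 4 * Q ≤ (1 - 4 * (t ^ 2 * β ^ 2)) ^ ((n : ℝ) / 2) * Q := by gcongr
      _ = ((1 - t ^ 2) * (1 - 4 * (t ^ 2 * β ^ 2))) ^ ((n : ℝ) / 2) := by
        rw [Real.mul_rpow (by linarith) h0, mul_comm]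
      _ ≤ capProfile n t β := Real.rpow_le_rpow (mul_nonneg (by linarith) h0)
        (h1.trans (le_max_right _ _)) (by positivity)
  have hsplit := intervalIntegral.integral_add_adjacent_intervals
    (intervalIntegrable_capProfile n t 0 a) (intervalIntegrable_capProfile n t a (Real.pi / 2))
  have hnn : 0 ≤ ∫ β in a..(Real.pi / 2), capProfile n t β :=
    intervalIntegral.integral_nonneg (by linarith) fun _ _ => capProfile_nonneg _ _ _
  have hint : a * (3 / 4 * Q) ≤ ∫ β in (0 : ℝ)..a, capProfile n t β := by
    have := intervalIntegral.integral_mono_on ha0.le (μ := volume) intervalIntegrable_const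
      (intervalIntegrable_capProfile n t 0 a) hlow
    rwa [intervalIntegral.integral_const, sub_zero, smul_eq_mul] at this
  have hp : a * (3 / 4 * Q) ≤ Real.pi * capArea n t 0 := by
    rw [capArea, ← hsplit]
    field_simp
    linarith
  have hc0 := capArea_zero_nonneg n t
  have h6 : Q = 16 / 3 * √L * (a * (3 / 4 * Q)) := by
    rw [ha]; field_simp; norm_num
  calc Q = 16 / 3 * √L * (a * (3 / 4 * Q)) := h6
    _ ≤ 16 / 3 * √L * (Real.pi * capArea n t 0) := by gcongr
    _ ≤ 16 / 3 * √L * (3.15 * capArea n t 0) := by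
      gcongr
      linarith [Real.pi_lt_d2]
    _ ≤ 17 * √L * capArea n t 0 := by
      have : 0 ≤ √L * capArea n t 0 := by positivity
      linarith

/-- The integrand is at most Q exp(-n t² β² / 2), so a Gaussian integral gives p² n t² ≤ Q²/4; the
trivial bound p ≤ Q/2 gives the summand without n t². -/
theorem capArea_sq_mul_le (hn : 1 ≤ n) (ht : t ^ 2 < 1) :
    capArea n t 0 ^ 2 * (1 + n * t ^ 2) ≤ ((1 - t ^ 2) ^ ((n : ℝ) / 2)) ^ 2 / 2 := by
  have hpi := Real.pi_pos
  set Q := (1 - t ^ 2) ^ ((n : ℝ) / 2) with hQ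
  have hQ0 : 0 ≤ Q := Real.rpow_nonneg (by linarith) _
  have hc0 := capArea_zero_nonneg n t
  have h1 : capArea n t 0 ^ 2 ≤ Q ^ 2 / 4 := by
    have := pow_le_pow_left₀ hc0 (capArea_zero_le_rpow hn ht.le) 2
    rw [mul_pow] at this
    linarith
  have h2 : capArea n t 0 ^ 2 * (n * t ^ 2) ≤ Q ^ 2 / 4 := by
    rcases eq_or_ne t 0 with rfl | ht0
    · have : 0 ≤ Q ^ 2 / 4 := by positivity
      simpa using this
    set b := n * t ^ 2 / 2 with hb
    have hb0 : 0 < b := by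
      have : (1 : ℝ) ≤ n := by exact_mod_cast hn
      positivity
    have hup : ∫ β in (0 : ℝ)..(Real.pi / 2), capProfile n t β ≤
        ∫ β in (0 : ℝ)..(Real.pi / 2), Q * Real.exp (-b * β ^ 2) := by
      refine intervalIntegral.integral_mono_on_of_le_Ioo (by positivity)
        (intervalIntegrable_capProfile _ _ _ _)
        (Continuous.intervalIntegrable (by fun_prop) _ _) fun β hβ => ?_
      have hc : 0 < Real.cos β := Real.cos_pos_of_mem_Ioo ⟨by linarith [hβ.1], hβ.2⟩
      have hsin0 : 0 ≤ Real.sin β := Real.sin_nonneg_of_nonneg_of_le_pi hβ.1.le (by linarith [hβ.2])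
      -- tan β ≥ β amounts to 1/cos² β ≥ 1 + β².
      have htan : β ≤ Real.tan β := Real.le_tan hβ.1.le hβ.2
      have hsc : β * Real.cos β ≤ Real.sin β := by
        rw [Real.tan_eq_sin_div_cos, le_div_iff₀ hc] at htan
        exact htan
      have hsc2 : β ^ 2 * Real.cos β ^ 2 ≤ 1 - Real.cos β ^ 2 := by
        have := pow_le_pow_left₀ (mul_nonneg hβ.1.le hc.le) hsc 2
        rw [mul_pow] at this
        linarith [Real.sin_sq_add_cos_sq β]
      have hdiv : t ^ 2 * (1 + β ^ 2) ≤ t ^ 2 / Real.cos β ^ 2 := by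
        rw [le_div_iff₀ (by positivity)]
        nlinarith [sq_nonneg t]
      have hle : max 0 (1 - t ^ 2 / Real.cos β ^ 2) ≤ (1 - t ^ 2) * Real.exp (-(t ^ 2 * β ^ 2)) := by
        refine max_le (mul_nonneg (by linarith) (Real.exp_pos _).le) ?_
        have he := Real.add_one_le_exp (-(t ^ 2 * β ^ 2))
        have : (1 - t ^ 2) * (-(t ^ 2 * β ^ 2) + 1) ≤
            (1 - t ^ 2) * Real.exp (-(t ^ 2 * β ^ 2)) :=
          mul_le_mul_of_nonneg_left he (by linarith)
        have h5 : 0 ≤ t ^ 2 * (t ^ 2 * β ^ 2) := by positivity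
        nlinarith
      calc capProfile n t β ≤ ((1 - t ^ 2) * Real.exp (-(t ^ 2 * β ^ 2))) ^ ((n : ℝ) / 2) :=
            Real.rpow_le_rpow (le_max_left _ _) hle (by positivity)
        _ = Q * Real.exp (-b * β ^ 2) := by
            rw [Real.mul_rpow (by linarith) (Real.exp_pos _).le, ← Real.exp_mul]
            congr 2
            rw [hb]; ring
    have hgauss : ∫ β in (0 : ℝ)..(Real.pi / 2), Real.exp (-b * β ^ 2) ≤ √(Real.pi / b) / 2 := by
      rw [← integral_gaussian_Ioi, intervalIntegral.integral_of_le (by positivity)]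
      exact setIntegral_mono_set (integrable_exp_neg_mul_sq hb0).integrableOn
        (Filter.Eventually.of_forall fun _ => (Real.exp_pos _).le)
        Set.Ioc_subset_Ioi_self.eventuallyLE
    rw [intervalIntegral.integral_const_mul] at hup
    have h3 : Real.pi * capArea n t 0 ≤ Q * (√(Real.pi / b) / 2) := by
      rw [capArea, ← mul_assoc, mul_one_div_cancel hpi.ne', one_mul]
      exact hup.trans (mul_le_mul_of_nonneg_left hgauss hQ0)
    have h4 := pow_le_pow_left₀ (by positivity) h3 2
    rw [mul_pow, mul_pow, div_pow, Real.sq_sqrt (by positivity)] at h4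
    have h5 : Real.pi ^ 2 * capArea n t 0 ^ 2 * b ≤ Q ^ 2 * Real.pi / 4 := by
      calc _ ≤ Q ^ 2 * (Real.pi / b / 2 ^ 2) * b := by gcongr
        _ = _ := by field_simp; norm_num
    have h6 : Real.pi * (capArea n t 0 ^ 2 * b) ≤ Q ^ 2 / 4 := by
      refine le_of_mul_le_mul_left ?_ hpi
      linarith
    have h7 : 2 * (capArea n t 0 ^ 2 * b) ≤ Real.pi * (capArea n t 0 ^ 2 * b) :=
      mul_le_mul_of_nonneg_right (by linarith [Real.pi_gt_three]) (by positivity)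
    have h8 : capArea n t 0 ^ 2 * (n * t ^ 2) = 2 * (capArea n t 0 ^ 2 * b) := by rw [hb]; ring
    linarith
  linarith

/-- Taking logarithms in the lower bound for the cap measure gives L ≤ n t² + (log L)/2 + log 17,
and the middle term is absorbed by L. Together with n t² ≤ 2 L this makes L and 1 + n t² comparable.
-/
theorem log_le_mul_one_add (hn : 2 ≤ n) (ht : t ^ 2 ≤ 1 / 2) (h : 0 < capArea n t 0)
    (hL : 1 / 2 ≤ Real.log (1 / capArea n t 0)) :
    Real.log (1 / capArea n t 0) ≤ 5 * (1 + n * t ^ 2) := by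
  have h1 := one_sub_sq_rpow_le_capArea hn ht hL (mul_sq_le_two_mul_log (by omega) h)
  set L := Real.log (1 / capArea n t 0) with hLdef
  have hlogp : Real.log (capArea n t 0) = -L := by rw [hLdef, one_div, Real.log_inv, neg_neg]
  have hs0 : 0 < √L := Real.sqrt_pos.2 (by linarith)
  have h2 := Real.log_le_log (Real.rpow_pos_of_pos (by linarith) _) h1
  rw [Real.log_rpow (by linarith), Real.log_mul (by positivity) h.ne',
    Real.log_mul (by norm_num) hs0.ne', hlogp, Real.log_sqrt (by linarith)] at h2
  have h3 : -(2 * t ^ 2) ≤ Real.log (1 - t ^ 2) := by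
    have h4 := Real.one_sub_inv_le_log_of_pos (by linarith : 0 < 1 - t ^ 2)
    have h5 : (1 - t ^ 2)⁻¹ ≤ 1 + 2 * t ^ 2 := by
      rw [inv_le_iff_one_le_mul₀ (by linarith)]
      nlinarith [sq_nonneg t]
    linarith
  have h6 : (n : ℝ) / 2 * -(2 * t ^ 2) ≤ (n : ℝ) / 2 * Real.log (1 - t ^ 2) :=
    mul_le_mul_of_nonneg_left h3 (by positivity)
  have h7 : Real.log L ≤ L - 1 := Real.log_le_sub_one_of_pos (by linarith)
  have h8 : Real.log 17 ≤ 3 := by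
    rw [Real.log_le_iff_le_exp (by norm_num)]
    have h9 := Real.exp_one_gt_d9
    have : Real.exp 3 = Real.exp 1 ^ 3 := by rw [← Real.exp_nat_mul]; norm_num
    rw [this]
    calc (17 : ℝ) ≤ 2.7 ^ 3 := by norm_num
      _ ≤ _ := pow_le_pow_left₀ (by norm_num) (by linarith) 3
  have h10 : (0 : ℝ) ≤ n * t ^ 2 := by positivity
  linarith

/-- The derivative at `0` of the measure of two caps, as a function of the inner product of their
centres. -/
noncomputable def capSlope (n : ℕ) (t : ℝ) : ℝ := 1 / (2 * Real.pi) * (1 - 2 * t ^ 2) ^ ((n : ℝ) / 2)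

theorem capSlope_nonneg (ht : t ^ 2 ≤ 1 / 2) : 0 ≤ capSlope n t :=
  mul_nonneg (by have := Real.pi_pos; positivity) (Real.rpow_nonneg (by linarith) _)

/-- 1 - 2t² ≤ (1 - t²)², so the slope is at most (1 - t²)^n / (2π), which is O(p² L). -/
theorem capSlope_le (hn : 2 ≤ n) (ht : t ^ 2 ≤ 1 / 2) {L : ℝ} (hL : 1 / 2 ≤ L)
    (hnt : n * t ^ 2 ≤ 2 * L) : capSlope n t ≤ 50 * (capArea n t 0 ^ 2 * L) := by
  have hpi := Real.pi_gt_three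
  have h1 := one_sub_sq_rpow_le_capArea hn ht hL hnt
  have hQ0 : 0 ≤ (1 - t ^ 2) ^ ((n : ℝ) / 2) := Real.rpow_nonneg (by linarith) _
  have h2 : (1 - 2 * t ^ 2) ^ ((n : ℝ) / 2) ≤ ((1 - t ^ 2) ^ ((n : ℝ) / 2)) ^ 2 := by
    rw [Real.rpow_pow_comm (by linarith)]
    refine Real.rpow_le_rpow (by linarith) ?_ (by positivity)
    nlinarith [sq_nonneg (t ^ 2)]
  have h3 := pow_le_pow_left₀ hQ0 h1 2
  rw [mul_pow, mul_pow, Real.sq_sqrt (by linarith)] at h3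
  have h4 : 1 / (2 * Real.pi) ≤ 1 / 6 := by
    rw [div_le_div_iff₀ (by positivity) (by norm_num)]
    linarith
  have h5 : 0 ≤ L * capArea n t 0 ^ 2 := by positivity
  calc capSlope n t ≤ 1 / 6 * (17 ^ 2 * L * capArea n t 0 ^ 2) :=
        mul_le_mul h4 (h2.trans h3) (Real.rpow_nonneg (by linarith) _) (by norm_num)
    _ ≤ _ := by linarith

/-- Conversely 1 - 2t² ≥ (1 - t²)²(1 - 4t⁴), and by Bernoulli the extra factor raised to n/2 is at
least 1/2 when n t⁴ ≤ 1/4. -/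
theorem le_capSlope (hn : 2 ≤ n) (ht : t ^ 2 ≤ 1 / 2) (h : 0 < capArea n t 0)
    (hL : 1 / 2 ≤ Real.log (1 / capArea n t 0)) (hnt : n * t ^ 4 ≤ 1 / 4) :
    capArea n t 0 ^ 2 * Real.log (1 / capArea n t 0) ≤ 40 * capSlope n t := by
  have hpi := Real.pi_pos
  have hpi4 := Real.pi_lt_four
  have h1 := capArea_sq_mul_le (n := n) (by omega) (by linarith : t ^ 2 < 1)
  have h2 := log_le_mul_one_add hn ht h hL
  have hn2 : (1 : ℝ) ≤ n / 2 := by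
    have : (2 : ℝ) ≤ n := by exact_mod_cast hn
    linarith
  have ht4 : t ^ 4 = t ^ 2 * t ^ 2 := by ring
  have h0 : 0 ≤ 1 - 4 * t ^ 4 := by nlinarith [sq_nonneg t]
  have h3 : ((1 - t ^ 2) ^ ((n : ℝ) / 2)) ^ 2 * (1 / 2) ≤ (1 - 2 * t ^ 2) ^ ((n : ℝ) / 2) := by
    have h4 : 1 / 2 ≤ (1 - 4 * t ^ 4) ^ ((n : ℝ) / 2) := by
      have h5 := one_add_mul_self_le_rpow_one_add (s := -(4 * t ^ 4)) (by linarith) hn2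
      rw [← sub_eq_add_neg] at h5
      linarith
    calc _ ≤ ((1 - t ^ 2) ^ ((n : ℝ) / 2)) ^ 2 * (1 - 4 * t ^ 4) ^ ((n : ℝ) / 2) := by gcongr
      _ = ((1 - t ^ 2) ^ 2 * (1 - 4 * t ^ 4)) ^ ((n : ℝ) / 2) := by
        rw [Real.mul_rpow (sq_nonneg _) h0, Real.rpow_pow_comm (by linarith)]
      _ ≤ _ := by
        refine Real.rpow_le_rpow (mul_nonneg (sq_nonneg _) h0) ?_ (by positivity)
        set u := t ^ 2
        rw [ht4]
        have hu : 0 ≤ u := sq_nonneg t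
        have : 1 / 4 ≤ (1 - u) ^ 2 := by nlinarith
        nlinarith [mul_nonneg (mul_nonneg hu hu) (sub_nonneg.2 this)]
  have h6 : capArea n t 0 ^ 2 * (1 + n * t ^ 2) ≤ (1 - 2 * t ^ 2) ^ ((n : ℝ) / 2) := by linarith
  have h7 : (1 - 2 * t ^ 2) ^ ((n : ℝ) / 2) = 2 * Real.pi * capSlope n t := by
    rw [capSlope]; field_simp
  have h8 := capSlope_nonneg (n := n) ht
  calc _ ≤ capArea n t 0 ^ 2 * (5 * (1 + n * t ^ 2)) := by gcongr
    _ = 5 * (capArea n t 0 ^ 2 * (1 + n * t ^ 2)) := by ring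
    _ ≤ 5 * (2 * Real.pi * capSlope n t) := by rw [← h7]; gcongr
    _ ≤ _ := by nlinarith

end TailEstimates

/-! ### Linear approximation of the two-cap measure near orthogonal centres. -/

section Taylor

variable {n : ℕ} {t : ℝ}

/-- The measure of the intersection of two caps of height `t`, as a function of the inner product
of their centres. -/
noncomputable def capCurve (n : ℕ) (t s : ℝ) : ℝ := capArea n t (Real.arccos s / 2)

/-- Only the lower limit of the integral depends on s; the half-angle formula cos²(arccos(s)/2) = (1
+ s)/2 makes the integrand explicit there. -/
theorem hasDerivAt_capCurve {s : ℝ} (h1 : -1 < s) (h2 : s < 1) :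
    HasDerivAt (capCurve n t) (1 / (2 * Real.pi) *
      (max 0 (1 - 2 * t ^ 2 / (1 + s)) ^ ((n : ℝ) / 2) / √(1 - s ^ 2))) s := by
  have hpi := Real.pi_pos
  set h := Real.arccos s / 2 with hh
  have hcos2 : Real.cos h ^ 2 = (1 + s) / 2 := by
    rw [Real.cos_sq, hh, mul_div_cancel₀ _ two_ne_zero, Real.cos_arccos h1.le h2.le]
    ring
  have hcos : Real.cos h ≠ 0 := by
    intro h0
    rw [h0] at hcos2
    linarith
  have hcont : ContinuousAt (capProfile n t) h := by
    unfold capProfile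
    refine ContinuousAt.rpow_const (ContinuousAt.sup continuousAt_const
      (continuousAt_const.sub (continuousAt_const.div (by fun_prop) (pow_ne_zero 2 hcos))))
      (Or.inr (by positivity))
  have hd := intervalIntegral.integral_hasDerivAt_left
    (intervalIntegrable_capProfile n t h (Real.pi / 2))
    ((measurable_capProfile n t).stronglyMeasurable.stronglyMeasurableAtFilter) hcont
  have harc := (Real.hasDerivAt_arccos h1.ne' h2.ne).div_const 2
  have hc := (hd.comp s harc).const_mul (1 / Real.pi)
  have hval : capProfile n t h = max 0 (1 - 2 * t ^ 2 / (1 + s)) ^ ((n : ℝ) / 2) := by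
    rw [capProfile, hcos2]
    congr 3
    have : 1 + s ≠ 0 := by linarith
    field_simp
  refine hc.congr_deriv ?_
  rw [hval]
  field_simp

/-- Relative to its value at 0, the derivative is (1 + η)^(n/2) / √(1 - s²) with |η| ≤ 4 t²|s|. As n
t² ≤ 2L, the first factor is 1 + O(L|s|), and the second is at most 1 + |s|. -/
theorem abs_capCurve_deriv_sub_le (hn : 2 ≤ n) (ht : t ^ 2 ≤ 1 / 8) {L : ℝ} (hL : 1 / 2 ≤ L)
    (hnt : n * t ^ 2 ≤ 2 * L) {s : ℝ} (hs : |s| ≤ 1 / 5) (hLs : L * |s| ≤ 1 / 5) :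
    |1 / (2 * Real.pi) * (max 0 (1 - 2 * t ^ 2 / (1 + s)) ^ ((n : ℝ) / 2) / √(1 - s ^ 2)) -
      capSlope n t| ≤ 12 * (L * |s|) * capSlope n t := by
  have hpi := Real.pi_pos
  have hs' := abs_le.1 hs
  have ha0 := abs_nonneg s
  have hn2 : (1 : ℝ) ≤ n / 2 := by
    have : (2 : ℝ) ≤ n := by exact_mod_cast hn
    linarith
  have hs2 : s ^ 2 ≤ |s| * (1 / 5) := by
    rw [← sq_abs, pow_two]
    exact mul_le_mul_of_nonneg_left hs ha0
  have h1s : 0 < 1 + s := by linarith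
  have h2t : 0 < 1 - 2 * t ^ 2 := by linarith
  set η := 2 * t ^ 2 * s / ((1 + s) * (1 - 2 * t ^ 2)) with hη
  have hfac : 1 - 2 * t ^ 2 / (1 + s) = (1 - 2 * t ^ 2) * (1 + η) := by
    rw [hη]
    field_simp
    ring
  have hηabs : |η| ≤ 4 * (t ^ 2 * |s|) := by
    rw [hη, abs_div, abs_mul, abs_of_nonneg (by positivity : (0 : ℝ) ≤ 2 * t ^ 2),
      abs_of_pos (mul_pos h1s h2t), div_le_iff₀ (mul_pos h1s h2t)]
    have h3 : 1 / 2 ≤ (1 + s) * (1 - 2 * t ^ 2) := by nlinarith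
    have h4 : 0 ≤ t ^ 2 * |s| := by positivity
    nlinarith
  have hsmall : 4 * (t ^ 2 * |s|) ≤ 1 / 10 := by nlinarith
  have hη' := abs_le.1 hηabs
  have h1η : 0 ≤ 1 + η := by linarith
  have hmax : max 0 (1 - 2 * t ^ 2 / (1 + s)) = (1 - 2 * t ^ 2) * (1 + η) := by
    rw [hfac, max_eq_right (mul_nonneg h2t.le h1η)]
  have hnL : (n : ℝ) * t ^ 2 * |s| ≤ 2 * (L * |s|) := by
    have := mul_le_mul_of_nonneg_right hnt ha0
    linarith
  have hBup : (1 + η) ^ ((n : ℝ) / 2) ≤ 1 + 8 * (L * |s|) := by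
    calc (1 + η) ^ ((n : ℝ) / 2) ≤ Real.exp η ^ ((n : ℝ) / 2) :=
          Real.rpow_le_rpow h1η (by linarith [Real.add_one_le_exp η]) (by positivity)
      _ = Real.exp (η * (n / 2)) := by rw [← Real.exp_mul]
      _ ≤ Real.exp (4 * (L * |s|)) := by
          refine Real.exp_le_exp.2 ?_
          have : η * (n / 2) ≤ 4 * (t ^ 2 * |s|) * (n / 2) :=
            mul_le_mul_of_nonneg_right hη'.2 (by positivity)
          linarith
      _ ≤ 1 + 8 * (L * |s|) := by
          have h5 : 0 ≤ L * |s| := by positivity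
          have := Real.abs_exp_sub_one_le (x := 4 * (L * |s|))
            (by rw [abs_of_nonneg (by positivity)]; linarith)
          rw [abs_of_nonneg (by positivity : 0 ≤ 4 * (L * |s|))] at this
          linarith [(abs_le.1 this).2]
  have hBlow : 1 - 4 * (L * |s|) ≤ (1 + η) ^ ((n : ℝ) / 2) := by
    have h5 := one_add_mul_self_le_rpow_one_add (s := η) (by linarith) hn2
    have : -(4 * (t ^ 2 * |s|)) * (n / 2) ≤ η * (n / 2) :=
      mul_le_mul_of_nonneg_right hη'.1 (by positivity)
    linarith
  have h1s2 : 0 < 1 - s ^ 2 := by linarith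
  have hA1 : √(1 - s ^ 2) ≤ 1 := Real.sqrt_le_one.2 (by linarith [sq_nonneg s])
  have hA0 : 0 < √(1 - s ^ 2) := Real.sqrt_pos.2 h1s2
  have hAlow : 1 - s ^ 2 ≤ √(1 - s ^ 2) :=
    Real.le_sqrt_of_sq_le (by nlinarith [sq_nonneg s])
  have hAup : 1 / √(1 - s ^ 2) ≤ 1 + |s| := by
    rw [div_le_iff₀ hA0]
    have : (1 + |s|) * (1 - s ^ 2) ≤ (1 + |s|) * √(1 - s ^ 2) := by gcongr
    nlinarith
  have hA1' : 1 ≤ 1 / √(1 - s ^ 2) := by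
    rw [le_div_iff₀ hA0]; linarith
  set A := 1 / √(1 - s ^ 2) with hA
  set B := (1 + η) ^ ((n : ℝ) / 2) with hB
  have hB0 : 0 ≤ B := Real.rpow_nonneg h1η _
  have hrw : 1 / (2 * Real.pi) * (max 0 (1 - 2 * t ^ 2 / (1 + s)) ^ ((n : ℝ) / 2) / √(1 - s ^ 2)) -
      capSlope n t = (A * B - 1) * capSlope n t := by
    rw [hmax, Real.mul_rpow h2t.le h1η, capSlope, hA]
    ring
  have hAB : |A * B - 1| ≤ 12 * (L * |s|) := by
    have hLs1 : |s| ≤ 2 * (L * |s|) := by nlinarith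
    have hLs0 : 0 ≤ L * |s| := by positivity
    rw [abs_le]
    constructor
    · have : B ≤ A * B := le_mul_of_one_le_left hB0 hA1'
      linarith
    · have : A * B ≤ (1 + |s|) * (1 + 8 * (L * |s|)) := mul_le_mul hAup hBup hB0 (by linarith)
      nlinarith
  rw [hrw, abs_mul, abs_of_nonneg (capSlope_nonneg (by linarith))]
  exact mul_le_mul_of_nonneg_right hAB (capSlope_nonneg (by linarith))

/-- The remainder of the linear approximation of `capCurve` at `0`. -/
noncomputable def capRem (n : ℕ) (t s : ℝ) : ℝ :=
  capCurve n t s - capCurve n t 0 - capSlope n t * s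

theorem abs_capRem_le (hn : 2 ≤ n) (ht : t ^ 2 ≤ 1 / 8) {L : ℝ} (hL : 1 / 2 ≤ L)
    (hnt : n * t ^ 2 ≤ 2 * L) {s : ℝ} (hs : |s| ≤ 1 / 5) (hLs : L * |s| ≤ 1 / 5) :
    |capRem n t s| ≤ 600 * (capArea n t 0 ^ 2 * L ^ 2) * s ^ 2 := by
  have hslope := capSlope_le hn (by linarith : t ^ 2 ≤ 1 / 2) hL hnt
  have hslope0 := capSlope_nonneg (n := n) (by linarith : t ^ 2 ≤ 1 / 2)
  have key := Convex.norm_image_sub_le_of_norm_hasDerivWithin_le (𝕜 := ℝ)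
    (f := fun x => capCurve n t x - capSlope n t * x)
    (f' := fun s => 1 / (2 * Real.pi) * (max 0 (1 - 2 * t ^ 2 / (1 + s)) ^ ((n : ℝ) / 2) /
      √(1 - s ^ 2)) - capSlope n t) (s := Set.Icc (-|s|) |s|)
    (C := 12 * (L * |s|) * capSlope n t) (x := 0) (y := s) ?_ ?_ (convex_Icc _ _)
    ⟨by simp, by simp⟩ ⟨neg_abs_le s, le_abs_self s⟩
  · simp only [mul_zero, sub_zero, Real.norm_eq_abs] at key
    have h1 : capCurve n t s - capSlope n t * s - capCurve n t 0 = capRem n t s := by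
      rw [capRem]; ring
    rw [h1] at key
    have h2 : 12 * (L * |s|) * capSlope n t * |s| = 12 * L * capSlope n t * s ^ 2 := by
      rw [← sq_abs s]; ring
    rw [h2] at key
    refine key.trans ?_
    -- The constant 600 = 12 · 50 combines the variation of the derivative with the size of the
    -- slope.
    have h3 : 12 * L * capSlope n t ≤ 12 * L * (50 * (capArea n t 0 ^ 2 * L)) := by gcongr
    calc _ ≤ 12 * L * (50 * (capArea n t 0 ^ 2 * L)) * s ^ 2 := by gcongr
      _ = _ := by ring
  · intro x hx
    have hxs : |x| ≤ |s| := abs_le.2 hx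
    have hx5 := abs_le.1 (hxs.trans hs)
    refine HasDerivAt.hasDerivWithinAt ?_
    have := (hasDerivAt_id x).const_mul (capSlope n t)
    rw [mul_one] at this
    exact (hasDerivAt_capCurve (by linarith) (by linarith)).sub this
  · intro x hx
    have hxs : |x| ≤ |s| := abs_le.2 hx
    have hLx : L * |x| ≤ L * |s| := by gcongr
    rw [Real.norm_eq_abs]
    refine (abs_capCurve_deriv_sub_le hn ht hL hnt (hxs.trans hs) (hLx.trans hLs)).trans ?_
    gcongr

end Taylor

/-! ### Tails and moments of the inner product with a fixed point. -/

section Moments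

variable {n : ℕ}

theorem uniformSphere_twoCaps_eq_capCurve (hn : 1 ≤ n) {t : ℝ} (ht : 0 ≤ t)
    (x z : UnitSphere (n + 2)) :
    (uniformSphere (n + 2)).real (twoCaps t x z) = capCurve n t (sinner x z) := by
  have h := abs_le.1 (abs_sinner_le x z)
  refine uniformSphere_twoCaps hn ht ⟨?_, ?_⟩ ?_
  · exact div_nonneg (Real.arccos_nonneg _) two_pos.le
  · exact div_le_div_of_nonneg_right (Real.arccos_le_pi _) two_pos.le
  · rw [mul_div_cancel₀ _ two_ne_zero, Real.cos_arccos h.1 h.2]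

/-- Two antipodal caps, each of measure at most half the exponential bound. -/
theorem uniformSphere_sinner_sq_le (hn : 1 ≤ n) {u : ℝ} (hu : 0 ≤ u) (x : UnitSphere (n + 2)) :
    uniformSphere (n + 2) {y | u ≤ sinner x y ^ 2} ≤ ENNReal.ofReal (Real.exp (-(n * u) / 2)) := by
  let R : EuclideanSpace ℝ (Fin (n + 2)) ≃ₗᵢ[ℝ] EuclideanSpace ℝ (Fin (n + 2)) :=
    LinearIsometryEquiv.neg ℝ
  have hR : ∀ y, sinner x (rot R y) = - sinner x y := fun y => by simp [sinner, rot, R]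
  have hsub : {y | u ≤ sinner x y ^ 2} ⊆ cap √u x ∪ rot R ⁻¹' cap √u x := by
    intro y hy
    have hy : √u ≤ |sinner x y| := by
      rw [← Real.sqrt_sq_eq_abs]; exact Real.sqrt_le_sqrt hy
    rcases le_abs'.1 hy with h | h
    · right
      change √u ≤ sinner x (rot R y)
      rw [hR]; linarith
    · left; exact h
  have h1 : (uniformSphere (n + 2)).real {y | u ≤ sinner x y ^ 2} ≤
      2 * capArea n √u 0 := by
    refine (measureReal_mono hsub).trans ((measureReal_union_le _ _).trans ?_)
    have h2 : (uniformSphere (n + 2)).real (rot R ⁻¹' cap √u x) =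
        (uniformSphere (n + 2)).real (cap √u x) := by
      rw [measureReal_def, measureReal_def, (measurePreserving_rot R).measure_preimage
        (measurableSet_cap _ _).nullMeasurableSet]
    rw [h2, uniformSphere_cap hn (Real.sqrt_nonneg u)]
    linarith
  have h2 : 2 * capArea n √u 0 ≤ Real.exp (-(n * u) / 2) := by
    rcases le_total u 1 with hu1 | hu1
    · have hsq : √u ^ 2 ≤ 1 := by rwa [Real.sq_sqrt hu]
      have h3 := capArea_zero_le_rpow hn hsq
      have h4 := one_sub_sq_rpow_le_exp n hsq
      rw [Real.sq_sqrt hu] at h3 h4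
      linarith
    · have hn0 : ((n : ℝ) / 2) ≠ 0 := by
        have : (1 : ℝ) ≤ n := by exact_mod_cast hn
        positivity
      have h3 := capArea_zero_le hn √u
      rw [Real.sq_sqrt hu, max_eq_left (by linarith), Real.zero_rpow hn0] at h3
      linarith [Real.exp_pos (-(n * u) / 2)]
  rw [← ofReal_measureReal]
  exact ENNReal.ofReal_le_ofReal (h1.trans h2)

theorem integrable_comp_sinner {d : ℕ} [NeZero d] {φ : ℝ → ℝ} (hφ : Continuous φ)
    (x : UnitSphere d) : Integrable (fun y => φ (sinner x y)) (uniformSphere d) := by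
  obtain ⟨C, hC⟩ := isCompact_Icc.exists_bound_of_continuousOn (s := Set.Icc (-1 : ℝ) 1)
    hφ.continuousOn
  exact (IsBddKernel.of_sinner hφ.measurable (C := C) fun t ht => hC t (abs_le.1 ht)).integrable x

/-- Layer-cake formula: the rate n/4 is half the decay rate of the tail, so the excess over 1 is at
most ∫ κ exp(-κ u) du = 1. -/
theorem integral_exp_sinner_sq_le (hn : 1 ≤ n) (x : UnitSphere (n + 2)) :
    ∫ y, Real.exp (n / 4 * sinner x y ^ 2) ∂uniformSphere (n + 2) ≤ 2 := by
  set κ : ℝ := n / 4 with hκ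
  have hκ0 : 0 < κ := by
    have : (1 : ℝ) ≤ n := by exact_mod_cast hn
    positivity
  have hprim : ∀ u : ℝ, ∫ s in (0 : ℝ)..u, κ * Real.exp (κ * s) = Real.exp (κ * u) - 1 := by
    intro u
    have hd : ∀ s : ℝ, HasDerivAt (fun s => Real.exp (κ * s)) (κ * Real.exp (κ * s)) s := by
      intro s
      have := ((hasDerivAt_id s).const_mul κ).exp
      refine this.congr_deriv ?_
      simp [mul_comm]
    rw [intervalIntegral.integral_eq_sub_of_hasDerivAt (fun s _ => hd s)
      (Continuous.intervalIntegrable (by fun_prop) _ _)]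
    simp
  have hms : Measurable fun y : UnitSphere (n + 2) => sinner x y :=
    isBddKernel_sinner.measurable_left x
  have hlc := lintegral_comp_eq_lintegral_meas_le_mul (uniformSphere (n + 2))
    (f := fun y => sinner x y ^ 2) (g := fun s => κ * Real.exp (κ * s))
    (Filter.Eventually.of_forall fun y => sq_nonneg _) (hms.pow_const 2).aemeasurable
    (fun s _ => Continuous.intervalIntegrable (by fun_prop) _ _)
    (Filter.Eventually.of_forall fun s => by positivity)
  simp only [hprim] at hlc
  have hbound : ∫⁻ s in Set.Ioi (0 : ℝ), uniformSphere (n + 2) {y | s ≤ sinner x y ^ 2} *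
      ENNReal.ofReal (κ * Real.exp (κ * s)) ≤ 1 := by
    have h1 : ∫⁻ s in Set.Ioi (0 : ℝ), uniformSphere (n + 2) {y | s ≤ sinner x y ^ 2} *
        ENNReal.ofReal (κ * Real.exp (κ * s)) ≤
        ∫⁻ s in Set.Ioi (0 : ℝ), ENNReal.ofReal (κ * Real.exp (-κ * s)) := by
      refine setLIntegral_mono (by fun_prop) fun s hs => ?_
      calc _ ≤ ENNReal.ofReal (Real.exp (-(n * s) / 2)) * ENNReal.ofReal (κ * Real.exp (κ * s)) := by
            gcongr
            exact uniformSphere_sinner_sq_le hn (le_of_lt hs) x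
        _ = ENNReal.ofReal (κ * Real.exp (-κ * s)) := by
            rw [← ENNReal.ofReal_mul (Real.exp_pos _).le, mul_left_comm, ← Real.exp_add]
            congr 3
            rw [hκ]; ring
    refine h1.trans_eq ?_
    have hint : IntegrableOn (fun s => Real.exp (-κ * s)) (Set.Ioi 0) :=
      integrableOn_exp_mul_Ioi (by linarith) 0
    rw [← ofReal_integral_eq_lintegral_ofReal (hint.const_mul κ)
      (Filter.Eventually.of_forall fun s => by positivity), integral_const_mul,
      integral_exp_mul_Ioi (by linarith) 0]
    simp [hκ0.ne']
  rw [← hlc] at hbound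
  have hi := integrable_comp_sinner (φ := fun s => Real.exp (κ * s ^ 2)) (by fun_prop) x
  have hnn : ∀ y, 0 ≤ Real.exp (κ * sinner x y ^ 2) - 1 := fun y =>
    sub_nonneg.2 (Real.one_le_exp (by positivity))
  have h2 : ∫ y, (Real.exp (κ * sinner x y ^ 2) - 1) ∂uniformSphere (n + 2) ≤ 1 := by
    rw [integral_eq_lintegral_of_nonneg_ae (Filter.Eventually.of_forall hnn)
      (hi.sub (integrable_const 1)).aestronglyMeasurable]
    exact ENNReal.toReal_mono ENNReal.one_ne_top hbound
  rw [integral_sub hi (integrable_const 1)] at h2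
  simp at h2
  linarith

theorem integral_sinner_pow_four_le (hn : 1 ≤ n) (x : UnitSphere (n + 2)) :
    ∫ y, sinner x y ^ 4 ∂uniformSphere (n + 2) ≤ 64 / n ^ 2 := by
  have hn0 : (1 : ℝ) ≤ n := by exact_mod_cast hn
  have h : ∫ y, sinner x y ^ 4 ∂uniformSphere (n + 2) ≤
      ∫ y, 32 / n ^ 2 * Real.exp (n / 4 * sinner x y ^ 2) ∂uniformSphere (n + 2) := by
    refine integral_mono (integrable_comp_sinner (φ := fun s => s ^ 4) (by fun_prop) x)
      (integrable_comp_sinner (φ := fun s => 32 / n ^ 2 * Real.exp (n / 4 * s ^ 2))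
        (by fun_prop) x) fun y => ?_
    have h1 := Real.quadratic_le_exp_of_nonneg
      (by positivity : (0 : ℝ) ≤ n / 4 * sinner x y ^ 2)
    have h0 : (0 : ℝ) ≤ n / 4 * sinner x y ^ 2 := by positivity
    simp only
    rw [div_mul_eq_mul_div, le_div_iff₀ (by positivity)]
    linarith
  rw [integral_const_mul] at h
  calc _ ≤ _ := h
    _ ≤ 32 / n ^ 2 * 2 := by gcongr; exact integral_exp_sinner_sq_le hn x
    _ = _ := by ring

/-- With r = √n, the arithmetic–geometric mean inequality bounds |s|³ by (r/2) s⁴ + s²/(2r). -/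
theorem integral_abs_sinner_cube_le (hn : 1 ≤ n) (x : UnitSphere (n + 2)) :
    ∫ y, |sinner x y| ^ 3 ∂uniformSphere (n + 2) ≤ 33 / √n ^ 3 := by
  have hn0 : (1 : ℝ) ≤ n := by exact_mod_cast hn
  set r := √(n : ℝ) with hr
  have hr0 : 0 < r := Real.sqrt_pos.2 (by linarith)
  have hr2 : (n : ℝ) = r ^ 2 := (Real.sq_sqrt (by linarith)).symm
  have i4 := integrable_comp_sinner (φ := fun s => r / 2 * s ^ 4) (by fun_prop) x
  have i2 := integrable_comp_sinner (φ := fun s => 1 / (2 * r) * s ^ 2) (by fun_prop) x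
  have h : ∫ y, |sinner x y| ^ 3 ∂uniformSphere (n + 2) ≤
      ∫ y, (r / 2 * sinner x y ^ 4 + 1 / (2 * r) * sinner x y ^ 2) ∂uniformSphere (n + 2) := by
    refine integral_mono (integrable_comp_sinner (φ := fun s => |s| ^ 3) (by fun_prop) x)
      (i4.add i2) fun y => ?_
    simp only
    rw [← sq_abs, show sinner x y ^ 4 = |sinner x y| ^ 4 by
      rw [show (4 : ℕ) = 2 * 2 by norm_num, pow_mul, pow_mul, sq_abs]]
    set a := |sinner x y|
    have ha : 0 ≤ a := abs_nonneg _
    have h1 : 0 ≤ (r * a - 1) ^ 2 * a ^ 2 / (2 * r) := by positivity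
    have h2 : r / 2 * a ^ 4 + 1 / (2 * r) * a ^ 2 - a ^ 3 = (r * a - 1) ^ 2 * a ^ 2 / (2 * r) := by
      field_simp
      ring
    linarith
  rw [integral_add i4 i2, integral_const_mul, integral_const_mul, integral_sinner_sq] at h
  have h4 := integral_sinner_pow_four_le hn x
  rw [hr2] at h4
  refine h.trans ?_
  have h5 : (1 : ℝ) / ((n + 2 : ℕ) : ℝ) ≤ 1 / r ^ 2 := by
    rw [← hr2]
    refine one_div_le_one_div_of_le (by linarith) ?_
    push_cast; linarith
  calc _ ≤ r / 2 * (64 / (r ^ 2) ^ 2) + 1 / (2 * r) * (1 / r ^ 2) := by gcongr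
    _ = (65 / 2) / r ^ 3 := by field_simp; norm_num
    _ ≤ _ := by gcongr; norm_num

theorem uniformSphere_abs_sinner_le (hn : 1 ≤ n) (b : ℝ) (x : UnitSphere (n + 2)) (hb : 0 ≤ b) :
    (uniformSphere (n + 2)).real {y | b < |sinner x y|} ≤ Real.exp (-(n * b ^ 2) / 2) := by
  have h := uniformSphere_sinner_sq_le hn (sq_nonneg b) x
  have h2 : (uniformSphere (n + 2)).real {y | b ^ 2 ≤ sinner x y ^ 2} ≤
      Real.exp (-(n * b ^ 2) / 2) :=
    ENNReal.toReal_le_of_le_ofReal (Real.exp_pos _).le h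
  refine (measureReal_mono fun y hy => ?_).trans h2
  have hy : b < |sinner x y| := hy
  change b ^ 2 ≤ sinner x y ^ 2
  rw [← sq_abs (sinner x y)]
  exact pow_le_pow_left₀ hb hy.le 2

/-- An entropy bound: u ≤ L + p exp u, applied to u = n s²/4 and integrated over the cap.
Conditioning on an event of probability p costs only a factor L. -/
theorem integral_cap_sinner_sq_le (hn : 1 ≤ n) {t : ℝ} (x : UnitSphere (n + 2)) {p : ℝ}
    (hp0 : 0 < p) (hp : (uniformSphere (n + 2)).real (cap t x) = p)
    (hL : 2 / 3 ≤ Real.log (1 / p)) :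
    ∫ y in cap t x, sinner x y ^ 2 ∂uniformSphere (n + 2) ≤ 16 * p * Real.log (1 / p) / n := by
  have hn0 : (1 : ℝ) ≤ n := by exact_mod_cast hn
  set L := Real.log (1 / p) with hLdef
  have hexp : Real.exp (-L) = p := by
    rw [hLdef, one_div, Real.log_inv, neg_neg, Real.exp_log hp0]
  have ie := integrable_comp_sinner (φ := fun s => p * Real.exp (n / 4 * s ^ 2)) (by fun_prop) x
  have i2 := integrable_comp_sinner (φ := fun s => n / 4 * s ^ 2) (by fun_prop) x
  have h1 : ∫ y in cap t x, n / 4 * sinner x y ^ 2 ∂uniformSphere (n + 2) ≤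
      ∫ y in cap t x, (L + p * Real.exp (n / 4 * sinner x y ^ 2)) ∂uniformSphere (n + 2) := by
    refine integral_mono i2.integrableOn ((integrable_const L).add ie).integrableOn fun y => ?_
    have h2 := Real.add_one_le_exp (n / 4 * sinner x y ^ 2 - L)
    rw [sub_eq_add_neg, Real.exp_add, hexp] at h2
    simp only
    linarith
  rw [integral_add (integrable_const L).integrableOn ie.integrableOn, integral_const_mul,
    setIntegral_const, hp, smul_eq_mul] at h1
  have h2 : ∫ y in cap t x, p * Real.exp (n / 4 * sinner x y ^ 2) ∂uniformSphere (n + 2) ≤ p * 2 := by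
    refine (setIntegral_le_integral ie (Filter.Eventually.of_forall fun y => by positivity)).trans ?_
    rw [integral_const_mul]
    exact mul_le_mul_of_nonneg_left (integral_exp_sinner_sq_le hn x) hp0.le
  rw [le_div_iff₀ (by linarith)]
  nlinarith

end Moments

/-! ### Splitting off the action on linear functions. -/

section Deflation

variable {n : ℕ} {k : UnitSphere (n + 2) → UnitSphere (n + 2) → ℝ}

local notation "σₙ" => uniformSphere (n + 2)

/-- The eigenvalue of an invariant kernel on linear functions. -/
noncomputable def linEig (k : UnitSphere (n + 2) → UnitSphere (n + 2) → ℝ) : ℝ :=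
  ∫ y, k (axis 0) y * sinner (axis 0) y ∂uniformSphere (n + 2)

/-- An invariant kernel with its action on linear functions removed. -/
noncomputable def deflate (k : UnitSphere (n + 2) → UnitSphere (n + 2) → ℝ)
    (x y : UnitSphere (n + 2)) : ℝ :=
  k x y - (n + 2) * linEig k * sinner x y

theorem linEig_eq (hi : IsInvKernel k) (x : UnitSphere (n + 2)) :
    ∫ y, k x y * sinner x y ∂σₙ = linEig k :=
  IsInvKernel.integral_const (k := fun x y => k x y * sinner x y)
    (fun R x y => by simp only [hi R x y, sinner_rot]) x (axis 0)

theorem kcomp_sinner (hb : IsBddKernel k) (hi : IsInvKernel k) (x y : UnitSphere (n + 2)) :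
    kcomp σₙ k sinner x y = linEig k * sinner x y := by
  rw [kcomp, integral_mul_sinner hb hi, linEig_eq hi]

theorem sinner_kcomp (hb : IsBddKernel k) (hs : ∀ x y, k x y = k y x) (hi : IsInvKernel k)
    (x y : UnitSphere (n + 2)) : kcomp σₙ sinner k x y = linEig k * sinner x y := by
  rw [sinner_comm x y, ← kcomp_sinner hb hi, kcomp, kcomp]
  refine integral_congr_ae (Filter.Eventually.of_forall fun z => ?_)
  simp only [hs y z, sinner_comm x z]
  ring

theorem linEig_sinner : linEig (sinner : UnitSphere (n + 2) → _ → ℝ) = 1 / ((n : ℝ) + 2) := by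
  have h := integral_sinner_sq (d := n + 2) (axis 0)
  simp only [pow_two] at h
  rw [linEig, h]
  push_cast
  rfl

theorem IsBddKernel.deflate (hb : IsBddKernel k) : IsBddKernel (deflate k) :=
  hb.sub (isBddKernel_sinner.const_mul _)

theorem IsInvKernel.deflate (hi : IsInvKernel k) : IsInvKernel (deflate k) := fun R x y => by
  rw [SphereRGG.deflate, SphereRGG.deflate, hi R, sinner_rot]

theorem deflate_symm (hs : ∀ x y, k x y = k y x) (x y : UnitSphere (n + 2)) :
    deflate k x y = deflate k y x := by
  rw [deflate, deflate, hs, sinner_comm]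

theorem integral_deflate (hb : IsBddKernel k) (h0 : ∀ x, ∫ y, k x y ∂σₙ = 0)
    (x : UnitSphere (n + 2)) : ∫ y, deflate k x y ∂σₙ = 0 := by
  simp only [deflate]
  rw [integral_sub (hb.integrable x) ((isBddKernel_sinner.integrable x).const_mul _), h0,
    integral_const_mul, integral_sinner]
  simp

theorem linEig_deflate (hb : IsBddKernel k) : linEig (deflate k) = 0 := by
  have h : ∀ y, deflate k (axis 0) y * sinner (axis 0) y = k (axis 0) y * sinner (axis 0) y -
      (n + 2) * linEig k * (sinner (axis 0) y * sinner (axis 0) y) := fun y => by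
    rw [deflate]; ring
  rw [linEig]
  simp only [h]
  rw [integral_sub ((hb.mul isBddKernel_sinner).integrable _)
    (((isBddKernel_sinner.mul isBddKernel_sinner).integrable _).const_mul _), integral_const_mul]
  change linEig k - _ * linEig sinner = 0
  rw [linEig_sinner]
  field_simp
  ring

/-- The deflated kernel annihilates linear functions, hence so do all its powers. -/
theorem sinner_kcomp_kpow_deflate (hb : IsBddKernel k) (hs : ∀ x y, k x y = k y x)
    (hi : IsInvKernel k) (m : ℕ) (x y : UnitSphere (n + 2)) :
    kcomp σₙ sinner (kpow σₙ (deflate k) m) x y = 0 := by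
  have h0 : kcomp σₙ sinner (deflate k) = fun _ _ => 0 := by
    ext x y
    rw [sinner_kcomp hb.deflate (deflate_symm hs) hi.deflate, linEig_deflate hb, zero_mul]
  cases m with
  | zero => exact congrFun (congrFun h0 x) y
  | succ m =>
    rw [kpow, ← kcomp_assoc isBddKernel_sinner hb.deflate (hb.deflate.pow m), h0, kcomp]
    simp

/-- The spectral splitting of the iterates of an invariant kernel. -/
theorem kpow_eq_add_deflate (hb : IsBddKernel k) (hs : ∀ x y, k x y = k y x)
    (hi : IsInvKernel k) (m : ℕ) (x y : UnitSphere (n + 2)) :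
    kpow σₙ k m x y = (n + 2) * linEig k ^ (m + 1) * sinner x y + kpow σₙ (deflate k) m x y := by
  induction m generalizing x y with
  | zero => simp only [kpow, deflate]; ring
  | succ m ih =>
    -- The product is split so that the cross term pairs linear functions with a power of the
    -- deflated kernel, and vanishes.
    have h1 : ∀ z, k x z * kpow σₙ k m z y = (n + 2) * linEig k ^ (m + 1) * (k x z * sinner z y) +
        ((n + 2) * linEig k * (sinner x z * kpow σₙ (deflate k) m z y) +
          deflate k x z * kpow σₙ (deflate k) m z y) := fun z => by
      rw [ih, deflate]; ring
    have hg := hb.deflate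
    have i1 := (kcomp_integrable (μ := σₙ) hb isBddKernel_sinner x y).const_mul
      ((n + 2) * linEig k ^ (m + 1))
    have hgm := hg.pow (μ := σₙ) m
    have i2 := (kcomp_integrable (μ := σₙ) isBddKernel_sinner hgm x y).const_mul
      ((n + 2) * linEig k)
    have i3 := kcomp_integrable (μ := σₙ) hg hgm x y
    have e1 := kcomp_sinner hb hi x y
    have e2 := sinner_kcomp_kpow_deflate hb hs hi m x y
    simp only [kcomp] at e1 e2
    simp only [kpow, kcomp]
    simp only [h1]
    rw [integral_add i1 (i2.fun_add i3), integral_add i2 i3, integral_const_mul, integral_const_mul,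
      e1, e2]
    ring

end Deflation

/-! ### The centred edge indicator and the Taylor expansion of its square. -/

section EdgeKernel

variable {n : ℕ}

local notation "σₙ" => uniformSphere (n + 2)

open Classical in
/-- The centred edge indicator as a function of two latent vectors. -/
noncomputable def edgeKernel (d : ℕ) (t p : ℝ) (x y : UnitSphere d) : ℝ :=
  (if t ≤ sinner x y then 1 else 0) - p

theorem isBddKernel_edgeKernel (d : ℕ) (t p : ℝ) : IsBddKernel (edgeKernel d t p) := by
  refine IsBddKernel.of_sinner (φ := fun s => (if t ≤ s then 1 else 0) - p) (C := 1 + |p|) ?_ ?_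
  · exact (Measurable.ite measurableSet_Ici measurable_const measurable_const).sub_const p
  · intro s _
    refine (abs_sub _ _).trans (add_le_add_left ?_ _)
    split_ifs <;> simp

theorem edgeKernel_symm (d : ℕ) (t p : ℝ) (x y : UnitSphere d) :
    edgeKernel d t p x y = edgeKernel d t p y x := by
  rw [edgeKernel, edgeKernel, sinner_comm]

theorem isInvKernel_edgeKernel (d : ℕ) (t p : ℝ) : IsInvKernel (edgeKernel d t p) := by
  intro R x y
  rw [edgeKernel, edgeKernel, sinner_rot]

theorem edgeKernel_eq_indicator {d : ℕ} (t p : ℝ) (x y : UnitSphere d) :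
    edgeKernel d t p x y = (cap t x).indicator (fun _ => (1 : ℝ)) y - p := by
  classical
  rw [edgeKernel, Set.indicator_apply]
  rfl

theorem integral_edgeKernel {t p : ℝ} (x : UnitSphere (n + 2)) (hp : (σₙ).real (cap t x) = p) :
    ∫ y, edgeKernel (n + 2) t p x y ∂σₙ = 0 := by
  simp only [edgeKernel_eq_indicator]
  rw [integral_sub ((integrable_const (1 : ℝ)).indicator (measurableSet_cap t x))
    (integrable_const p), integral_indicator_const _ (measurableSet_cap t x), hp]
  simp

/-- The product of two cap indicators is the indicator of the intersection, and the centring terms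
integrate to zero apart from p². -/
theorem kcomp_edgeKernel {t p : ℝ} (hp : ∀ x : UnitSphere (n + 2), (σₙ).real (cap t x) = p)
    (x y : UnitSphere (n + 2)) :
    kcomp σₙ (edgeKernel (n + 2) t p) (edgeKernel (n + 2) t p) x y =
      (σₙ).real (twoCaps t x y) - p ^ 2 := by
  have h : ∀ z, edgeKernel (n + 2) t p x z * edgeKernel (n + 2) t p z y =
      (twoCaps t x y).indicator (fun _ => (1 : ℝ)) z -
        (p * edgeKernel (n + 2) t p x z + p * edgeKernel (n + 2) t p y z + p ^ 2) := fun z => by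
    have h1 : (twoCaps t x y).indicator (fun _ => (1 : ℝ)) z =
        (cap t x).indicator (fun _ => (1 : ℝ)) z * (cap t y).indicator (fun _ => (1 : ℝ)) z := by
      rw [← Set.inter_indicator_mul]
      simp only [mul_one]
      rfl
    rw [edgeKernel_symm _ _ _ z y, edgeKernel_eq_indicator, edgeKernel_eq_indicator, h1]
    ring
  have hb := isBddKernel_edgeKernel (n + 2) t p
  rw [kcomp]
  simp only [h]
  rw [integral_sub ((integrable_const (1 : ℝ)).indicator (measurableSet_twoCaps t x y))
    ((((hb.integrable x).const_mul p).fun_add ((hb.integrable y).const_mul p)).fun_add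
      (integrable_const _)), integral_indicator_const _ (measurableSet_twoCaps t x y),
    integral_add (((hb.integrable x).const_mul p).fun_add ((hb.integrable y).const_mul p))
      (integrable_const _),
    integral_add ((hb.integrable x).const_mul p) ((hb.integrable y).const_mul p),
    integral_const_mul, integral_const_mul, integral_edgeKernel x (hp x),
    integral_edgeKernel y (hp y)]
  simp

theorem linEig_edgeKernel (t p : ℝ) (x : UnitSphere (n + 2)) :
    linEig (edgeKernel (n + 2) t p) = ∫ y in cap t x, sinner x y ∂σₙ := by
  have h : ∀ y, edgeKernel (n + 2) t p x y * sinner x y =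
      (cap t x).indicator (fun y => sinner x y) y - p * sinner x y := fun y => by
    classical
    rw [edgeKernel_eq_indicator, Set.indicator_apply, Set.indicator_apply]
    split_ifs <;> ring
  rw [← linEig_eq (isInvKernel_edgeKernel _ _ _) x]
  simp only [h]
  have hi := (isBddKernel_sinner (d := n + 2)).integrable (μ := σₙ) x
  rw [integral_sub (hi.indicator (measurableSet_cap t x)) (hi.const_mul p), integral_const_mul,
    integral_sinner, integral_indicator (measurableSet_cap t x)]
  simp

/-- Since t is nonnegative in the application, this fixes the sign of the eigenvalue, which is
otherwise known only through its square. -/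
theorem mul_le_linEig_edgeKernel {t p : ℝ} (x : UnitSphere (n + 2))
    (hp : (σₙ).real (cap t x) = p) : t * p ≤ linEig (edgeKernel (n + 2) t p) := by
  rw [linEig_edgeKernel t p x, ← hp]
  have hi := (isBddKernel_sinner (d := n + 2)).integrable (μ := σₙ) x
  have h := setIntegral_mono_on (μ := σₙ) (f := fun _ => t) (g := sinner x)
    (integrable_const t).integrableOn hi.integrableOn (measurableSet_cap t x) fun y hy => hy
  rw [setIntegral_const, smul_eq_mul, mul_comm] at h
  exact h

theorem linEig_sq_eq {k : UnitSphere (n + 2) → UnitSphere (n + 2) → ℝ} (hb : IsBddKernel k)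
    (hi : IsInvKernel k) : linEig (kcomp σₙ k k) = linEig k ^ 2 := by
  have h := kcomp_sinner (hb.comp (μ := σₙ) hb) (hi.comp hi) (axis 0) (axis 0)
  rw [kcomp_assoc hb hb isBddKernel_sinner] at h
  have h2 : kcomp σₙ k sinner = fun x y => linEig k * sinner x y := by
    ext x y
    exact kcomp_sinner hb hi x y
  have h3 := kcomp_sinner hb hi (axis 0) (axis 0)
  rw [h2, kcomp] at h
  rw [kcomp] at h3
  have h4 : ∀ z : UnitSphere (n + 2), k (axis 0) z * (linEig k * sinner z (axis 0)) =
      linEig k * (k (axis 0) z * sinner z (axis 0)) := fun z => by ring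
  simp only [h4] at h
  rw [integral_const_mul, h3, sinner_self] at h
  linarith

variable (hn : 1 ≤ n) {t p : ℝ} (ht : 0 ≤ t) (hp : capArea n t 0 = p)

include hn ht hp in
theorem kcomp_edgeKernel_eq_capRem (x y : UnitSphere (n + 2)) :
    kcomp σₙ (edgeKernel (n + 2) t p) (edgeKernel (n + 2) t p) x y =
      capRem n t (sinner x y) + (capCurve n t 0 - p ^ 2) + capSlope n t * sinner x y := by
  rw [kcomp_edgeKernel (fun x => (uniformSphere_cap hn ht x).trans hp),
    uniformSphere_twoCaps_eq_capCurve hn ht, capRem]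
  ring

include hn ht hp in
theorem isBddKernel_capRem :
    IsBddKernel fun x y : UnitSphere (n + 2) => capRem n t (sinner x y) := by
  have hb := isBddKernel_edgeKernel (n + 2) t p
  have hc : IsBddKernel fun _ _ : UnitSphere (n + 2) => capCurve n t 0 - p ^ 2 :=
    IsBddKernel.of_sinner (φ := fun _ => capCurve n t 0 - p ^ 2) measurable_const fun _ _ => le_rfl
  have h := ((hb.comp (μ := σₙ) hb).sub hc).sub (isBddKernel_sinner.const_mul (capSlope n t))
  convert h using 3 with x y
  rw [kcomp_edgeKernel_eq_capRem hn ht hp]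
  ring

-- A crude bound for the rare inner products at which the Taylor estimate is unavailable: a
-- difference of two probabilities plus a slope term of size at most 1.
include hn ht in
theorem abs_capRem_le_two (ht2 : t ^ 2 ≤ 1 / 2) (x y : UnitSphere (n + 2)) :
    |capRem n t (sinner x y)| ≤ 2 := by
  have h1 := uniformSphere_twoCaps_eq_capCurve hn ht x y
  have h2 := uniformSphere_twoCaps_eq_capCurve hn ht (axis 0 : UnitSphere (n + 2)) (axis 1)
  rw [sinner_axis_axis (by simp)] at h2
  have h3 : (σₙ).real (twoCaps t x y) ∈ Set.Icc (0 : ℝ) 1 := ⟨measureReal_nonneg, measureReal_le_one⟩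
  have h4 : (σₙ).real (twoCaps t (axis 0) (axis 1)) ∈ Set.Icc (0 : ℝ) 1 :=
    ⟨measureReal_nonneg, measureReal_le_one⟩
  rw [h1] at h3
  rw [h2] at h4
  have h5 := capSlope_nonneg (n := n) ht2
  have h6 : capSlope n t ≤ 1 := by
    have hpi := Real.pi_gt_three
    refine mul_le_one₀ ?_ (Real.rpow_nonneg (by linarith) _) ?_
    · rw [div_le_one (by positivity)]; linarith
    · exact Real.rpow_le_one (by linarith) (by nlinarith) (by positivity)
  have h7 : |capSlope n t * sinner x y| ≤ 1 := by
    rw [abs_mul, abs_of_nonneg h5]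
    exact mul_le_one₀ h6 (abs_nonneg _) (abs_sinner_le x y)
  rw [abs_le] at h7
  rw [capRem, abs_le]
  constructor <;> linarith [h3.1, h3.2, h4.1, h4.2, h7.1, h7.2]

-- The square of the eigenvalue is the linear eigenvalue of the composed kernel, to which constants
-- contribute nothing and s contributes the slope times E[s²] = 1/(n + 2).
include hn ht hp in
theorem linEig_edgeKernel_sq :
    (n + 2) * linEig (edgeKernel (n + 2) t p) ^ 2 = capSlope n t +
      (n + 2) * ∫ y, sinner (axis 0) y * capRem n t (sinner (axis 0) y) ∂σₙ := by
  rw [← linEig_sq_eq (isBddKernel_edgeKernel _ _ _) (isInvKernel_edgeKernel _ _ _), linEig]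
  simp only [kcomp_edgeKernel_eq_capRem hn ht hp]
  have h : ∀ y : UnitSphere (n + 2), (capRem n t (sinner (axis 0) y) + (capCurve n t 0 - p ^ 2) +
      capSlope n t * sinner (axis 0) y) * sinner (axis 0) y =
      sinner (axis 0) y * capRem n t (sinner (axis 0) y) +
        (capCurve n t 0 - p ^ 2) * sinner (axis 0) y +
        capSlope n t * sinner (axis 0) y ^ 2 := fun y => by ring
  simp only [h]
  have i1 := (isBddKernel_sinner.mul (isBddKernel_capRem hn ht hp)).integrable (μ := σₙ) (axis 0)
  have i2 := (isBddKernel_sinner (d := n + 2)).integrable (μ := σₙ) (axis 0)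
  have i3 := (isBddKernel_sinner.mul (isBddKernel_sinner (d := n + 2))).integrable (μ := σₙ) (axis 0)
  simp only [← pow_two] at i3
  rw [integral_add (i1.fun_add (i2.const_mul _)) (i3.const_mul _), integral_add i1 (i2.const_mul _),
    integral_const_mul, integral_const_mul, integral_sinner, integral_sinner_sq]
  push_cast
  field_simp
  ring

/-- The second iterate of the deflated edge kernel is the Taylor remainder of the cap curve,
projected off the affine functions. -/
theorem kpow_deflate_edgeKernel_one (hn : 1 ≤ n) (ht : 0 ≤ t) (hp : capArea n t 0 = p)
    (x y : UnitSphere (n + 2)) :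
    kpow σₙ (deflate (edgeKernel (n + 2) t p)) 1 x y = capRem n t (sinner x y) -
      (∫ z, capRem n t (sinner (axis 0) z) ∂σₙ) -
      ((n + 2) * ∫ z, sinner (axis 0) z * capRem n t (sinner (axis 0) z) ∂σₙ) * sinner x y := by
  have hb := isBddKernel_edgeKernel (n + 2) t p
  have hi := isInvKernel_edgeKernel (n + 2) t p
  have hs := edgeKernel_symm (n + 2) t p
  have h0 : ∀ x : UnitSphere (n + 2), ∫ y, edgeKernel (n + 2) t p x y ∂σₙ = 0 := fun x =>
    integral_edgeKernel x ((uniformSphere_cap hn ht x).trans hp)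
  have h1 : ∀ x y, kpow σₙ (edgeKernel (n + 2) t p) 1 x y =
      capRem n t (sinner x y) + (capCurve n t 0 - p ^ 2) + capSlope n t * sinner x y :=
    kcomp_edgeKernel_eq_capRem hn ht hp
  -- The iterate has mean zero, which pins the constant term to minus the mean of the remainder.
  have h2 := integral_kpow_eq_zero hb h0 1 (axis 0)
  simp only [h1] at h2
  have i1 := (isBddKernel_capRem hn ht hp).integrable (μ := σₙ) (axis 0)
  have i2 := (isBddKernel_sinner (d := n + 2)).integrable (μ := σₙ) (axis 0)
  rw [integral_add (i1.fun_add (integrable_const _)) (i2.const_mul _),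
    integral_add i1 (integrable_const _), integral_const_mul, integral_sinner] at h2
  simp only [integral_const, probReal_univ, smul_eq_mul] at h2
  have h3 := kpow_eq_add_deflate hb hs hi 1 x y
  have h4 := linEig_edgeKernel_sq hn ht hp
  rw [h1] at h3
  linear_combination -h3 + h2 - sinner x y * h4

end EdgeKernel

-- Quantitative estimates in the admissible range of parameters.

local notation "σₙ" n => uniformSphere (n + 2)

/-- The range of parameters in which the moment estimates below hold: the cap at height `t` has
measure `p`, `L = log (1 / p)` is small compared to the dimension, and `s₀` is a level at which the
cap curve is still well approximated by its tangent at the origin. -/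
structure CapRegime (n : ℕ) (t p L s₀ : ℝ) : Prop where
  two_le : 2 ≤ n
  t_nonneg : 0 ≤ t
  area : capArea n t 0 = p
  p_pos : 0 < p
  p_le : p ≤ 1 / 2
  L_eq : L = Real.log (1 / p)
  s₀_pos : 0 < s₀
  s₀_le : s₀ ≤ 1 / 5
  L_mul_s₀_le : L * s₀ ≤ 1 / 5
  -- Makes the contribution of |s| > s₀, where only a bound by 2 is available, negligible.
  tail : Real.exp (-(n * s₀ ^ 2) / 2) ≤ p ^ 4 / n ^ 2
  -- The cube of L is what the trace of order three needs; the other estimates need only its square.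
  large : 2 * 10 ^ 15 * L ^ 3 ≤ n

namespace CapRegime

variable {n : ℕ} {t p L s₀ : ℝ} (H : CapRegime n t p L s₀)

include H

theorem L_ge : 2 / 3 ≤ L := by
  have h1 : Real.log 2 ≤ Real.log (1 / p) := by
    refine Real.log_le_log two_pos ?_
    rw [le_div_iff₀ H.p_pos]
    linarith [H.p_le]
  have := Real.log_two_gt_d9
  rw [H.L_eq]
  linarith

theorem one_le : 1 ≤ n := H.two_le.trans' one_le_two

theorem large_sq : (10 : ℝ) ^ 15 * L ^ 2 ≤ n := by
  have h1 := H.large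
  have h2 := H.L_ge
  have h3 : L ^ 2 * (2 / 3) ≤ L ^ 3 := by
    rw [pow_succ L 2]
    exact mul_le_mul_of_nonneg_left h2 (sq_nonneg L)
  linarith [sq_nonneg L]

theorem n_pos : (0 : ℝ) < n := by
  have := H.one_le
  exact_mod_cast this

theorem n_mul_t_sq : n * t ^ 2 ≤ 2 * L := by
  have h := mul_sq_le_two_mul_log (t := t) H.one_le (by rw [H.area]; exact H.p_pos)
  rwa [H.area, ← H.L_eq] at h

theorem t_sq_le : t ^ 2 ≤ 1 / 8 := by
  have h1 := H.n_mul_t_sq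
  have h2 := H.large_sq
  have h3 := H.L_ge
  have h4 := H.n_pos
  have h5 : n * t ^ 2 ≤ n * (1 / 8) := by nlinarith
  exact le_of_mul_le_mul_left h5 h4

theorem n_mul_t_pow_four : n * t ^ 4 ≤ 1 / 4 := by
  have h1 := H.n_mul_t_sq
  have h2 := H.large_sq
  have h4 := H.n_pos
  have h5 : n * (n * t ^ 4) ≤ n * (1 / 4) := by
    calc n * (n * t ^ 4) = (n * t ^ 2) ^ 2 := by ring
      _ ≤ (2 * L) ^ 2 := pow_le_pow_left₀ (by positivity) h1 2
      _ ≤ n * (1 / 4) := by nlinarith [sq_nonneg L]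
  exact le_of_mul_le_mul_left h5 h4

theorem capSlope_le : capSlope n t ≤ 50 * (p ^ 2 * L) := by
  have h := SphereRGG.capSlope_le H.two_le (by linarith [H.t_sq_le] : t ^ 2 ≤ 1 / 2)
    (by linarith [H.L_ge]) H.n_mul_t_sq
  rwa [H.area] at h

theorem le_capSlope : p ^ 2 * L ≤ 40 * capSlope n t := by
  have h := SphereRGG.le_capSlope H.two_le (by linarith [H.t_sq_le] : t ^ 2 ≤ 1 / 2)
    (by rw [H.area]; exact H.p_pos)
    (by rw [H.area, ← H.L_eq]; linarith [H.L_ge]) H.n_mul_t_pow_four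
  rwa [H.area, ← H.L_eq] at h

theorem abs_capRem_le (x y : UnitSphere (n + 2)) :
    |capRem n t (sinner x y)| ≤ 600 * (p ^ 2 * L ^ 2) * sinner x y ^ 2 +
      2 * {y | s₀ < |sinner x y|}.indicator (fun _ => (1 : ℝ)) y := by
  classical
  rw [Set.indicator_apply]
  split_ifs with h
  · have := abs_capRem_le_two H.one_le H.t_nonneg (by linarith [H.t_sq_le] : t ^ 2 ≤ 1 / 2) x y
    have h2 : 0 ≤ 600 * (p ^ 2 * L ^ 2) * sinner x y ^ 2 := by positivity
    linarith
  · have hs : |sinner x y| ≤ s₀ := not_lt.1 h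
    have h2 := SphereRGG.abs_capRem_le H.two_le H.t_sq_le (by linarith [H.L_ge]) H.n_mul_t_sq
      (hs.trans H.s₀_le)
      ((mul_le_mul_of_nonneg_left hs (by linarith [H.L_ge])).trans H.L_mul_s₀_le)
    rw [H.area] at h2
    linarith

theorem isBddKernel_capRem :
    IsBddKernel fun x y : UnitSphere (n + 2) => capRem n t (sinner x y) :=
  SphereRGG.isBddKernel_capRem H.one_le H.t_nonneg H.area

/-- A single estimate with a free weight, used with w equal to 1, |s|, the indicator of the cap, s²
and half the absolute remainder. -/
theorem integral_mul_abs_capRem_le (x : UnitSphere (n + 2)) {w : UnitSphere (n + 2) → ℝ}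
    (hw : Measurable w) (h0 : ∀ y, 0 ≤ w y) (h1 : ∀ y, w y ≤ 1) :
    ∫ y, w y * |capRem n t (sinner x y)| ∂(σₙ n) ≤
      600 * (p ^ 2 * L ^ 2) * ∫ y, w y * sinner x y ^ 2 ∂(σₙ n) + 2 * (p ^ 4 / n ^ 2) := by
  have hms : Measurable fun y : UnitSphere (n + 2) => sinner x y :=
    isBddKernel_sinner.measurable_left x
  have hA : MeasurableSet {y | s₀ < |sinner x y|} :=
    measurableSet_lt measurable_const (measurable_abs.comp hms)
  have i1 : Integrable (fun y => w y * sinner x y ^ 2) (σₙ n) := by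
    refine integrable_of_bdd (C := 1) (hw.mul (hms.pow_const 2)) fun y => ?_
    rw [abs_of_nonneg (mul_nonneg (h0 y) (sq_nonneg _))]
    refine mul_le_one₀ (h1 y) (sq_nonneg _) ?_
    exact sinner_sq_le x y
  have i2 : Integrable ({y | s₀ < |sinner x y|}.indicator (fun _ => (1 : ℝ))) (σₙ n) :=
    (integrable_const (1 : ℝ)).indicator hA
  obtain ⟨C, hC⟩ := H.isBddKernel_capRem.bdd
  have i3 : Integrable (fun y => w y * |capRem n t (sinner x y)|) (σₙ n) := by
    refine integrable_of_bdd (C := C)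
      (hw.mul (measurable_abs.comp (H.isBddKernel_capRem.measurable_left x))) fun y => ?_
    rw [abs_of_nonneg (mul_nonneg (h0 y) (abs_nonneg _))]
    exact (mul_le_of_le_one_left (abs_nonneg _) (h1 y)).trans (hC x y)
  have h2 : ∫ y, w y * |capRem n t (sinner x y)| ∂(σₙ n) ≤
      ∫ y, (600 * (p ^ 2 * L ^ 2) * (w y * sinner x y ^ 2) +
        2 * {y | s₀ < |sinner x y|}.indicator (fun _ => (1 : ℝ)) y) ∂(σₙ n) := by
    refine integral_mono i3 ((i1.const_mul _).fun_add (i2.const_mul 2)) fun y => ?_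
    have h3 : 0 ≤ {y | s₀ < |sinner x y|}.indicator (fun _ => (1 : ℝ)) y :=
      Set.indicator_nonneg (fun _ _ => zero_le_one) y
    have h4 := mul_le_mul_of_nonneg_left (H.abs_capRem_le x y) (h0 y)
    have h5 := mul_le_mul_of_nonneg_right (h1 y) h3
    change _ * _ ≤ _
    linarith
  rw [integral_add (i1.const_mul _) (i2.const_mul 2), integral_const_mul, integral_const_mul,
    integral_indicator_const _ hA] at h2
  have h3 := (uniformSphere_abs_sinner_le H.one_le s₀ x H.s₀_pos.le).trans H.tail
  rw [smul_eq_mul, mul_one] at h2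
  linarith

theorem p_sq_le : p ^ 2 ≤ L ^ 2 :=
  pow_le_pow_left₀ H.p_pos.le (by linarith [H.p_le, H.L_ge]) 2

theorem integral_abs_capRem_le (x : UnitSphere (n + 2)) :
    ∫ y, |capRem n t (sinner x y)| ∂(σₙ n) ≤ 602 * (p ^ 2 * L ^ 2) / n := by
  have h := H.integral_mul_abs_capRem_le x (w := fun _ => 1) measurable_const
    (fun _ => zero_le_one) (fun _ => le_rfl)
  simp only [one_mul] at h
  rw [integral_sinner_sq] at h
  have hn := H.n_pos
  have h1 : (1 : ℝ) / ((n + 2 : ℕ) : ℝ) ≤ 1 / n := by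
    push_cast
    exact one_div_le_one_div_of_le hn (by linarith)
  have h2 := mul_le_mul_of_nonneg_left h1 (show 0 ≤ 600 * (p ^ 2 * L ^ 2) by positivity)
  have h3 : p ^ 4 / n ^ 2 ≤ p ^ 2 * L ^ 2 / n := by
    rw [div_le_div_iff₀ (by positivity) hn]
    have hn1 : (1 : ℝ) ≤ n := by exact_mod_cast H.one_le
    calc p ^ 4 * n = p ^ 2 * p ^ 2 * (n * 1) := by ring
      _ ≤ p ^ 2 * L ^ 2 * (n * n) := by
        gcongr ?_ * ?_ * (n * ?_)
        exact H.p_sq_le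
      _ = p ^ 2 * L ^ 2 * n ^ 2 := by ring
  have e : 602 * (p ^ 2 * L ^ 2) / n = 600 * (p ^ 2 * L ^ 2) * (1 / n) +
      2 * (p ^ 2 * L ^ 2 / n) := by ring
  linarith

theorem integral_abs_sinner_mul_capRem_le (x : UnitSphere (n + 2)) :
    ∫ y, |sinner x y| * |capRem n t (sinner x y)| ∂(σₙ n) ≤
      19802 * (p ^ 2 * L ^ 2) / √n ^ 3 := by
  have h := H.integral_mul_abs_capRem_le x (w := fun y => |sinner x y|)
    (measurable_abs.comp (isBddKernel_sinner.measurable_left x))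
    (fun _ => abs_nonneg _) (fun y => abs_sinner_le x y)
  have h1 := integral_abs_sinner_cube_le H.one_le x
  have e1 : ∀ y, |sinner x y| * sinner x y ^ 2 = |sinner x y| ^ 3 := fun y => by
    rw [← sq_abs]; ring
  simp only [e1] at h
  have h2 := mul_le_mul_of_nonneg_left h1 (show 0 ≤ 600 * (p ^ 2 * L ^ 2) by positivity)
  have hn := H.n_pos
  have hr : 1 ≤ √(n : ℝ) := Real.one_le_sqrt.2 (by exact_mod_cast H.one_le)
  have hsq : (n : ℝ) ^ 2 = √(n : ℝ) ^ 4 := by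
    rw [show 4 = 2 * 2 by rfl, pow_mul, Real.sq_sqrt hn.le]
  have h3 : p ^ 4 / n ^ 2 ≤ p ^ 2 * L ^ 2 / √n ^ 3 := by
    rw [hsq, show p ^ 4 = p ^ 2 * p ^ 2 by ring]
    exact div_le_div₀ (by positivity) (mul_le_mul_of_nonneg_left H.p_sq_le (sq_nonneg p))
      (by positivity) (pow_le_pow_right₀ hr (by norm_num))
  have e : 19802 * (p ^ 2 * L ^ 2) / √n ^ 3 = 600 * (p ^ 2 * L ^ 2) * (33 / √n ^ 3) +
      2 * (p ^ 2 * L ^ 2 / √n ^ 3) := by ring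
  linarith

theorem setIntegral_cap_abs_capRem_le (x : UnitSphere (n + 2)) :
    ∫ y in cap t x, |capRem n t (sinner x y)| ∂(σₙ n) ≤ 9606 * (p ^ 3 * L ^ 3) / n := by
  classical
  have hm := measurableSet_cap t x
  have h := H.integral_mul_abs_capRem_le x (w := (cap t x).indicator fun _ => 1)
    (measurable_const.indicator hm)
    (fun y => Set.indicator_nonneg (fun _ _ => zero_le_one) y)
    (fun y => Set.indicator_apply_le' (fun _ => le_rfl) fun _ => zero_le_one)
  have e1 : ∀ φ : UnitSphere (n + 2) → ℝ,
      ∫ y, (cap t x).indicator (fun _ => (1 : ℝ)) y * φ y ∂(σₙ n) = ∫ y in cap t x, φ y ∂(σₙ n) := by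
    intro φ
    rw [← integral_indicator hm]
    congr 1 with y
    rw [Set.indicator_apply, Set.indicator_apply]
    split_ifs <;> simp
  rw [e1, e1] at h
  have hL := H.L_ge
  have h1 := integral_cap_sinner_sq_le (t := t) H.one_le x H.p_pos
    ((uniformSphere_cap H.one_le H.t_nonneg x).trans H.area) (by rw [← H.L_eq]; exact hL)
  rw [← H.L_eq] at h1
  have h2 := mul_le_mul_of_nonneg_left h1 (show 0 ≤ 600 * (p ^ 2 * L ^ 2) by positivity)
  have hn := H.n_pos
  have hp := H.p_pos
  have h3 : p ^ 4 / n ^ 2 ≤ 3 * (p ^ 3 * L ^ 3) / n := by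
    have hL3 : p ≤ 3 * L ^ 3 := by
      have : (2 / 3 : ℝ) ^ 3 ≤ L ^ 3 := pow_le_pow_left₀ (by norm_num) hL 3
      linarith [H.p_le]
    have hn1 : (1 : ℝ) ≤ n := by exact_mod_cast H.one_le
    rw [div_le_div_iff₀ (by positivity) hn]
    calc p ^ 4 * n = p ^ 3 * p * (n * 1) := by ring
      _ ≤ p ^ 3 * (3 * L ^ 3) * (n * n) := by gcongr
      _ = 3 * (p ^ 3 * L ^ 3) * n ^ 2 := by ring
  have e : 9606 * (p ^ 3 * L ^ 3) / n = 600 * (p ^ 2 * L ^ 2) * (16 * p * L / n) +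
      2 * (3 * (p ^ 3 * L ^ 3) / n) := by ring
  linarith

/-- The weighted estimate is applied twice: the weight |R|/2 reduces E[R²] to E[s²|R|], and the
weight s² reduces that to the fourth moment. -/
theorem integral_capRem_sq_le (x : UnitSphere (n + 2)) :
    ∫ y, capRem n t (sinner x y) ^ 2 ∂(σₙ n) ≤ 3 * 10 ^ 7 * (p ^ 4 * L ^ 4) / n ^ 2 := by
  have hmr := H.isBddKernel_capRem.measurable_left x
  have h1 := H.integral_mul_abs_capRem_le x (w := fun y => sinner x y ^ 2)
    ((isBddKernel_sinner.measurable_left x).pow_const 2)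
    (fun _ => sq_nonneg _) (fun y => sinner_sq_le x y)
  have h2 := H.integral_mul_abs_capRem_le x (w := fun y => |capRem n t (sinner x y)| / 2)
    ((measurable_abs.comp hmr).div_const 2) (fun _ => by positivity)
    (fun y => by
      have := abs_capRem_le_two H.one_le H.t_nonneg (by linarith [H.t_sq_le] : t ^ 2 ≤ 1 / 2) x y
      change _ / _ ≤ _
      linarith)
  have e1 : ∀ y : UnitSphere (n + 2), sinner x y ^ 2 * sinner x y ^ 2 = sinner x y ^ 4 :=
    fun y => by ring
  have e2 : ∀ y : UnitSphere (n + 2), |capRem n t (sinner x y)| / 2 * sinner x y ^ 2 =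
      1 / 2 * (sinner x y ^ 2 * |capRem n t (sinner x y)|) := fun y => by ring
  have e3 : ∀ y : UnitSphere (n + 2), |capRem n t (sinner x y)| / 2 * |capRem n t (sinner x y)| =
      1 / 2 * capRem n t (sinner x y) ^ 2 := fun y => by rw [← sq_abs]; ring
  simp only [e1] at h1
  simp only [e2, e3, integral_const_mul] at h2
  have h3 := integral_sinner_pow_four_le H.one_le x
  have hB : 0 ≤ 600 * (p ^ 2 * L ^ 2) := by positivity
  have h4 := mul_le_mul_of_nonneg_left h1 hB
  have h5 := mul_le_mul_of_nonneg_left (mul_le_mul_of_nonneg_left h3 hB) hB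
  have hn := H.n_pos
  have hL4 : (1 : ℝ) ≤ 6 * L ^ 4 := by
    have : (2 / 3 : ℝ) ^ 4 ≤ L ^ 4 := pow_le_pow_left₀ (by norm_num) H.L_ge 4
    linarith
  have h6 : p ^ 4 / n ^ 2 ≤ 6 * (p ^ 4 * L ^ 4) / n ^ 2 := by
    gcongr
    nlinarith [pow_pos H.p_pos 4]
  have h7 : 600 * (p ^ 2 * L ^ 2) * (p ^ 4 / n ^ 2) ≤ 600 * (p ^ 4 * L ^ 4) / n ^ 2 := by
    have : p ^ 2 * L ^ 2 * p ^ 4 ≤ p ^ 4 * L ^ 4 := by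
      calc p ^ 2 * L ^ 2 * p ^ 4 = p ^ 4 * L ^ 2 * p ^ 2 := by ring
        _ ≤ p ^ 4 * L ^ 2 * L ^ 2 := by gcongr ?_ * ?_; exact H.p_sq_le
        _ = p ^ 4 * L ^ 4 := by ring
    rw [← mul_div_assoc]
    gcongr ?_ / _
    linarith
  have e : 600 * (p ^ 2 * L ^ 2) * (600 * (p ^ 2 * L ^ 2) * (64 / n ^ 2)) =
      600 * 600 * 64 * (p ^ 4 * L ^ 4) / n ^ 2 := by ring
  rw [e] at h5
  have h8 : 0 ≤ p ^ 4 * L ^ 4 / n ^ 2 := by positivity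
  simp only [mul_div_assoc] at h5 h6 h7 h8 ⊢
  linarith

/-- The correction to (n + 2) λ² is O(p² L² / √n), and n ≥ 10^15 L² makes it at most 1/8 of the
lower bound p² L / 40 for the slope. -/
theorem abs_linEig_capRem_le :
    |(n + 2) * ∫ y, sinner (axis 0) y * capRem n t (sinner (axis 0) y) ∂(σₙ n)| ≤
      p ^ 2 * L / 320 := by
  have h1 := H.integral_abs_sinner_mul_capRem_le (axis 0)
  simp only [← abs_mul] at h1
  have h2 := (abs_integral_le_integral_abs (μ := σₙ n)
    (f := fun y => sinner (axis 0) y * capRem n t (sinner (axis 0) y))).trans h1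
  have hn := H.n_pos
  have hn2 : (2 : ℝ) ≤ n := by exact_mod_cast H.two_le
  have hL := H.L_ge
  have hr : 3 * 10 ^ 7 * L ≤ √(n : ℝ) := by
    refine Real.le_sqrt_of_sq_le ?_
    have := H.large_sq
    nlinarith [sq_nonneg L]
  have hr0 : 0 < √(n : ℝ) := Real.sqrt_pos.2 hn
  have hnr : (n : ℝ) = √(n : ℝ) ^ 2 := (Real.sq_sqrt hn.le).symm
  rw [abs_mul, abs_of_nonneg (by positivity)]
  calc ((n : ℝ) + 2) * _ ≤ 2 * n * (19802 * (p ^ 2 * L ^ 2) / √n ^ 3) := by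
        gcongr
        linarith
    _ = 39604 * (p ^ 2 * L) * L / √n := by
        nth_rw 1 [hnr]
        field_simp
        ring
    _ ≤ p ^ 2 * L / 320 := by
        rw [div_le_div_iff₀ hr0 (by norm_num)]
        have : p ^ 2 * L * (3 * 10 ^ 7 * L) ≤ p ^ 2 * L * √n := by gcongr
        have h0 : 0 ≤ p ^ 2 * L * L := by positivity
        linarith

theorem linEig_sq_bounds :
    p ^ 2 * L / 80 ≤ (n + 2) * linEig (edgeKernel (n + 2) t p) ^ 2 ∧
      (n + 2) * linEig (edgeKernel (n + 2) t p) ^ 2 ≤ 51 * (p ^ 2 * L) := by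
  have h1 := abs_le.1 H.abs_linEig_capRem_le
  have h2 := H.capSlope_le
  have h3 := H.le_capSlope
  rw [linEig_edgeKernel_sq H.one_le H.t_nonneg H.area]
  have : 0 ≤ p ^ 2 * L := by have := H.L_ge; positivity
  constructor <;> linarith [h1.1, h1.2]

theorem cap_measure (x : UnitSphere (n + 2)) : (σₙ n).real (cap t x) = p :=
  (uniformSphere_cap H.one_le H.t_nonneg x).trans H.area

theorem linEig_nonneg : 0 ≤ linEig (edgeKernel (n + 2) t p) :=
  (mul_nonneg H.t_nonneg H.p_pos.le).trans (mul_le_linEig_edgeKernel (axis 0) (H.cap_measure _))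

theorem integral_deflate_edgeKernel (x : UnitSphere (n + 2)) :
    ∫ y, deflate (edgeKernel (n + 2) t p) x y ∂(σₙ n) = 0 :=
  integral_deflate (isBddKernel_edgeKernel _ _ _)
    (fun x => integral_edgeKernel x (H.cap_measure x)) x

/-- The second iterate of the deflated kernel differs from the remainder by an affine function of s
and is orthogonal to all such functions, so its norm cannot exceed that of the remainder. -/
theorem hsSq_deflate_le_integral_capRem_sq :
    hsSq (deflate (edgeKernel (n + 2) t p)) 1 ≤
      ∫ y, capRem n t (sinner (axis 0) y) ^ 2 ∂(σₙ n) := by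
  have hb := (isBddKernel_edgeKernel (n + 2) t p).deflate
  have hi := (isInvKernel_edgeKernel (n + 2) t p).deflate
  have hs := deflate_symm (edgeKernel_symm (n + 2) t p)
  set g := deflate (edgeKernel (n + 2) t p) with hg
  have h1 := integral_row_sq hb hs hi 1 (axis 0)
  have hz := integral_kpow_eq_zero hb H.integral_deflate_edgeKernel 1 (axis 0)
  have hls := sinner_kcomp_kpow_deflate (isBddKernel_edgeKernel (n + 2) t p)
    (edgeKernel_symm (n + 2) t p) (isInvKernel_edgeKernel (n + 2) t p) 1 (axis 0) (axis 0)
  rw [← hg] at hls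
  have hg2 := kpow_deflate_edgeKernel_one H.one_le H.t_nonneg H.area (axis 0)
  rw [← hg] at hg2
  set a := ∫ z, capRem n t (sinner (axis 0) z) ∂(σₙ n)
  set b := (n + 2) * ∫ z, sinner (axis 0) z * capRem n t (sinner (axis 0) z) ∂(σₙ n)
  have hz2 : ∫ y, sinner (axis 0) y * kpow (σₙ n) g 1 (axis 0) y ∂(σₙ n) = 0 := by
    rw [← hls, kcomp]
    simp only [kpow_symm hb hs 1 (axis 0)]
  have hG := hb.pow (μ := σₙ n) 1
  have i1 := (hG.mul hG).integrable (μ := σₙ n) (axis 0)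
  have i2 := hG.integrable (μ := σₙ n) (axis 0)
  have i3 := (isBddKernel_sinner.mul hG).integrable (μ := σₙ n) (axis 0)
  have hR : ∀ y, 2 * (a * kpow (σₙ n) g 1 (axis 0) y) +
      2 * (b * (sinner (axis 0) y * kpow (σₙ n) g 1 (axis 0) y)) +
      kpow (σₙ n) g 1 (axis 0) y * kpow (σₙ n) g 1 (axis 0) y ≤
      capRem n t (sinner (axis 0) y) ^ 2 := by
    intro y
    have e : capRem n t (sinner (axis 0) y) =
        kpow (σₙ n) g 1 (axis 0) y + (a + b * sinner (axis 0) y) := by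
      rw [hg2]; ring
    rw [e]
    nlinarith [sq_nonneg (a + b * sinner (axis 0) y)]
  have h4 := integral_mono (μ := σₙ n)
    ((((i2.const_mul a).const_mul 2).fun_add ((i3.const_mul b).const_mul 2)).fun_add i1)
    (by simpa only [pow_two] using
      (H.isBddKernel_capRem.mul H.isBddKernel_capRem).integrable (μ := σₙ n) (axis 0)) hR
  rw [integral_add (((i2.const_mul a).const_mul 2).fun_add ((i3.const_mul b).const_mul 2)) i1,
    integral_add ((i2.const_mul a).const_mul 2) ((i3.const_mul b).const_mul 2),
    integral_const_mul, integral_const_mul, integral_const_mul, integral_const_mul, hz, hz2] at h4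
  simp only [← pow_two] at h4
  rw [h1] at h4
  linarith

/-- The left side is of order p⁴ L⁴ / n² and the right of order p⁴ L² / n. The 16 offsets the factor
8 in `abs_kpow_diag_le` and leaves the target ratio 1/2. -/
theorem sixteen_mul_hsSq_le :
    16 * hsSq (deflate (edgeKernel (n + 2) t p)) 1 ≤
      (n + 2) * linEig (edgeKernel (n + 2) t p) ^ 4 := by
  have h1 := H.hsSq_deflate_le_integral_capRem_sq.trans (H.integral_capRem_sq_le (axis 0))
  have h2 := H.linEig_sq_bounds.1
  have hn := H.n_pos
  have hn2 : (2 : ℝ) ≤ n := by exact_mod_cast H.two_le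
  have hL := H.L_ge
  have h3 : (p ^ 2 * L / 80) ^ 2 ≤ ((n + 2) * linEig (edgeKernel (n + 2) t p) ^ 2) ^ 2 :=
    pow_le_pow_left₀ (by positivity) h2 2
  have h4 : 16 * (3 * 10 ^ 7 * (p ^ 4 * L ^ 4) / n ^ 2) ≤ (p ^ 2 * L / 80) ^ 2 / (n + 2) := by
    rw [← mul_div_assoc, div_le_div_iff₀ (by positivity) (by positivity)]
    have h5 := H.large_sq
    calc 16 * (3 * 10 ^ 7 * (p ^ 4 * L ^ 4)) * ((n : ℝ) + 2)
        ≤ 16 * (3 * 10 ^ 7 * (p ^ 4 * L ^ 4)) * (2 * n) := by gcongr; linarith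
      _ = (96 * 10 ^ 7 * L ^ 2) * (p ^ 4 * L ^ 2 * n) := by ring
      _ ≤ (n / 6400) * (p ^ 4 * L ^ 2 * n) := by
          gcongr ?_ * _
          nlinarith [sq_nonneg L]
      _ = (p ^ 2 * L / 80) ^ 2 * n ^ 2 := by ring
  have h5 : (p ^ 2 * L / 80) ^ 2 / (n + 2) ≤
      (n + 2) * linEig (edgeKernel (n + 2) t p) ^ 4 := by
    rw [div_le_iff₀ (by positivity)]
    calc _ ≤ _ := h3
      _ = _ := by ring
  linarith

/-- λ² ≥ p² L / (160 n) combined with n ≥ 2 · 10^15 L³ trades √n for n; the constant is just below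
√(2 · 10^15 / 160). -/
theorem linEig_lower :
    35 * 10 ^ 5 * (p * L ^ 2) / n ≤ linEig (edgeKernel (n + 2) t p) := by
  have h2 := H.linEig_sq_bounds.1
  have hn := H.n_pos
  have hp := H.p_pos
  have hn2 : (2 : ℝ) ≤ n := by exact_mod_cast H.two_le
  have hL := H.L_ge
  refine le_of_pow_le_pow_left₀ two_ne_zero H.linEig_nonneg ?_
  have h3 : p ^ 2 * L / 80 / (2 * n) ≤ linEig (edgeKernel (n + 2) t p) ^ 2 := by
    rw [div_le_iff₀ (by positivity)]
    refine h2.trans ?_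
    rw [mul_comm]
    gcongr
    linarith
  refine le_trans ?_ h3
  rw [div_pow, div_div, div_le_div_iff₀ (by positivity) (by positivity)]
  have h5 := mul_le_mul_of_nonneg_left H.large (show 0 ≤ 160 * (p ^ 2 * L * n) / 160 by positivity)
  have h6 : 0 ≤ p ^ 2 * L ^ 4 * n := by positivity
  nlinarith

/-- In ∫ g(e, y) g²(y, e) dy the factor g may be replaced by the indicator of the cap at e, as g² is
orthogonal to constants and linear functions. Inserting g² = R - a - b s leaves the integral of R
over the cap, a p and b λ. -/
theorem abs_kpow_deflate_two_le :
    |kpow (σₙ n) (deflate (edgeKernel (n + 2) t p)) 2 (axis 0) (axis 0)| ≤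
      1 / 2 * ((n + 2) * linEig (edgeKernel (n + 2) t p) ^ 3) := by
  have hk := isBddKernel_edgeKernel (n + 2) t p
  have hb := hk.deflate
  have hs := deflate_symm (edgeKernel_symm (n + 2) t p)
  have hlow := H.linEig_lower
  have hl0 := H.linEig_nonneg
  have hsq := H.linEig_sq_bounds.1
  have heig := linEig_edgeKernel t p (axis 0 : UnitSphere (n + 2))
  have hg2 := kpow_deflate_edgeKernel_one H.one_le H.t_nonneg H.area (axis 0)
  have hbR := H.abs_linEig_capRem_le
  have hz := integral_kpow_eq_zero hb H.integral_deflate_edgeKernel 1 (axis 0)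
  have hls := sinner_kcomp_kpow_deflate hk
    (edgeKernel_symm (n + 2) t p) (isInvKernel_edgeKernel (n + 2) t p) 1 (axis 0) (axis 0)
  set lam := linEig (edgeKernel (n + 2) t p) with hlam
  have hdef : ∀ y, deflate (edgeKernel (n + 2) t p) (axis 0) y =
      (cap t (axis 0)).indicator (fun _ => (1 : ℝ)) y - p - (n + 2) * lam * sinner (axis 0) y :=
    fun y => by rw [deflate, edgeKernel_eq_indicator]
  set g := deflate (edgeKernel (n + 2) t p) with hg
  set a := ∫ z, capRem n t (sinner (axis 0) z) ∂(σₙ n) with ha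
  set b := (n + 2) * ∫ z, sinner (axis 0) z * capRem n t (sinner (axis 0) z) ∂(σₙ n)
  have hz2 : ∫ y, sinner (axis 0) y * kpow (σₙ n) g 1 (axis 0) y ∂(σₙ n) = 0 := by
    rw [← hls, kcomp]
    simp only [kpow_symm hb hs 1 (axis 0)]
  have hm := measurableSet_cap t (axis 0 : UnitSphere (n + 2))
  have hG := (hb.pow (μ := σₙ n) 1).integrable (μ := σₙ n) (axis 0)
  have hsG := (isBddKernel_sinner.mul (hb.pow (μ := σₙ n) 1)).integrable (μ := σₙ n) (axis 0)
  have hR := H.isBddKernel_capRem.integrable (μ := σₙ n) (axis 0)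
  have hS := (isBddKernel_sinner (d := n + 2)).integrable (μ := σₙ n) (axis 0)
  have e1 : kpow (σₙ n) g 2 (axis 0) (axis 0) =
      ∫ y in cap t (axis 0), kpow (σₙ n) g 1 (axis 0) y ∂(σₙ n) := by
    have e : ∀ y, g (axis 0) y * kpow (σₙ n) g 1 y (axis 0) =
        (cap t (axis 0)).indicator (fun y => kpow (σₙ n) g 1 (axis 0) y) y -
          p * kpow (σₙ n) g 1 (axis 0) y -
          (n + 2) * lam * (sinner (axis 0) y * kpow (σₙ n) g 1 (axis 0) y) := by
      intro y
      classical
      rw [kpow_symm hb hs 1 y, hdef, Set.indicator_apply, Set.indicator_apply]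
      split_ifs <;> ring
    change ∫ y, g (axis 0) y * kpow (σₙ n) g 1 y (axis 0) ∂(σₙ n) = _
    simp only [e]
    have hGi : Integrable (fun y => (cap t (axis 0)).indicator
        (fun y => kpow (σₙ n) g 1 (axis 0) y) y) (σₙ n) := hG.indicator hm
    have hGi2 : Integrable (fun y => (cap t (axis 0)).indicator
        (fun y => kpow (σₙ n) g 1 (axis 0) y) y - p * kpow (σₙ n) g 1 (axis 0) y) (σₙ n) :=
      hGi.sub (hG.const_mul p)
    rw [integral_sub hGi2 (hsG.const_mul _), integral_sub hGi (hG.const_mul p), integral_const_mul, integral_const_mul,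
      hz, hz2, integral_indicator hm]
    ring
  have e2 : ∫ y in cap t (axis 0), kpow (σₙ n) g 1 (axis 0) y ∂(σₙ n) =
      (∫ y in cap t (axis 0), capRem n t (sinner (axis 0) y) ∂(σₙ n)) - a * p - b * lam := by
    simp only [hg2]
    have hRa : Integrable (fun y => capRem n t (sinner (axis 0) y) - a) (σₙ n) :=
      hR.sub (integrable_const a)
    rw [integral_sub hRa.integrableOn (hS.const_mul b).integrableOn,
      integral_sub hR.integrableOn (integrable_const a).integrableOn, setIntegral_const,
      H.cap_measure, integral_const_mul, ← heig, smul_eq_mul]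
    ring
  have h1 := (abs_integral_le_integral_abs (μ := (σₙ n).restrict (cap t (axis 0)))
    (f := fun y => capRem n t (sinner (axis 0) y))).trans (H.setIntegral_cap_abs_capRem_le _)
  have h2 := (abs_integral_le_integral_abs (μ := σₙ n)
    (f := fun y => capRem n t (sinner (axis 0) y))).trans (H.integral_abs_capRem_le _)
  rw [← ha] at h2
  have hp := H.p_pos
  have hL := H.L_ge
  have hn := H.n_pos
  have h3 : |a * p| ≤ 903 * (p ^ 3 * L ^ 3) / n := by
    rw [abs_mul, abs_of_pos hp]
    refine (mul_le_mul_of_nonneg_right h2 hp.le).trans ?_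
    rw [div_mul_eq_mul_div]
    gcongr ?_ / _
    nlinarith [show 0 ≤ p ^ 3 * L ^ 2 by positivity]
  have h4 : |b * lam| ≤ p ^ 2 * L / 320 * lam := by
    rw [abs_mul, abs_of_nonneg hl0]
    exact mul_le_mul_of_nonneg_right hbR hl0
  -- 10509 = 9606 + 903 collects the first two terms. By `linEig_lower` they cost no more than the
  -- third, so the total is at most p² L λ / 160.
  have h5 : 10509 * (p ^ 3 * L ^ 3) / n ≤ p ^ 2 * L / 320 * lam := by
    have h6 := mul_le_mul_of_nonneg_left hlow (show 0 ≤ p ^ 2 * L / 320 by positivity)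
    refine le_trans ?_ h6
    rw [← mul_div_assoc]
    gcongr ?_ / _
    nlinarith [show 0 ≤ p ^ 3 * L ^ 3 by positivity]
  have h6 := mul_le_mul_of_nonneg_right hsq hl0
  have h8 := abs_le.1 h1
  have h9 := abs_le.1 h3
  have h10 := abs_le.1 h4
  rw [e1, e2, abs_le]
  have h0 : 0 ≤ p ^ 2 * L * lam := by positivity
  simp only [mul_div_assoc] at *
  constructor <;> nlinarith [h8.1, h8.2, h9.1, h9.2, h10.1, h10.2]

theorem abs_kpow_deflate_le (m : ℕ) :
    |kpow (σₙ n) (deflate (edgeKernel (n + 2) t p)) (m + 2) (axis 0) (axis 0)| ≤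
      1 / 2 * ((n + 2) * linEig (edgeKernel (n + 2) t p) ^ (m + 3)) := by
  cases m with
  | zero => exact H.abs_kpow_deflate_two_le
  | succ m =>
    have h16 := H.sixteen_mul_hsSq_le
    have hl0 := H.linEig_nonneg
    have hn := H.n_pos
    set lam := linEig (edgeKernel (n + 2) t p)
    have h4 : 0 ≤ lam ^ 4 := by positivity
    have h := abs_kpow_diag_le (isBddKernel_edgeKernel (n + 2) t p).deflate
      (deflate_symm (edgeKernel_symm (n + 2) t p)) (isInvKernel_edgeKernel (n + 2) t p).deflate
      H.one_le H.integral_deflate_edgeKernel hl0 (by nlinarith) m (axis 0)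
    refine h.trans ?_
    have hm : 0 ≤ lam ^ m := by positivity
    calc 8 * lam ^ m * hsSq (deflate (edgeKernel (n + 2) t p)) 1
        = 1 / 2 * (lam ^ m * (16 * hsSq (deflate (edgeKernel (n + 2) t p)) 1)) := by ring
      _ ≤ 1 / 2 * (lam ^ m * ((n + 2) * lam ^ 4)) := by gcongr
      _ = 1 / 2 * ((n + 2) * lam ^ (m + 1 + 3)) := by ring

/-- The trace of the iterates of the edge kernel is governed by the linear eigenvalue. -/
theorem kpow_edgeKernel_bounds (m : ℕ) (x : UnitSphere (n + 2)) :
    1 / 2 * ((n + 2) * linEig (edgeKernel (n + 2) t p) ^ (m + 3)) ≤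
        kpow (σₙ n) (edgeKernel (n + 2) t p) (m + 2) x x ∧
      kpow (σₙ n) (edgeKernel (n + 2) t p) (m + 2) x x ≤
        3 / 2 * ((n + 2) * linEig (edgeKernel (n + 2) t p) ^ (m + 3)) := by
  have h := abs_le.1 (H.abs_kpow_deflate_le m)
  rw [((isInvKernel_edgeKernel (n + 2) t p).pow _).diag x (axis 0),
    kpow_eq_add_deflate (isBddKernel_edgeKernel _ _ _) (edgeKernel_symm _ _ _)
      (isInvKernel_edgeKernel _ _ _), sinner_self]
  constructor <;> linarith [h.1, h.2]

end CapRegime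

/-! ### The hypotheses on p and d put the threshold in the admissible range. -/

theorem capRegime_threshold {n : ℕ} {p : ℝ} (hd : 2 * (2 * 10 ^ 15) ^ 4 ≤ n + 2) (hp0 : 0 < p)
    (hp : p ≤ 1 / 2) (hL : (5 * Real.log (1 / p)) ^ 4 ≤ (n : ℝ) + 2) :
    CapRegime n (threshold p (n + 2)) p (Real.log (1 / p)) (1 / √√((n : ℝ) + 2)) := by
  have hdR : 2 * (2 * 10 ^ 15 : ℝ) ^ 4 ≤ (n : ℝ) + 2 := by exact_mod_cast hd
  have hn4 : (4 : ℝ) ≤ n := by norm_num at hdR; linarith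
  have hn2 : 2 ≤ n := by
    have : 4 ≤ n := by exact_mod_cast hn4
    omega
  have hn1 : 1 ≤ n := by omega
  have hL0 : 0 ≤ Real.log (1 / p) :=
    Real.log_nonneg (by rw [le_div_iff₀ hp0]; linarith)
  set L := Real.log (1 / p) with hLdef
  -- u = d^(1/4) and s₀ = 1/u, so d ≥ (5L)^4 is exactly L s₀ ≤ 1/5, and n s₀² is of order √d, which
  -- dominates L and log n.
  set u := √√((n : ℝ) + 2) with hu
  have hu2 : u ^ 2 = √((n : ℝ) + 2) := Real.sq_sqrt (Real.sqrt_nonneg _)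
  have hu4 : u ^ 4 = (n : ℝ) + 2 := by
    rw [show 4 = 2 * 2 by rfl, pow_mul, hu2, Real.sq_sqrt (by positivity)]
  have hu0 : 0 ≤ u := Real.sqrt_nonneg _
  have huB : 2 * 10 ^ 15 ≤ u := by
    refine le_of_pow_le_pow_left₀ (n := 4) (by norm_num) hu0 ?_
    rw [hu4]
    have : (0 : ℝ) ≤ (2 * 10 ^ 15) ^ 4 := by positivity
    linarith
  have huL : 5 * L ≤ u := by
    refine le_of_pow_le_pow_left₀ (n := 4) (by norm_num) hu0 ?_
    rwa [hu4]
  have hupos : 0 < u := by linarith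
  have hnhalf : ((n : ℝ) + 2) / 2 ≤ n := by linarith
  refine ⟨hn2, threshold_nonneg hn1 hp0.le hp, capArea_threshold hn1 hp0.le hp, hp0, hp, rfl,
    by positivity, ?_, ?_, ?_, ?_⟩
  · exact one_div_le_one_div_of_le (by norm_num) (by linarith)
  · rw [mul_one_div, div_le_div_iff₀ hupos (by norm_num)]
    linarith
  · have hnpos : (0 : ℝ) < n := by linarith
    have e1 : p = Real.exp (-L) := by
      rw [hLdef, one_div, Real.log_inv, neg_neg, Real.exp_log hp0]
    have e2 : p ^ 4 / (n : ℝ) ^ 2 = Real.exp (-(4 * L) - 2 * Real.log n) := by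
      rw [Real.exp_sub, two_mul, Real.exp_add, Real.exp_log hnpos, e1, ← Real.exp_nat_mul]
      congr 1
      · congr 1; push_cast; ring
      · ring
    rw [e2]
    refine Real.exp_le_exp.2 ?_
    have h1 : u ^ 2 / 2 ≤ n * (1 / u) ^ 2 := by
      rw [one_div, inv_pow, ← div_eq_mul_inv, div_le_div_iff₀ two_pos (by positivity)]
      have : u ^ 2 * u ^ 2 = u ^ 4 := by ring
      linarith
    have h2 : Real.log n ≤ 4 * u := by
      have h3 : Real.log n ≤ Real.log (u ^ 4) :=
        Real.log_le_log hnpos (by linarith)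
      rw [Real.log_pow] at h3
      have h4 := Real.log_le_sub_one_of_pos hupos
      push_cast at h3
      linarith
    have h5 : 36 * u ≤ u ^ 2 := by
      rw [pow_two]
      exact mul_le_mul_of_nonneg_right (by linarith) hu0
    linarith
  -- If L is at most 2 · 10^15, the lower bound on d suffices; otherwise the constant is absorbed
  -- into L, leaving L⁴ ≤ d/625.
  · rcases le_total L (2 * 10 ^ 15) with h | h
    · have h1 : L ^ 3 ≤ (2 * 10 ^ 15) ^ 3 := pow_le_pow_left₀ hL0 h 3
      have h2 : (2 * 10 ^ 15 : ℝ) * L ^ 3 ≤ (2 * 10 ^ 15) ^ 4 := by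
        calc (2 * 10 ^ 15 : ℝ) * L ^ 3 ≤ (2 * 10 ^ 15) * (2 * 10 ^ 15) ^ 3 :=
              mul_le_mul_of_nonneg_left h1 (by positivity)
          _ = (2 * 10 ^ 15) ^ 4 := by ring
      linarith
    · have h1 : 2 * 10 ^ 15 * L ^ 3 ≤ L * L ^ 3 :=
        mul_le_mul_of_nonneg_right h (by positivity)
      have h2 : (5 * L) ^ 4 = 625 * (L * L ^ 3) := by ring
      have h3 : 0 ≤ L * L ^ 3 := by positivity
      linarith

/-! ### From random graphs to traces, and the final constants. -/

theorem measurable_signedWeight {V : Type*} [Fintype V] (p : ℝ) (H : SimpleGraph V) :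
    Measurable (signedWeight p H) := by
  unfold signedWeight
  refine Finset.measurable_fun_prod _ fun e _ => Measurable.sub_const ?_ p
  exact Measurable.ite (measurableSet_setOfPred.2
    (measurable_set_iff.1 SimpleGraph.measurable_edgeSet e)) measurable_const measurable_const

theorem signedWeight_geometricGraph_cycle {V : Type*} [Fintype V] {m d : ℕ} (t p : ℝ)
    (f : Fin (m + 3) ↪ V) (x : V → UnitSphere d) :
    signedWeight p ((SimpleGraph.cycleGraph (m + 3)).map f) (geometricGraph t x) =
      ∏ i, edgeKernel d t p (x (f i)) (x (f (i + 1))) := by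
  classical
  unfold signedWeight
  trans ∏ e ∈ ((SimpleGraph.cycleGraph (m + 3)).map f).edgeFinset,
    ((if e ∈ (geometricGraph t x).edgeSet then (1 : ℝ) else 0) - p)
  · congr!
  rw [prod_edgeFinset_cycleGraph_map f fun e =>
    (if e ∈ (geometricGraph t x).edgeSet then (1 : ℝ) else 0) - p]
  refine Finset.prod_congr rfl fun i _ => ?_
  have hne : f i ≠ f (i + 1) := by
    intro h
    have := f.injective h
    simp at this
  rw [edgeKernel]
  congr 1
  refine if_congr ?_ rfl rfl
  exact ⟨fun h => h.2, fun h => ⟨hne, h⟩⟩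

/-- The expected signed weight of a cycle is the trace of an iterate of the edge kernel. -/
theorem integral_signedWeight_cycle {N m d : ℕ} [NeZero d] (p : ℝ) (f : Fin (m + 3) ↪ Fin N) :
    ∫ G, signedWeight p ((SimpleGraph.cycleGraph (m + 3)).map f) G
        ∂(randomGeometricGraph N p d) =
      ∫ a, kpow (uniformSphere d) (edgeKernel d (threshold p d) p) (m + 2) a a
        ∂uniformSphere d := by
  rw [randomGeometricGraph, integral_map (measurable_geometricGraph _).aemeasurable
    (measurable_signedWeight _ _).aestronglyMeasurable]
  simp only [signedWeight_geometricGraph_cycle]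
  have hb := isBddKernel_edgeKernel d (threshold p d) p
  rw [← integral_cycle hb (m + 1),
    ← (measurePreserving_pi_comp (uniformSphere d) f).map_eq, integral_map]
  · exact (measurePreserving_pi_comp (uniformSphere d) f).measurable.aemeasurable
  · exact (Finset.measurable_fun_prod Finset.univ fun i _ =>
      hb.comp_measurable (measurable_pi_apply i) (measurable_pi_apply (i + 1))).aestronglyMeasurable

/-- Puts the target in the form d w^ℓ, to be compared with (n + 2) λ^ℓ. -/
theorem cycle_scale_eq {p L d : ℝ} (hL : 0 ≤ L) (hd : 0 < d) (ℓ : ℕ) :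
    p ^ ℓ * L ^ ((ℓ : ℝ) / 2) / d ^ ((ℓ : ℝ) / 2 - 1) = d * (p * √L / √d) ^ ℓ := by
  have h : ∀ {a : ℝ}, 0 ≤ a → a ^ ((ℓ : ℝ) / 2) = √a ^ ℓ := fun ha => by
    rw [Real.sqrt_eq_rpow, ← Real.rpow_natCast, ← Real.rpow_mul ha]
    congr 1
    ring
  rw [Real.rpow_sub_one hd.ne', h hL, h hd.le, div_pow, mul_pow]
  field_simp

theorem CapRegime.kpow_edgeKernel_scale_bounds {n : ℕ} {t p L s₀ : ℝ} (H : CapRegime n t p L s₀)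
    (m : ℕ) (x : UnitSphere (n + 2)) :
    1 / 18 ^ (m + 3) * (((n : ℝ) + 2) * (p * √L / √((n : ℝ) + 2)) ^ (m + 3)) ≤
        kpow (uniformSphere (n + 2)) (edgeKernel (n + 2) t p) (m + 2) x x ∧
      kpow (uniformSphere (n + 2)) (edgeKernel (n + 2) t p) (m + 2) x x ≤
        18 ^ (m + 3) * (((n : ℝ) + 2) * (p * √L / √((n : ℝ) + 2)) ^ (m + 3)) := by
  have hp := H.p_pos
  have hL := H.L_ge
  obtain ⟨h1, h2⟩ := H.kpow_edgeKernel_bounds m x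
  obtain ⟨h3, h4⟩ := H.linEig_sq_bounds
  have hl0 := H.linEig_nonneg
  set lam := linEig (edgeKernel (n + 2) t p)
  set w := p * √L / √((n : ℝ) + 2) with hw
  have hw0 : 0 ≤ w := by positivity
  have hd : (0 : ℝ) < (n : ℝ) + 2 := by positivity
  have hw2 : ((n : ℝ) + 2) * w ^ 2 = p ^ 2 * L := by
    rw [hw, div_pow, mul_pow, Real.sq_sqrt hd.le, Real.sq_sqrt (by linarith)]
    field_simp
  clear_value w
  rw [← hw2] at h3 h4
  -- λ² / w² lies between 1/80 and 51, and 80 ≤ 9², 51 ≤ 8².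
  have h5 : w / 9 ≤ lam := by
    refine le_of_pow_le_pow_left₀ two_ne_zero hl0 (le_of_mul_le_mul_left ?_ hd)
    have : 0 ≤ ((n : ℝ) + 2) * w ^ 2 := by positivity
    rw [div_pow]
    linarith
  have h6 : lam ≤ 8 * w := by
    refine le_of_pow_le_pow_left₀ two_ne_zero (by positivity) (le_of_mul_le_mul_left ?_ hd)
    have : 0 ≤ ((n : ℝ) + 2) * w ^ 2 := by positivity
    rw [mul_pow]
    linarith
  constructor
  · refine le_trans ?_ h1
    have h7 : (1 / 2 : ℝ) ^ (m + 3) ≤ 1 / 2 := pow_le_of_le_one (by norm_num) (by norm_num) (by omega)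
    calc 1 / 18 ^ (m + 3) * (((n : ℝ) + 2) * w ^ (m + 3))
        = (1 / 2) ^ (m + 3) * (((n : ℝ) + 2) * (w / 9) ^ (m + 3)) := by
          rw [show (18 : ℝ) = 2 * 9 by norm_num, mul_pow, div_pow, div_pow, one_pow]
          field_simp
      _ ≤ 1 / 2 * (((n : ℝ) + 2) * lam ^ (m + 3)) := by gcongr
  · refine h2.trans ?_
    have h7 : (3 / 2 : ℝ) ≤ (9 / 4) ^ (m + 3) :=
      (by norm_num : (3 / 2 : ℝ) ≤ 9 / 4).trans (le_self_pow₀ (by norm_num) (by omega))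
    calc 3 / 2 * (((n : ℝ) + 2) * lam ^ (m + 3))
        ≤ (9 / 4) ^ (m + 3) * (((n : ℝ) + 2) * (8 * w) ^ (m + 3)) := by gcongr
      _ = 18 ^ (m + 3) * (((n : ℝ) + 2) * w ^ (m + 3)) := by
          rw [show (18 : ℝ) = 9 / 4 * 8 by norm_num, mul_pow, mul_pow]
          ring

end SphereRGG

theorem mainTheorem9 :
    ∃ C : ℝ, 0 < C ∧ ∃ d₀ : ℕ, ∀ (n ℓ d : ℕ) (p : ℝ) (f : Fin ℓ ↪ Fin n),
      3 ≤ ℓ → d₀ ≤ d → 0 < p → p ≤ 1 / 2 → (5 * Real.log (1 / p)) ^ 4 ≤ (d : ℝ) →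
        (1 / C ^ ℓ) * (p ^ ℓ * Real.log (1 / p) ^ ((ℓ : ℝ) / 2) / (d : ℝ) ^ ((ℓ : ℝ) / 2 - 1)) ≤
            ∫ G, SphereRGG.signedWeight p ((SimpleGraph.cycleGraph ℓ).map f) G
              ∂(SphereRGG.randomGeometricGraph n p d) ∧
          ∫ G, SphereRGG.signedWeight p ((SimpleGraph.cycleGraph ℓ).map f) G
              ∂(SphereRGG.randomGeometricGraph n p d) ≤
            C ^ ℓ *
              (p ^ ℓ * Real.log (1 / p) ^ ((ℓ : ℝ) / 2) / (d : ℝ) ^ ((ℓ : ℝ) / 2 - 1)) := by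
  -- 18 = 2 · 9 = (9/4) · 8: the eigenvalue loses a factor 9 or 8 per edge, and the prefactors 1/2
  -- and 3/2 are absorbed into powers of 2 and 9/4. The lower bound on d handles bounded L in
  -- `capRegime_threshold`.
  refine ⟨18, by norm_num, 2 * (2 * 10 ^ 15) ^ 4, fun N ℓ d p f hℓ hd hp0 hp hL => ?_⟩
  obtain ⟨m, rfl⟩ : ∃ m, ℓ = m + 3 := ⟨ℓ - 3, by omega⟩
  obtain ⟨n, rfl⟩ : ∃ n, d = n + 2 :=
    ⟨d - 2, (Nat.sub_add_cancel (le_trans (by norm_num) hd)).symm⟩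
  have hcast : ((n + 2 : ℕ) : ℝ) = (n : ℝ) + 2 := by push_cast; rfl
  rw [hcast] at hL
  have H := SphereRGG.capRegime_threshold hd hp0 hp hL
  have hconst : ∫ a, SphereRGG.kpow (SphereRGG.uniformSphere (n + 2))
      (SphereRGG.edgeKernel (n + 2) (SphereRGG.threshold p (n + 2)) p) (m + 2) a a
        ∂SphereRGG.uniformSphere (n + 2) =
      SphereRGG.kpow (SphereRGG.uniformSphere (n + 2))
        (SphereRGG.edgeKernel (n + 2) (SphereRGG.threshold p (n + 2)) p) (m + 2)
        (SphereRGG.axis 0) (SphereRGG.axis 0) := by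
    have h := fun a => ((SphereRGG.isInvKernel_edgeKernel (n + 2)
      (SphereRGG.threshold p (n + 2)) p).pow (m + 2)).diag a (SphereRGG.axis 0)
    simp only [h]
    simp
  have hL0 : 0 ≤ Real.log (1 / p) := by linarith [H.L_ge]
  rw [SphereRGG.integral_signedWeight_cycle, hconst, hcast,
    SphereRGG.cycle_scale_eq hL0 (by positivity)]
  exact H.kpow_edgeKernel_scale_bounds m _
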